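/- **Setting.** An instance of the square escape problem (SEP) consists of $n\ge 1$ grid points $r_1,\dots,r_n\in\mathbb Z^2$ (not necessarily distinct) in an axis-parallel box $B=[x_0,x_1]\times[y_0,y_1]$ with integer sides. Each point escapes in one of the four directions left, right, down, up; its escape path consists of the grid points from it to its perpendicular projection on the corresponding side of $B$. Let $k$ be the optimal density: the least integer such that directions can be chosen with at most $k$ escape paths through every grid point of $B$ (boundary included). Let $L_r$ be the set of the (at most four) perpendicular projections of $r$ on the sides of $B$. **Algorithm approx.** Compute all the sets $L_r$. For $k_B=1,2,\dots,n$: build the bipartite graph $G_{k_B}$ whose first side is the set of the $n$ input points, whose second side is $\left(\bigcup_r L_r\right)\times\{1,\dots,k_B\}$, and in which $r$ is joined to $(v,i)$ exactly if $v\in L_r$; compute a maximum matching $M$ of $G_{k_B}$; if $|M|=n$, leave the loop. Return $k_B$ and, for each point, a direction in which its projection is (the boundary point of) its partner in $M$. **Theorem.** The algorithm can be implemented on a unit-cost random access machine (integer registers and integer-indexed arrays of integers, all of them 0 initially except for the input; every addition, subtraction, comparison, memory access and branching takes one step), with a subroutine that computes a maximum matching of every bipartite graph given by adjacency lists, such that,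 for an absolute constant $C$ and all instances with $n\ge1$: 1. the algorithm halts after at most $C\,n^{3/2}k^2$ steps, and it returns the least $k_B\ge1$ for which $G_{k_B}$ has a matching of size $n$, together with directions given by such a matching; 2. the loop has at most $k$ iterations; 3. in each iteration, the graph $G_{k_B}=(V,E)$ that is built has $|E|\le 4kn$ edges, and the maximum matching of it is computed in at most $C\sqrt n\,|E|$ steps, hence in $O(\sqrt{|V|}\,|E|)$ steps, and in at most $C\,kn\sqrt n$ steps. -/

import Mathlib

/-! ## A unit-cost random access machine with structured programs

Registers and the cells of arrays hold integers. The only arithmetic operations are addition and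
subtraction. Every evaluated node of an expression or a test, every write and every branching
costs one step. -/

namespace RAM

/-- A memory state: registers `reg x`, and arrays `arr a` with cells `arr a i`. -/
structure State where
  reg : ℕ → ℤ
  arr : ℕ → ℤ → ℤ

namespace State

def setReg (s : State) (x : ℕ) (v : ℤ) : State :=
  { s with reg := Function.update s.reg x v }

def setArr (s : State) (a : ℕ) (i v : ℤ) : State :=
  { s with arr := Function.update s.arr a (Function.update (s.arr a) i v) }

end State

/-- Integer expressions: literals, registers, array cells, sums and differences. -/
inductive Expr where
  | lit (z : ℤ)
  | reg (x : ℕ)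
  | get (a : ℕ) (i : Expr)
  | add (e f : Expr)
  | sub (e f : Expr)

namespace Expr

def eval : Expr → State → ℤ
  | lit z, _ => z
  | reg x, s => s.reg x
  | get a i, s => s.arr a (i.eval s)
  | add e f, s => e.eval s + f.eval s
  | sub e f, s => e.eval s - f.eval s

/-- The number of steps needed to evaluate an expression. -/
def cost : Expr → ℕ
  | lit _ => 1
  | reg _ => 1
  | get _ i => i.cost + 1
  | add e f => e.cost + f.cost + 1
  | sub e f => e.cost + f.cost + 1

end Expr

/-- Tests. -/
inductive Test where
  | lt (e f : Expr)
  | eq (e f : Expr)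
  | not (b : Test)
  | and (b c : Test)

namespace Test

def Holds : Test → State → Prop
  | lt e f, s => e.eval s < f.eval s
  | eq e f, s => e.eval s = f.eval s
  | not b, s => ¬ b.Holds s
  | and b c, s => b.Holds s ∧ c.Holds s

/-- The number of steps needed to evaluate a test. -/
def cost : Test → ℕ
  | lt e f => e.cost + f.cost + 1
  | eq e f => e.cost + f.cost + 1
  | not b => b.cost + 1
  | and b c => b.cost + c.cost + 1

end Test

/-- Programs. -/
inductive Prog where
  | assign (x : ℕ) (e : Expr)
  | store (a : ℕ) (i e : Expr)
  | seq (p q : Prog)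
  | ite (b : Test) (p q : Prog)
  | while (b : Test) (p : Prog)

/-- `Exec p s t s'`: the program `p`, started in `s`, halts in `s'` after exactly `t` steps. -/
inductive Exec : Prog → State → ℕ → State → Prop
  | assign (x : ℕ) (e : Expr) (s : State) :
      Exec (.assign x e) s (e.cost + 1) (s.setReg x (e.eval s))
  | store (a : ℕ) (i e : Expr) (s : State) :
      Exec (.store a i e) s (i.cost + e.cost + 1) (s.setArr a (i.eval s) (e.eval s))
  | seq {p q : Prog} {s s' s'' : State} {t t' : ℕ} :
      Exec p s t s' → Exec q s' t' s'' → Exec (.seq p q) s (t + t') s''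
  | ite_true {b : Test} {p q : Prog} {s s' : State} {t : ℕ} :
      b.Holds s → Exec p s t s' → Exec (.ite b p q) s (b.cost + 1 + t) s'
  | ite_false {b : Test} {p q : Prog} {s s' : State} {t : ℕ} :
      ¬ b.Holds s → Exec q s t s' → Exec (.ite b p q) s (b.cost + 1 + t) s'
  | while_true {b : Test} {p : Prog} {s s' s'' : State} {t t' : ℕ} :
      b.Holds s → Exec p s t s' → Exec (.while b p) s' t' s'' →
      Exec (.while b p) s (b.cost + 1 + t + t') s''
  | while_false {b : Test} {p : Prog} {s : State} :
      ¬ b.Holds s → Exec (.while b p) s (b.cost + 1) s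

end RAM

infixr:60 " ;; " => RAM.Prog.seq

/-! ## Matchings in bipartite graphs

A bipartite graph is given by the finite set of its edges, each of which is a pair of a vertex of
the first side and a vertex of the second side. -/

namespace Bipartite

variable {α β : Type*}

/-- `M` is a set of edges of `E`, no two of which share an endpoint. -/
def IsMatching (E M : Finset (α × β)) : Prop :=
  M ⊆ E ∧ ∀ e ∈ M, ∀ f ∈ M, e.1 = f.1 ∨ e.2 = f.2 → e = f

def IsMaximumMatching (E M : Finset (α × β)) : Prop :=
  IsMatching E M ∧ ∀ M' : Finset (α × β), IsMatching E M' → M'.card ≤ M.card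

end Bipartite

/-! ## The square escape problem -/

/-- The four escape directions. -/
inductive Dir where
  | left
  | right
  | down
  | up

/-- An instance of the square escape problem with `n` points: grid points, not necessarily
distinct, inside the axis-parallel box with sides `x = x0`, `x = x1`, `y = y0` and `y = y1`. -/
structure SEP (n : ℕ) where
  pt : Fin n → ℤ × ℤ
  x0 : ℤ
  x1 : ℤ
  y0 : ℤ
  y1 : ℤ
  inside : ∀ u, x0 ≤ (pt u).1 ∧ (pt u).1 ≤ x1 ∧ y0 ≤ (pt u).2 ∧ (pt u).2 ≤ y1

namespace SEP

variable {n : ℕ} (I : SEP n)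

/-- The perpendicular projection of a point on the side of the box in direction `d`. -/
def proj (u : Fin n) : Dir → ℤ × ℤ
  | .left => (I.x0, (I.pt u).2)
  | .right => (I.x1, (I.pt u).2)
  | .down => ((I.pt u).1, I.y0)
  | .up => ((I.pt u).1, I.y1)

/-- The escape path of a point in direction `d`: the grid points from it to its projection. -/
def path (u : Fin n) : Dir → Set (ℤ × ℤ)
  | .left => {c | c.2 = (I.pt u).2 ∧ I.x0 ≤ c.1 ∧ c.1 ≤ (I.pt u).1}
  | .right => {c | c.2 = (I.pt u).2 ∧ (I.pt u).1 ≤ c.1 ∧ c.1 ≤ I.x1}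
  | .down => {c | c.1 = (I.pt u).1 ∧ I.y0 ≤ c.2 ∧ c.2 ≤ (I.pt u).2}
  | .up => {c | c.1 = (I.pt u).1 ∧ (I.pt u).2 ≤ c.2 ∧ c.2 ≤ I.y1}

/-- The number of escape paths that pass through `c`, if the point `u` escapes in direction
`o u`. -/
noncomputable def load (o : Fin n → Dir) (c : ℤ × ℤ) : ℕ :=
  {u : Fin n | c ∈ I.path u (o u)}.ncard

/-- The optimal density `k`: the least `d` such that all points can escape with at most `d`
escape paths through each grid point of the box, its boundary included. (The infimum is over a
nonempty set, since `d = n` always suffices.) -/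
noncomputable def optDensity : ℕ :=
  sInf {d : ℕ | ∃ o : Fin n → Dir, ∀ c : ℤ × ℤ, I.load o c ≤ d}

/-- `L_u`, the set of the projections of the point `u` on the sides of the box. -/
def projections (u : Fin n) : Finset (ℤ × ℤ) :=
  {I.proj u .left, I.proj u .right, I.proj u .down, I.proj u .up}

/-- The second side of the bipartite graph: `j` copies of every projection. -/
def copies (j : ℕ) : Finset ((ℤ × ℤ) × Fin j) :=
  (Finset.univ.biUnion I.projections) ×ˢ Finset.univ

/-- The edges of the bipartite graph `G` for `k_B = j`: every point is joined to all `j` copies of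
each of its projections. -/
def edges (j : ℕ) : Finset (Fin n × ((ℤ × ℤ) × Fin j)) :=
  Finset.univ.biUnion fun u =>
    (I.projections u ×ˢ Finset.univ).image fun v => (u, v)

end SEP

/-! ## The algorithm -/

namespace Approx

open RAM

/-! Names of registers. -/

/-- The number of points. -/
abbrev rN : ℕ := 0
/-- The sides of the box. -/
abbrev rX0 : ℕ := 1
abbrev rX1 : ℕ := 2
abbrev rY0 : ℕ := 3
abbrev rY1 : ℕ := 4
/-- The number of distinct projections that have been found. -/
abbrev rM : ℕ := 5
/-- The current value of `k_B`. -/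
abbrev rK : ℕ := 6
/-- The number of vertices on the first side of the current bipartite graph. -/
abbrev rL : ℕ := 7
/-- The number of vertices on the second side of the current bipartite graph. -/
abbrev rR : ℕ := 8
/-- The size of the computed matching. -/
abbrev rSize : ℕ := 9
/-! Auxiliary registers. -/
abbrev rU : ℕ := 10
abbrev rI : ℕ := 11
abbrev rBase : ℕ := 12
abbrev rP : ℕ := 13
abbrev rA : ℕ := 14
abbrev rB : ℕ := 15
abbrev rW : ℕ := 16

/-! Names of arrays. -/

/-- The coordinates of the points. -/
abbrev aX : ℕ := 0
abbrev aY : ℕ := 1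
/-- Tables with the numbers of the boundary points on the four sides of the box
(0: not numbered yet). -/
abbrev aTabLeft : ℕ := 2
abbrev aTabRight : ℕ := 3
abbrev aTabDown : ℕ := 4
abbrev aTabUp : ℕ := 5
/-- The indices `0, 1, 2, …` of the four projections of each point. -/
abbrev aLeft : ℕ := 6
abbrev aRight : ℕ := 7
abbrev aDown : ℕ := 8
abbrev aUp : ℕ := 9
/-- The adjacency lists of the current bipartite graph: the neighbours of `u` are
the entries `adj[off[u]], …, adj[off[u+1] - 1]`. -/
abbrev aOff : ℕ := 10
abbrev aAdj : ℕ := 11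
/-- The computed matching: the partner of each vertex of the first side, or `-1`. -/
abbrev aMate : ℕ := 12
/-- The directions that are returned. -/
abbrev aOut : ℕ := 13

/-- The registers and the arrays with a number below `reserved` belong to the main program; all
others are working memory of the matching subroutine. -/
abbrev reserved : ℕ := 32

/-- `for x = 0, …, y - 1 do p`, where `x` and `y` are registers. -/
def forRange (x y : ℕ) (p : Prog) : Prog :=
  .assign x (.lit 0) ;;
  .while (.lt (.reg x) (.reg y)) (p ;; .assign x (.add (.reg x) (.lit 1)))

/-- Look up the number of a boundary point in the table `tab`, with the register `key` as index;
give the boundary point the next free number if it has none. Write its index to `dest[u]`. -/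
def lookup (tab key dest : ℕ) : Prog :=
  .ite (.eq (.get tab (.reg key)) (.lit 0))
    (.assign rM (.add (.reg rM) (.lit 1)) ;; .store tab (.reg key) (.reg rM))
    (.assign rM (.reg rM)) ;;
  .store dest (.reg rU) (.sub (.get tab (.reg key)) (.lit 1))

/-- Number the boundary point with coordinates `a` and `b` (two expressions) and write its index
to `dest[u]`. The table and the key depend only on the boundary point, so that a corner of the box
gets one number only. -/
def number (a b : Expr) (dest : ℕ) : Prog :=
  .assign rA a ;;
  .assign rB b ;;
  .ite (.eq (.reg rA) (.reg rX0)) (lookup aTabLeft rB dest)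
    (.ite (.eq (.reg rA) (.reg rX1)) (lookup aTabRight rB dest)
      (.ite (.eq (.reg rB) (.reg rY0)) (lookup aTabDown rA dest)
        (lookup aTabUp rA dest)))

/-- Compute the projections of all points. -/
def setup : Prog :=
  .assign rM (.lit 0) ;;
  forRange rU rN
    (number (.reg rX0) (.get aY (.reg rU)) aLeft ;;
     number (.reg rX1) (.get aY (.reg rU)) aRight ;;
     number (.get aX (.reg rU)) (.reg rY0) aDown ;;
     number (.get aX (.reg rU)) (.reg rY1) aUp)

/-- Append copy `i` of the projection of the point `u` with index `id[u]` to the adjacency list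
of `u`. Copy `i` of the boundary point with index `v` is the vertex `v + i * m`, where `m` is the
number of boundary points; the register `base` contains `i * m`. -/
def addEdge (id : ℕ) : Prog :=
  .store aAdj (.reg rP) (.add (.get id (.reg rU)) (.reg rBase)) ;;
  .assign rP (.add (.reg rP) (.lit 1))

/-- Build the bipartite graph `G` for the current value of `k_B`. -/
def buildGraph : Prog :=
  .assign rL (.reg rN) ;;
  .assign rR (.lit 0) ;;
  forRange rI rK (.assign rR (.add (.reg rR) (.reg rM))) ;;
  .assign rP (.lit 0) ;;
  forRange rU rN
    (.store aOff (.reg rU) (.reg rP) ;;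
     .assign rBase (.lit 0) ;;
     forRange rI rK
      (addEdge aLeft ;; addEdge aRight ;; addEdge aDown ;; addEdge aUp ;;
       .assign rBase (.add (.reg rBase) (.reg rM)))) ;;
  .store aOff (.reg rN) (.reg rP)

/-- Read off the escape directions `0, 1, 2, 3` (left, right, down, up) from the matching. -/
def extract : Prog :=
  forRange rU rN
    (.assign rW (.get aMate (.reg rU)) ;;
     .while (.not (.lt (.reg rW) (.reg rM))) (.assign rW (.sub (.reg rW) (.reg rM))) ;;
     .ite (.eq (.reg rW) (.get aLeft (.reg rU))) (.store aOut (.reg rU) (.lit 0))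
      (.ite (.eq (.reg rW) (.get aRight (.reg rU))) (.store aOut (.reg rU) (.lit 1))
        (.ite (.eq (.reg rW) (.get aDown (.reg rU))) (.store aOut (.reg rU) (.lit 2))
          (.store aOut (.reg rU) (.lit 3)))))

/-- Everything before the main loop. -/
def prologue : Prog :=
  setup ;; .assign rK (.lit 0) ;; .assign rSize (.lit (-1))

/-- The main loop goes on as long as `k_B < n` and no matching of size `n` has been found. -/
def loopTest : Test :=
  .and (.lt (.reg rK) (.reg rN)) (.not (.eq (.reg rSize) (.reg rN)))

/-- The part of an iteration of the main loop that precedes the computation of a matching. -/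
def prepare : Prog :=
  .assign rK (.add (.reg rK) (.lit 1)) ;; buildGraph

/-- The algorithm, with the program `mm` as its subroutine for maximum matchings. -/
def approx (mm : Prog) : Prog :=
  prologue ;; .while loopTest (prepare ;; mm) ;; extract

/-- The initial state: the input, and zeros. -/
def init {n : ℕ} (I : SEP n) : State where
  reg := fun x =>
    if x = rN then n else if x = rX0 then I.x0 else if x = rX1 then I.x1
    else if x = rY0 then I.y0 else if x = rY1 then I.y1 else 0
  arr := fun a i =>
    if h : 0 ≤ i ∧ i.toNat < n then
      if a = aX then (I.pt ⟨i.toNat, h.2⟩).1 else if a = aY then (I.pt ⟨i.toNat, h.2⟩).2 else 0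
    else 0

/-- The state contains the bipartite graph with sides `{0, …, a - 1}` and `{0, …, b - 1}` and edge
set `E`, in the form of adjacency lists. -/
structure HoldsGraph (s : State) (a b : ℕ) (E : Finset (ℕ × ℕ)) : Prop where
  left : s.reg rL = a
  right : s.reg rR = b
  off_zero : s.arr aOff 0 = 0
  off_mono : ∀ u : ℕ, u < a → s.arr aOff u ≤ s.arr aOff (u + 1)
  adj_range : ∀ p : ℤ, 0 ≤ p → p < s.arr aOff a → 0 ≤ s.arr aAdj p ∧ s.arr aAdj p < b
  mem_iff : ∀ u v : ℕ, (u, v) ∈ E ↔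
    u < a ∧ ∃ p : ℤ, s.arr aOff u ≤ p ∧ p < s.arr aOff (u + 1) ∧ s.arr aAdj p = v

/-- The state contains the matching `M` of a graph whose first side is `{0, …, a - 1}`. -/
structure HoldsMatching (s : State) (a : ℕ) (M : Finset (ℕ × ℕ)) : Prop where
  size : s.reg rSize = M.card
  mem_iff : ∀ u : ℕ, u < a → ∀ v : ℕ, (u, v) ∈ M ↔ s.arr aMate u = v
  unmatched : ∀ u : ℕ, u < a → (∀ v : ℕ, (u, v) ∉ M) → s.arr aMate u = -1

/-- `mm` is a correct subroutine for maximum matchings in bipartite graphs: in every state that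
contains a bipartite graph, it halts with a maximum matching of this graph, and the memory of the
main program is not changed otherwise. -/
def ComputesMaximumMatchings (mm : Prog) : Prop :=
  ∀ (s : State) (a b : ℕ) (E : Finset (ℕ × ℕ)), HoldsGraph s a b E →
    ∃ (t : ℕ) (s' : State) (M : Finset (ℕ × ℕ)), Exec mm s t s' ∧
      Bipartite.IsMaximumMatching E M ∧ HoldsMatching s' a M ∧
      (∀ x < reserved, x ≠ rSize → s'.reg x = s.reg x) ∧
      (∀ x < reserved, x ≠ aMate → s'.arr x = s.arr x)

/-- `AtLoop mm I j s`: in the run of the algorithm on `I`, the state is `s` after `j` iterations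
of the main loop. -/
inductive AtLoop (mm : Prog) {n : ℕ} (I : SEP n) : ℕ → State → Prop
  | start {t : ℕ} {s : State} : Exec prologue (init I) t s → AtLoop mm I 0 s
  | step {j t : ℕ} {s s' : State} : AtLoop mm I j s → loopTest.Holds s →
      Exec (prepare ;; mm) s t s' → AtLoop mm I (j + 1) s'

/-- The state contains the bipartite graph `G` of the instance for `k_B = j`, for some numbering
`φ` of the vertices of its second side. -/
def HoldsInstanceGraph {n : ℕ} (I : SEP n) (j : ℕ) (s : State) : Prop :=
  ∃ (b : ℕ) (φ : (ℤ × ℤ) × Fin j → ℕ),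
    Set.BijOn φ (I.copies j : Set ((ℤ × ℤ) × Fin j)) (Set.Iio b) ∧
    HoldsGraph s n b ((I.edges j).image fun e => ((e.1 : ℕ), φ e.2))

/-- The code of a direction in the output. -/
def dirCode : Dir → ℤ
  | .left => 0
  | .right => 1
  | .down => 2
  | .up => 3

/-- The state contains a correct output: the least `K ≥ 1` for which the bipartite graph has a
matching of size `n`, and the directions of the escape paths to the partners in such a
matching. -/
def HoldsOutput {n : ℕ} (I : SEP n) (s : State) : Prop :=
  ∃ (K : ℕ) (M : Finset (Fin n × ((ℤ × ℤ) × Fin K))) (o : Fin n → Dir),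
    IsLeast {j : ℕ | 1 ≤ j ∧ ∃ M' : Finset (Fin n × ((ℤ × ℤ) × Fin j)),
      Bipartite.IsMatching (I.edges j) M' ∧ M'.card = n} K ∧
    Bipartite.IsMatching (I.edges K) M ∧ M.card = n ∧
    (∀ u, ∃ i, (u, (I.proj u (o u), i)) ∈ M) ∧
    s.reg rK = K ∧ ∀ u : Fin n, s.arr aOut (u : ℕ) = dirCode (o u)

end Approx

/-! The combinatorial core is one remark: the projection of a point lies on its escape path. In an
escape of density `k`, at most `k` points therefore end in the same boundary point, so for `j ≥ k`
they can be given different copies of it. Hence the graph for `j` has a matching of size `n`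
(`SEP.exists_matching`), and the loop ends by iteration `k`. In iteration `j` the lists have `4jn`
entries, the second side has at most `4jn` vertices, and the graph has at least `jn` edges. A
matching routine that needs `O(√n)` times the size of its input thus takes `O(√n |E|)` steps per
iteration, and `k` iterations cost `O(n^{3/2} k²)`.

The routine works with prices. Let `a` be the size of the first side and `L` about `√a`, with `a ≤
L²`. Each vertex `x` of the first side has a level below `L`. It takes a neighbour whose price
equals its level, evicts the former partner if there is one, and raises the price by one; when its
list is exhausted, its level rises, and at the last level it gives up. Thus every list is scanned at
most `L` times. Levels never exceed the prices of neighbours, the partner of `x` has price at most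
one above the level of `x`, and a vertex that has given up sees only prices at least `L`.

Positive prices occur only at matched vertices, of which there are at most `L²`, so some `t` in `1,
…, L` is the price of at most `L` vertices. The vertices with a neighbour cheaper than `t`, together
with the vertices of price at least `t`, form a cover; charged to the matching, it exceeds the size
of the matching by at most `L` (`Bidding.card_le`). By weak duality at most `L` augmentations
remain. Each is found by a linear-time search from all unmatched vertices, and the search that fails
leaves König's cover as a certificate (`Searching.card_le`).

Programs are treated with `WP`, total correctness together with a step count. In `wp_while` a single
potential proves termination and pays for the steps. Determinism carries the results from the run
that is constructed to all runs that `AtLoop` describes. -/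

namespace RAM

/-! ## Program logic -/

/-- Needed because `AtLoop` speaks of every run, while the program logic only exhibits one. -/
theorem Exec.deterministic {p : Prog} {s s₁ : State} {t₁ : ℕ} (h₁ : Exec p s t₁ s₁) :
    ∀ {t₂ : ℕ} {s₂ : State}, Exec p s t₂ s₂ → t₁ = t₂ ∧ s₁ = s₂ := by
  induction h₁ with
  | assign x e s => intro t₂ s₂ h; cases h; exact ⟨rfl, rfl⟩
  | store a i e s => intro t₂ s₂ h; cases h; exact ⟨rfl, rfl⟩
  | seq _ _ ihp ihq =>
    intro t₂ s₂ h
    cases h with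
    | seq h h' =>
      obtain ⟨rfl, rfl⟩ := ihp h
      obtain ⟨rfl, rfl⟩ := ihq h'
      exact ⟨rfl, rfl⟩
  | ite_true hb _ ih =>
    intro t₂ s₂ h
    cases h with
    | ite_true _ h => obtain ⟨rfl, rfl⟩ := ih h; exact ⟨rfl, rfl⟩
    | ite_false hb' _ => exact absurd hb hb'
  | ite_false hb _ ih =>
    intro t₂ s₂ h
    cases h with
    | ite_true hb' _ => exact absurd hb' hb
    | ite_false _ h => obtain ⟨rfl, rfl⟩ := ih h; exact ⟨rfl, rfl⟩
  | while_true hb _ _ ihp ihw =>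
    intro t₂ s₂ h
    cases h with
    | while_true _ h h' =>
      obtain ⟨rfl, rfl⟩ := ihp h
      obtain ⟨rfl, rfl⟩ := ihw h'
      exact ⟨rfl, rfl⟩
    | while_false hb' => exact absurd hb hb'
  | while_false hb =>
    intro t₂ s₂ h
    cases h with
    | while_true hb' _ _ => exact absurd hb' hb
    | while_false _ => exact ⟨rfl, rfl⟩

/-- The registers that a program may write. -/
def Prog.regs : Prog → Finset ℕ
  | .assign x _ => {x}
  | .store _ _ _ => ∅
  | .seq p q => p.regs ∪ q.regs
  | .ite _ p q => p.regs ∪ q.regs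
  | .while _ p => p.regs

/-- The arrays that a program may write. -/
def Prog.arrs : Prog → Finset ℕ
  | .assign _ _ => ∅
  | .store a _ _ => {a}
  | .seq p q => p.arrs ∪ q.arrs
  | .ite _ p q => p.arrs ∪ q.arrs
  | .while _ p => p.arrs

theorem Exec.reg_eq {p : Prog} {s s' : State} {t : ℕ} (h : Exec p s t s') {x : ℕ}
    (hx : x ∉ p.regs) : s'.reg x = s.reg x := by
  induction h with
  | assign y e s =>
    simp only [Prog.regs, Finset.mem_singleton] at hx
    simp [State.setReg, hx]
  | store => rfl
  | seq _ _ ihp ihq =>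
    simp only [Prog.regs, Finset.mem_union, not_or] at hx
    rw [ihq hx.2, ihp hx.1]
  | ite_true _ _ ih => exact ih fun h => hx (Finset.mem_union_left _ h)
  | ite_false _ _ ih => exact ih fun h => hx (Finset.mem_union_right _ h)
  | while_true _ _ _ ihp ihw => rw [ihw hx, ihp hx]
  | while_false => rfl

theorem Exec.arr_eq {p : Prog} {s s' : State} {t : ℕ} (h : Exec p s t s') {x : ℕ}
    (hx : x ∉ p.arrs) : s'.arr x = s.arr x := by
  induction h with
  | assign => rfl
  | store a i e s =>
    simp only [Prog.arrs, Finset.mem_singleton] at hx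
    simp [State.setArr, hx]
  | seq _ _ ihp ihq =>
    simp only [Prog.arrs, Finset.mem_union, not_or] at hx
    rw [ihq hx.2, ihp hx.1]
  | ite_true _ _ ih => exact ih fun h => hx (Finset.mem_union_left _ h)
  | ite_false _ _ ih => exact ih fun h => hx (Finset.mem_union_right _ h)
  | while_true _ _ _ ihp ihw => rw [ihw hx, ihp hx]
  | while_false => rfl

theorem State.setReg_reg (s : State) (x : ℕ) (v : ℤ) (y : ℕ) :
    (s.setReg x v).reg y = if y = x then v else s.reg y := by
  simp [State.setReg, Function.update_apply]

theorem State.setReg_arr (s : State) (x : ℕ) (v : ℤ) : (s.setReg x v).arr = s.arr := rfl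

theorem State.setArr_reg (s : State) (a : ℕ) (i v : ℤ) : (s.setArr a i v).reg = s.reg := rfl

theorem State.setArr_arr (s : State) (a : ℕ) (i v : ℤ) (b : ℕ) :
    (s.setArr a i v).arr b = if b = a then Function.update (s.arr a) i v else s.arr b := by
  simp [State.setArr, Function.update_apply]

/-- The program `p`, started in `s`, halts, and its running time and its final state
satisfy `Q`. -/
def WP (p : Prog) (s : State) (Q : ℕ → State → Prop) : Prop :=
  ∃ t s', Exec p s t s' ∧ Q t s'

theorem WP.mono {p : Prog} {s : State} {Q R : ℕ → State → Prop} (h : WP p s Q)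
    (hQR : ∀ t s', Q t s' → R t s') : WP p s R :=
  let ⟨t, s', he, hq⟩ := h
  ⟨t, s', he, hQR t s' hq⟩

/-- A postcondition may use that registers and arrays that do not occur on the left-hand side
of an assignment keep their contents. -/
theorem WP.mono_frame {p : Prog} {s : State} {Q R : ℕ → State → Prop} (h : WP p s Q)
    (hQR : ∀ t s', (∀ x, x ∉ p.regs → s'.reg x = s.reg x) →
      (∀ x, x ∉ p.arrs → s'.arr x = s.arr x) → Q t s' → R t s') : WP p s R :=
  let ⟨t, s', he, hq⟩ := h
  ⟨t, s', he, hQR t s' (fun _ => he.reg_eq) (fun _ => he.arr_eq) hq⟩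

theorem wp_assign {x : ℕ} {e : Expr} {s : State} {Q : ℕ → State → Prop} :
    WP (.assign x e) s Q ↔ Q (e.cost + 1) (s.setReg x (e.eval s)) :=
  ⟨fun ⟨_, _, he, hq⟩ => by cases he; exact hq, fun h => ⟨_, _, .assign x e s, h⟩⟩

theorem wp_store {a : ℕ} {i e : Expr} {s : State} {Q : ℕ → State → Prop} :
    WP (.store a i e) s Q ↔ Q (i.cost + e.cost + 1) (s.setArr a (i.eval s) (e.eval s)) :=
  ⟨fun ⟨_, _, he, hq⟩ => by cases he; exact hq, fun h => ⟨_, _, .store a i e s, h⟩⟩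

theorem wp_seq {p q : Prog} {s : State} {Q : ℕ → State → Prop} :
    WP (p ;; q) s Q ↔ WP p s fun t s' => WP q s' fun t' s'' => Q (t + t') s'' := by
  constructor
  · rintro ⟨_, _, he, hq⟩
    cases he with
    | seq h h' => exact ⟨_, _, h, _, _, h', hq⟩
  · rintro ⟨_, _, h, _, _, h', hq⟩
    exact ⟨_, _, .seq h h', hq⟩

theorem wp_ite {b : Test} {p q : Prog} {s : State} {Q : ℕ → State → Prop} :
    WP (.ite b p q) s Q ↔ (b.Holds s → WP p s fun t s' => Q (b.cost + 1 + t) s') ∧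
      (¬ b.Holds s → WP q s fun t s' => Q (b.cost + 1 + t) s') := by
  constructor
  · rintro ⟨_, _, he, hq⟩
    cases he with
    | ite_true hb h => exact ⟨fun _ => ⟨_, _, h, hq⟩, fun hb' => absurd hb hb'⟩
    | ite_false hb h => exact ⟨fun hb' => absurd hb' hb, fun _ => ⟨_, _, h, hq⟩⟩
  · rintro ⟨h₁, h₂⟩
    by_cases hb : b.Holds s
    · obtain ⟨_, _, h, hq⟩ := h₁ hb
      exact ⟨_, _, .ite_true hb h, hq⟩
    · obtain ⟨_, _, h, hq⟩ := h₂ hb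
      exact ⟨_, _, .ite_false hb h, hq⟩

/-- The rule for loops, with an invariant and a potential that pays for the steps. -/
theorem wp_while {b : Test} {p : Prog} (Inv : State → Prop) (Φ : State → ℤ)
    (nonneg : ∀ s, Inv s → 0 ≤ Φ s)
    (step : ∀ s, Inv s → b.Holds s →
      WP p s fun t s' => Inv s' ∧ (t : ℤ) + b.cost + 1 + Φ s' ≤ Φ s)
    {s : State} (hs : Inv s) :
    WP (.while b p) s fun t s' =>
      Inv s' ∧ ¬ b.Holds s' ∧ (t : ℤ) + Φ s' ≤ Φ s + b.cost + 1 := by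
  -- Every iteration lowers the integer potential by at least one, and the invariant keeps it
  -- nonnegative, so induction on a natural bound for it terminates.
  obtain ⟨N, hN⟩ : ∃ N : ℕ, Φ s ≤ N := ⟨(Φ s).toNat, Int.self_le_toNat _⟩
  induction N using Nat.strong_induction_on generalizing s with
  | _ N ih =>
    by_cases hb : b.Holds s
    · obtain ⟨t, s', he, hi, ht⟩ := step s hs hb
      have h0 := nonneg s' hi
      obtain ⟨t', s'', he', hi', hb', ht'⟩ := ih (Φ s').toNat (by omega) hi (by omega)
      refine ⟨_, _, .while_true hb he he', hi', hb', ?_⟩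
      push_cast
      linarith
    · exact ⟨_, _, .while_false hb, hs, hb, by push_cast; linarith⟩

/-- The rule for counting loops, with an invariant and a potential that pays for the steps
beyond the first `T` of each iteration. -/
theorem wp_forRange {x y : ℕ} {p : Prog} (N : ℕ) (Inv : ℕ → State → Prop) (Φ : State → ℤ)
    (T : ℤ)
    (step : ∀ i s, i < N → Inv i s → s.reg x = i → s.reg y = N →
      WP p s fun t s' => s'.reg x = i ∧ s'.reg y = N ∧
        Inv (i + 1) (s'.setReg x (i + 1)) ∧ (t : ℤ) + Φ (s'.setReg x (i + 1)) ≤ Φ s + T)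
    {s : State} (hxy : x ≠ y) (hy : s.reg y = N) (hs : Inv 0 (s.setReg x 0)) :
    WP (Approx.forRange x y p) s fun t s' => Inv N s' ∧ s'.reg x = N ∧ s'.reg y = N ∧
      (t : ℤ) + Φ s' ≤ Φ (s.setReg x 0) + N * (T + 8) + 6 := by
  -- The overhead: 4 steps for the test and 4 for the increment in each iteration, 4 for the last
  -- failing test, 2 for the initial assignment. This gives the constants `8` and `6`.
  have main : ∀ (k i : ℕ) (s : State), k + i = N → Inv i s → s.reg x = i → s.reg y = N →
      WP (.while (.lt (.reg x) (.reg y)) (p ;; .assign x (.add (.reg x) (.lit 1)))) s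
        fun t s' => Inv N s' ∧ s'.reg x = N ∧ s'.reg y = N ∧
          (t : ℤ) + Φ s' ≤ Φ s + k * (T + 8) + 4 := by
    intro k
    induction k with
    | zero =>
      intro i s hi hinv hx hy
      obtain rfl : i = N := by omega
      refine ⟨_, _, .while_false ?_, hinv, hx, hy, ?_⟩
      · simp [Test.Holds, Expr.eval, hx, hy]
      · simp [Test.cost, Expr.cost]; linarith
    | succ k ih =>
      intro i s hi hinv hx hy
      obtain ⟨t, s', he, hx', hy', hinv', ht⟩ := step i s (by omega) hinv hx hy
      obtain ⟨t', s'', he', hinv'', hx'', hy'', ht'⟩ := ih (i + 1) (s'.setReg x (i + 1))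
        (by omega) hinv' (by simp [State.setReg_reg])
        (by simp [State.setReg_reg, hxy.symm, hy'])
      refine ⟨_, _, .while_true (t := t + 4) (t' := t') ?_ (.seq he ?_) he', hinv'', hx'', hy'', ?_⟩
      · simp [Test.Holds, Expr.eval, hx, hy]; omega
      · have := Exec.assign x (.add (.reg x) (.lit 1)) s'
        simpa [Expr.eval, Expr.cost, hx'] using this
      · simp [Test.cost, Expr.cost]; linarith
  rw [Approx.forRange, wp_seq, wp_assign]
  refine (main N 0 _ (by omega) hs (by simp [State.setReg_reg])
    (by simp [State.setReg_reg, hxy.symm, hy])).mono ?_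
  rintro t s' ⟨h1, h2, h3, h4⟩
  refine ⟨h1, h2, h3, ?_⟩
  simp only [Expr.cost] at h4 ⊢
  push_cast
  linarith

end RAM

/-! ### Weak duality between matchings and vertex covers -/

namespace Bipartite

/-- Weak duality: a vertex cover is at least as large as any matching. -/
theorem IsMatching.card_le_of_cover {E M : Finset (ℕ × ℕ)} (hM : IsMatching E M)
    (S T : Finset ℤ) (cover : ∀ u v : ℕ, (u, v) ∈ E → (u : ℤ) ∈ S ∨ (v : ℤ) ∈ T) :
    M.card ≤ S.card + T.card := by
  classical
  rw [← Finset.card_filter_add_card_filter_not (s := M) (fun e => (e.1 : ℤ) ∈ S)]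
  refine add_le_add
    (Finset.card_le_card_of_injOn (fun e => (e.1 : ℤ)) (fun e he => ?_) fun e he f hf h => ?_)
    (Finset.card_le_card_of_injOn (fun e => (e.2 : ℤ)) (fun e he => ?_) fun e he f hf h => ?_)
  · simp only [Finset.coe_filter, Set.mem_ofPred_eq] at he
    exact he.2
  · simp only [Finset.coe_filter, Set.mem_ofPred_eq] at he hf
    exact hM.2 e he.1 f hf.1 (Or.inl (Int.ofNat_inj.1 h))
  · simp only [Finset.coe_filter, Set.mem_ofPred_eq] at he
    exact (cover e.1 e.2 (hM.1 he.1)).resolve_left he.2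
  · simp only [Finset.coe_filter, Set.mem_ofPred_eq] at he hf
    exact hM.2 e he.1 f hf.1 (Or.inr (Int.ofNat_inj.1 h))

end Bipartite

/-! ### The data of the matching algorithm -/

namespace Matching

/-- Used to follow potentials and counts through a single array update; the form without subtraction
serves `ℕ` and `ℤ` alike. -/
theorem sum_add_eq_of_eq_off {M : Type*} [AddCommMonoid M] {s : Finset ℤ} {f g : ℤ → M} {u : ℤ}
    (hu : u ∈ s) (h : ∀ x : ℤ, x ≠ u → f x = g x) :
    ∑ x ∈ s, f x + g u = ∑ x ∈ s, g x + f u := by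
  rw [← Finset.add_sum_erase s f hu, ← Finset.add_sum_erase s g hu,
    Finset.sum_congr rfl fun x hx => h x (Finset.ne_of_mem_erase hx)]
  abel

theorem sum_Ico_sub (f : ℤ → ℤ) (a : ℕ) :
    ∑ u ∈ Finset.Ico (0 : ℤ) a, (f (u + 1) - f u) = f a - f 0 := by
  induction a with
  | zero => simp
  | succ a ih =>
    have : Finset.Ico (0 : ℤ) ((a + 1 : ℕ) : ℤ) = insert (a : ℤ) (Finset.Ico (0 : ℤ) a) := by
      ext x; simp only [Finset.mem_Ico, Finset.mem_insert]; omega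
    rw [this, Finset.sum_insert (by simp), ih]
    push_cast
    ring

/-- Adjacency lists of a bipartite graph with sides `{0, …, a - 1}` and `{0, …, b - 1}`. -/
structure AdjLists (a b : ℕ) (off adj : ℤ → ℤ) : Prop where
  off_zero : off 0 = 0
  off_mono : ∀ u : ℤ, 0 ≤ u → u < a → off u ≤ off (u + 1)
  adj_range : ∀ p : ℤ, 0 ≤ p → p < off a → 0 ≤ adj p ∧ adj p < b

/-- There is an entry `v` in the adjacency list of `u`. -/
def Arc (off adj : ℤ → ℤ) (u v : ℤ) : Prop :=
  ∃ p, off u ≤ p ∧ p < off (u + 1) ∧ adj p = v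

theorem AdjLists.off_nonneg_le {a b : ℕ} {off adj : ℤ → ℤ} (G : AdjLists a b off adj) {u : ℤ}
    (h0 : 0 ≤ u) (ha : u ≤ a) : 0 ≤ off u ∧ off u ≤ off a := by
  have h1 : ∀ k : ℕ, (k : ℤ) ≤ a → 0 ≤ off k := by
    intro k
    induction k with
    | zero => intro; simp [G.off_zero]
    | succ k ih =>
      intro hk
      push_cast at hk ⊢
      exact (ih (by omega)).trans (G.off_mono k (by omega) (by omega))
  have h2 : ∀ k : ℕ, (k : ℤ) ≤ a → off (a - k) ≤ off a := by
    intro k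
    induction k with
    | zero => intro; simp
    | succ k ih =>
      intro hk
      push_cast at hk ⊢
      have := G.off_mono ((a : ℤ) - (k + 1)) (by omega) (by omega)
      rw [show (a : ℤ) - (k + 1) + 1 = a - k by ring] at this
      exact this.trans (ih (by omega))
  constructor
  · simpa [Int.toNat_of_nonneg h0] using h1 u.toNat (by omega)
  · have := h2 (a - u).toNat (by omega)
    rwa [Int.toNat_of_nonneg (by omega), sub_sub_cancel] at this

theorem AdjLists.range {a b : ℕ} {off adj : ℤ → ℤ} (G : AdjLists a b off adj) {u p : ℤ}
    (h0 : 0 ≤ u) (ha : u < a) (h : off u ≤ p) (h' : p < off (u + 1)) :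
    0 ≤ adj p ∧ adj p < b :=
  G.adj_range p ((G.off_nonneg_le h0 (by omega)).1.trans h)
    (h'.trans_le (G.off_nonneg_le (u := u + 1) (by omega) (by omega)).2)

/-- The number of matched vertices on the first side. -/
noncomputable def matched (a : ℕ) (mate : ℤ → ℤ) : ℕ :=
  ((Finset.Ico (0 : ℤ) a).filter fun u => 0 ≤ mate u).card

theorem matched_le (a : ℕ) (mate : ℤ → ℤ) : matched a mate ≤ a :=
  (Finset.card_filter_le _ _).trans (by simp)

theorem matched_update {a : ℕ} {mate : ℤ → ℤ} {u : ℤ} (v : ℤ) (h0 : 0 ≤ u) (ha : u < a) :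
    matched a (Function.update mate u v) + (if 0 ≤ mate u then 1 else 0) =
      matched a mate + if 0 ≤ v then 1 else 0 := by
  have := sum_add_eq_of_eq_off (s := Finset.Ico (0 : ℤ) a)
    (f := fun x => if 0 ≤ Function.update mate u v x then 1 else 0)
    (g := fun x => if 0 ≤ mate x then 1 else 0) (u := u) (by simp [h0, ha])
    (fun x hx => by simp [hx])
  simp only [matched, Finset.card_filter]
  simpa only [Function.update_self] using this

/-- `mate` and `mr` contain the partners in a matching, or `-1`. -/
structure Mates (a b : ℕ) (off adj mate mr : ℤ → ℤ) : Prop where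
  left : ∀ u : ℤ, 0 ≤ u → u < a → mate u = -1 ∨
    (0 ≤ mate u ∧ mate u < b ∧ Arc off adj u (mate u) ∧ mr (mate u) = u)
  right : ∀ v : ℤ, 0 ≤ v → v < b → mr v = -1 ∨ (0 ≤ mr v ∧ mr v < a ∧ mate (mr v) = v)

/-- On matched vertices, `mate` and `mr` are inverse to each other. -/
theorem Mates.card_right {a b : ℕ} {off adj mate mr : ℤ → ℤ} (h : Mates a b off adj mate mr) :
    ((Finset.Ico (0 : ℤ) b).filter fun v => 0 ≤ mr v).card = matched a mate := by
  refine Finset.card_nbij' mr mate ?_ ?_ ?_ ?_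
  all_goals
    intro x hx
    simp only [Finset.coe_filter, Finset.mem_Ico, Set.mem_ofPred_eq] at hx ⊢
  · have := h.right x; grind
  · have := h.left x; grind
  · have := h.right x; grind
  · have := h.left x; grind

/-! ### The bidding phase -/

/-- The invariant of the bidding phase, when the vertices before `i` have been started and `u`
is the vertex that bids (or `-1`). -/
structure Bidding (a b : ℕ) (L : ℤ) (off adj : ℤ → ℤ) (i u : ℤ) (mate mr pr lev ptr : ℤ → ℤ) :
    Prop extends Mates a b off adj mate mr where
  pr_nonneg : ∀ v : ℤ, 0 ≤ v → v < b → 0 ≤ pr v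
  pr_free : ∀ v : ℤ, 0 ≤ v → v < b → mr v = -1 → pr v = 0
  lev_nonneg : ∀ x : ℤ, 0 ≤ x → x < a → 0 ≤ lev x
  lev_lt : ∀ x : ℤ, 0 ≤ x → x < a → lev x < L
  off_le : ∀ x : ℤ, 0 ≤ x → x < a → off x ≤ ptr x
  le_off : ∀ x : ℤ, 0 ≤ x → x < a → ptr x ≤ off (x + 1)
  le_pr : ∀ x p : ℤ, 0 ≤ x → x < a → off x ≤ p → p < off (x + 1) → lev x ≤ pr (adj p)
  lt_pr : ∀ x p : ℤ, 0 ≤ x → x < a → off x ≤ p → p < ptr x → lev x < pr (adj p)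
  slack : ∀ x : ℤ, 0 ≤ x → x < a → 0 ≤ mate x → pr (mate x) ≤ lev x + 1
  fresh : ∀ x : ℤ, 0 ≤ x → x < a → i ≤ x → mate x = -1
  free : ∀ x : ℤ, 0 ≤ x → x < a → mate x = -1 → x = u ∨ i ≤ x ∨
    (lev x + 1 = L ∧ ptr x = off (x + 1))
  current : u = -1 ∨ (0 ≤ u ∧ u < a ∧ u < i ∧ mate u = -1)

/-- The potential that pays for the bidding phase. -/
noncomputable def bidPotential (a : ℕ) (L : ℤ) (off lev ptr : ℤ → ℤ) : ℤ :=
  ∑ x ∈ Finset.Ico (0 : ℤ) a,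
    ((L - 1 - lev x) * (off (x + 1) - off x + 1) + (off (x + 1) - ptr x))

section Bidding

variable {a b : ℕ} {L : ℤ} {off adj : ℤ → ℤ} {i u : ℤ} {mate mr pr lev ptr : ℤ → ℤ}

theorem Bidding.init (G : AdjLists a b off adj) (hL : 0 < L)
    (hmate : ∀ x : ℤ, 0 ≤ x → x < a → mate x = -1) (hlev : ∀ x : ℤ, 0 ≤ x → x < a → lev x = 0)
    (hptr : ∀ x : ℤ, 0 ≤ x → x < a → ptr x = off x) (hmr : ∀ v : ℤ, 0 ≤ v → v < b → mr v = -1)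
    (hpr : ∀ v : ℤ, 0 ≤ v → v < b → pr v = 0) :
    Bidding a b L off adj 0 (-1) mate mr pr lev ptr where
  left x h0 ha := Or.inl (hmate x h0 ha)
  right v h0 hb := Or.inl (hmr v h0 hb)
  pr_nonneg v h0 hb := (hpr v h0 hb).ge
  pr_free v h0 hb _ := hpr v h0 hb
  lev_nonneg x h0 ha := (hlev x h0 ha).ge
  lev_lt x h0 ha := (hlev x h0 ha).trans_lt hL
  off_le x h0 ha := (hptr x h0 ha).ge
  le_off x h0 ha := (hptr x h0 ha).trans_le (G.off_mono x h0 ha)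
  le_pr x p h0 ha h h' := by
    have := G.range h0 ha h h'
    rw [hlev x h0 ha, hpr _ this.1 this.2]
  lt_pr x p h0 ha h h' := by have := hptr x h0 ha; omega
  slack x h0 ha h := by have := hmate x h0 ha; omega
  fresh x h0 ha _ := hmate x h0 ha
  free x h0 ha _ := Or.inr (Or.inl h0)
  current := Or.inl rfl

theorem Bidding.start (h : Bidding a b L off adj i (-1) mate mr pr lev ptr) (h0 : 0 ≤ i)
    (ha : i < a) : Bidding a b L off adj (i + 1) i mate mr pr lev ptr where
  __ := h
  fresh x hx hxa hi := h.fresh x hx hxa (by omega)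
  free x hx hxa hm := by have := h.free x hx hxa hm; omega
  current := Or.inr ⟨h0, ha, by omega, h.fresh i h0 ha le_rfl⟩

/-- By `le_pr` the price is at least the level; as they differ, it is larger, and the arc may join
those covered by `lt_pr`. -/
theorem Bidding.advance (h : Bidding a b L off adj i u mate mr pr lev ptr)
    (hu : 0 ≤ u) (hp : ptr u < off (u + 1)) (hne : pr (adj (ptr u)) ≠ lev u) :
    Bidding a b L off adj i u mate mr pr lev (Function.update ptr u (ptr u + 1)) := by
  have hc := h.current.resolve_left (by omega)
  have h1 := h.le_pr u (ptr u) hc.1 hc.2.1 (h.off_le u hc.1 hc.2.1) hp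
  exact {
    h with
    off_le := fun x => by have := h.off_le x; grind
    le_off := fun x => by have := h.le_off x; grind
    lt_pr := fun x p => by have := h.lt_pr x p; grind
    free := fun x => by have := h.free x; grind }

/-- With the list exhausted, `lt_pr` covers all neighbours, and integrality turns its strict
inequality into `le_pr` for the raised level. Since `u` is unmatched, `slack` says nothing about it.
-/
theorem Bidding.raise (G : AdjLists a b off adj)
    (h : Bidding a b L off adj i u mate mr pr lev ptr)
    (hu : 0 ≤ u) (hp : ¬ ptr u < off (u + 1)) (hL : lev u + 1 < L) :
    Bidding a b L off adj i u mate mr pr (Function.update lev u (lev u + 1))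
      (Function.update ptr u (off u)) := by
  have hc := h.current.resolve_left (by omega)
  have h1 := G.off_mono u hc.1 hc.2.1
  exact {
    h with
    lev_nonneg := fun x => by have := h.lev_nonneg x; grind
    lev_lt := fun x => by have := h.lev_lt x; grind
    off_le := fun x => by have := h.off_le x; grind
    le_off := fun x => by have := h.le_off x; grind
    le_pr := fun x p => by have := h.le_pr x p; have := h.lt_pr x p; grind
    lt_pr := fun x p => by have := h.lt_pr x p; grind
    slack := fun x => by have := h.slack x; grind
    free := fun x => by have := h.free x; grind }

/-- The vertex `u` now falls under the last alternative of `free`: top level and exhausted list, so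
by `lt_pr` all its neighbours have price at least `L`. -/
theorem Bidding.give_up (h : Bidding a b L off adj i u mate mr pr lev ptr)
    (hu : 0 ≤ u) (hp : ¬ ptr u < off (u + 1)) (hL : ¬ lev u + 1 < L) :
    Bidding a b L off adj i (-1) mate mr pr lev ptr := by
  have hc := h.current.resolve_left (by omega)
  have h1 := h.le_off u hc.1 hc.2.1
  have h2 := h.lev_lt u hc.1 hc.2.1
  exact {
    h with
    free := fun x => by have := h.free x; grind
    current := Or.inl rfl }

/-- The vertex `u` is matched to `v`, whose partner, if it has any, bids next. -/
theorem Bidding.assign (G : AdjLists a b off adj)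
    (h : Bidding a b L off adj i u mate mr pr lev ptr)
    (hu : 0 ≤ u) (hp : ptr u < off (u + 1)) {v : ℤ} (hv : adj (ptr u) = v) (he : pr v = lev u)
    {mate' : ℤ → ℤ}
    (hmate : mate' = if mr v < 0 then Function.update mate u v else
      Function.update (Function.update mate u v) (mr v) (-1)) :
    Bidding a b L off adj i (mr v) mate' (Function.update mr v u)
        (Function.update pr v (pr v + 1)) lev (Function.update ptr u (ptr u + 1)) ∧
      (matched a mate' : ℤ) = matched a mate + if mr v < 0 then 1 else 0 := by
  obtain ⟨hu0, hua, hui, hum⟩ := h.current.resolve_left (by omega)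
  obtain ⟨hv0, hvb⟩ := hv ▸ G.range hu0 hua (h.off_le u hu0 hua) hp
  have harc : Arc off adj u v := ⟨ptr u, h.off_le u hu0 hua, hp, hv⟩
  have hr := h.right v hv0 hvb
  -- The restriction to `0 ≤ x` matters: if `v` had no partner, then `mr v = -1`, and the cell `-1`
  -- of the array is not written.
  have hm : ∀ x : ℤ, 0 ≤ x → mate' x = if x = u then v else if x = mr v then -1 else mate x := by
    intro x hx0
    rw [hmate]
    split_ifs <;> grind
  have hw : mr v ≠ u := by grind
  have hml : ∀ x : ℤ, 0 ≤ x → x < a → x ≠ u → x ≠ mr v → mate x ≠ v := by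
    intro x hx0 hxa
    have := h.left x hx0 hxa
    grind
  have hpr : ∀ x : ℤ, pr x ≤ Function.update pr v (pr v + 1) x := by
    intro x; grind
  constructor
  · exact {
      left := fun x => by
        have := h.left x; have := hm x; have := hml x; grind
      right := fun x hx0 hxb => by
        have h1 := h.right x hx0 hxb
        by_cases hx : x = v
        · subst hx; right; have := hm u; grind
        · have := hm (mr x); grind
      pr_nonneg := fun x hx0 hxb => (h.pr_nonneg x hx0 hxb).trans (hpr x)
      pr_free := fun x => by have := h.pr_free x; grind
      lev_nonneg := h.lev_nonneg
      lev_lt := h.lev_lt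
      off_le := fun x => by have := h.off_le x; grind
      le_off := fun x => by have := h.le_off x; grind
      le_pr := fun x p h1 h2 h3 h4 => (h.le_pr x p h1 h2 h3 h4).trans (hpr _)
      lt_pr := fun x p h1 h2 h3 h4 => by
        -- The arc just passed leads to `v`, whose price has risen from `lev u` to `lev u + 1`.
        by_cases hx : x = u ∧ p = ptr u
        · grind
        · exact (h.lt_pr x p h1 h2 h3 (by grind)).trans_le (hpr _)
      -- For `u` the bound holds with equality. No other vertex keeps `v` as its partner, and no
      -- other price has changed.
      slack := fun x => by
        have := h.slack x; have := hm x; have := hml x; grind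
      fresh := fun x => by
        have := h.fresh x; have := hm x; grind
      free := fun x => by
        have := h.free x; have := hm x; grind
      current := by
        rcases hr with hr | hr
        · exact Or.inl hr
        · right
          have := h.fresh (mr v)
          have := hm (mr v)
          grind }
  · have h1 := matched_update (mate := mate) v hu0 hua
    rw [if_neg (by omega), if_pos hv0] at h1
    rw [hmate]
    split_ifs with hlt
    · rw [← Nat.cast_one, ← Nat.cast_add]; exact_mod_cast h1
    · have h2 := matched_update (a := a) (mate := Function.update mate u v) (u := mr v) (-1)
        (by omega) (by omega)
      rw [Function.update_of_ne hw, if_pos (by omega : 0 ≤ mate (mr v)), if_neg (by omega)] at h2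
      omega

theorem bidPotential_advance (h0 : 0 ≤ u) (ha : u < a) :
    bidPotential a L off lev (Function.update ptr u (ptr u + 1)) =
      bidPotential a L off lev ptr - 1 := by
  have := sum_add_eq_of_eq_off (s := Finset.Ico (0 : ℤ) a)
    (f := fun x => (L - 1 - lev x) * (off (x + 1) - off x + 1) +
      (off (x + 1) - Function.update ptr u (ptr u + 1) x))
    (g := fun x => (L - 1 - lev x) * (off (x + 1) - off x + 1) + (off (x + 1) - ptr x))
    (u := u) (by simp [h0, ha]) (fun x hx => by simp [hx])
  simp only [Function.update_self] at this
  rw [bidPotential, bidPotential]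
  linarith

/-- The new level releases the degree of `u` plus one, and resetting the pointer takes the degree
back. The summand `+ 1` in the potential exists to pay for this step. -/
theorem bidPotential_raise (h0 : 0 ≤ u) (ha : u < a) (hp : ptr u = off (u + 1)) :
    bidPotential a L off (Function.update lev u (lev u + 1)) (Function.update ptr u (off u)) =
      bidPotential a L off lev ptr - 1 := by
  have := sum_add_eq_of_eq_off (s := Finset.Ico (0 : ℤ) a)
    (f := fun x => (L - 1 - Function.update lev u (lev u + 1) x) * (off (x + 1) - off x + 1) +
      (off (x + 1) - Function.update ptr u (off u) x))
    (g := fun x => (L - 1 - lev x) * (off (x + 1) - off x + 1) + (off (x + 1) - ptr x))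
    (u := u) (by simp [h0, ha]) (fun x hx => by simp [hx])
  simp only [Function.update_self] at this
  rw [bidPotential, bidPotential]
  linarith

theorem Bidding.potential_nonneg (G : AdjLists a b off adj)
    (h : Bidding a b L off adj i u mate mr pr lev ptr) : 0 ≤ bidPotential a L off lev ptr := by
  refine Finset.sum_nonneg fun x hx => ?_
  rw [Finset.mem_Ico] at hx
  have h1 := h.lev_lt x hx.1 hx.2
  have h2 := h.le_off x hx.1 hx.2
  have h3 := G.off_mono x hx.1 hx.2
  have : 0 ≤ (L - 1 - lev x) * (off (x + 1) - off x + 1) := mul_nonneg (by omega) (by omega)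
  omega

theorem bidPotential_init (G : AdjLists a b off adj) (hlev : ∀ x : ℤ, 0 ≤ x → x < a → lev x = 0)
    (hptr : ∀ x : ℤ, 0 ≤ x → x < a → ptr x = off x) :
    bidPotential a L off lev ptr = (L - 1) * (off a + a) + off a := by
  have h : bidPotential a L off lev ptr = ∑ x ∈ Finset.Ico (0 : ℤ) a,
      ((L - 1) * ((off (x + 1) - off x) + 1) + (off (x + 1) - off x)) := by
    refine Finset.sum_congr rfl fun x hx => ?_
    rw [Finset.mem_Ico] at hx
    rw [hlev x hx.1 hx.2, hptr x hx.1 hx.2]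
    ring
  rw [h, Finset.sum_add_distrib, ← Finset.mul_sum, Finset.sum_add_distrib, sum_Ico_sub]
  simp [G.off_zero]

/-- After the bidding phase, a vertex cover shows that the matching has at most `L` edges fewer
than a maximum matching. -/
theorem Bidding.card_le (G : AdjLists a b off adj) (hL : 0 < L) (haL : (a : ℤ) ≤ L * L)
    (h : Bidding a b L off adj a (-1) mate mr pr lev ptr) :
    ∃ S T : Finset ℤ, (∀ x v : ℤ, 0 ≤ x → x < a → Arc off adj x v → x ∈ S ∨ v ∈ T) ∧
      ((S.card + T.card : ℕ) : ℤ) ≤ matched a mate + L := by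
  classical
  -- Averaging: the price classes `1, …, L` are disjoint sets of matched vertices. If all had more
  -- than `L` elements, then `L (L + 1) ≤ a ≤ L²`.
  obtain ⟨t, ht1, htL, htc⟩ : ∃ t : ℤ, 1 ≤ t ∧ t ≤ L ∧
      (((Finset.Ico (0 : ℤ) b).filter fun v => pr v = t).card : ℤ) ≤ L := by
    by_contra! hcon
    have h1 : ∑ t ∈ Finset.Icc 1 L, ((Finset.Ico (0 : ℤ) b).filter fun v => pr v = t).card ≤
        ((Finset.Ico (0 : ℤ) b).filter fun v => 0 ≤ mr v).card := by
      rw [← Finset.card_biUnion]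
      · refine Finset.card_le_card fun v hv => ?_
        simp only [Finset.mem_biUnion, Finset.mem_filter, Finset.mem_Icc, Finset.mem_Ico] at hv ⊢
        have := h.right v; have := h.pr_free v; grind
      · intro t _ t' _ hne
        rw [Function.onFun, Finset.disjoint_left]
        intro v hv hv'
        simp only [Finset.mem_filter] at hv hv'
        exact hne (hv.2.symm.trans hv'.2)
    have h2 : ∑ t ∈ Finset.Icc 1 L, (L + 1) ≤ ∑ t ∈ Finset.Icc 1 L,
        ((((Finset.Ico (0 : ℤ) b).filter fun v => pr v = t).card : ℕ) : ℤ) := by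
      refine Finset.sum_le_sum fun t ht => ?_
      rw [Finset.mem_Icc] at ht
      have := hcon t ht.1 ht.2
      omega
    rw [h.card_right] at h1
    have h3 := matched_le a mate
    simp only [Finset.sum_const, Int.card_Icc, nsmul_eq_mul] at h2
    rw [← Nat.cast_sum] at h2
    have h4 : ((L + 1 - 1).toNat : ℤ) = L := by omega
    rw [h4] at h2
    have : (L * (L + 1)) ≤ a := h2.trans (by exact_mod_cast h1.trans h3)
    nlinarith
  refine ⟨(Finset.Ico (0 : ℤ) a).filter fun x => ∃ p, off x ≤ p ∧ p < off (x + 1) ∧ pr (adj p) < t,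
    (Finset.Ico (0 : ℤ) b).filter fun v => t ≤ pr v, ?_, ?_⟩
  · rintro x v hx0 hxa ⟨p, hp, hp', rfl⟩
    have := G.range hx0 hxa hp hp'
    simp only [Finset.mem_filter, Finset.mem_Ico]
    by_cases hlt : pr (adj p) < t
    · exact Or.inl ⟨⟨hx0, hxa⟩, p, hp, hp', hlt⟩
    · exact Or.inr ⟨this, not_lt.1 hlt⟩
  · have hS : ((Finset.Ico (0 : ℤ) a).filter
        fun x => ∃ p, off x ≤ p ∧ p < off (x + 1) ∧ pr (adj p) < t).card ≤
        ((Finset.Ico (0 : ℤ) b).filter fun v => 0 ≤ mr v ∧ pr v ≤ t).card := by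
      -- A vertex with a neighbour cheaper than `t ≤ L` has not given up, so it is matched. Its
      -- level is below `t`, and `slack` bounds the price of its partner by `t`.
      have key : ∀ x : ℤ, 0 ≤ x → x < a → (∃ p, off x ≤ p ∧ p < off (x + 1) ∧ pr (adj p) < t) →
          0 ≤ mate x ∧ mate x < b ∧ mr (mate x) = x ∧ pr (mate x) ≤ t := by
        rintro x hx0 hxa ⟨p, hp, hp', hlt⟩
        have h1 := h.le_pr x p hx0 hxa hp hp'
        have h2 := h.lt_pr x p hx0 hxa hp
        have h3 := h.left x hx0 hxa
        have h4 := h.slack x hx0 hxa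
        have h5 := h.free x hx0 hxa
        grind
      refine Finset.card_le_card_of_injOn mate (fun x hx => ?_) fun x hx y hy hxy => ?_
      · simp only [Finset.coe_filter, Finset.mem_Ico, Set.mem_ofPred_eq] at hx ⊢
        have := key x hx.1.1 hx.1.2 hx.2
        grind
      · simp only [Finset.coe_filter, Finset.mem_Ico, Set.mem_ofPred_eq] at hx hy
        have h1 := key x hx.1.1 hx.1.2 hx.2
        have h2 := key y hy.1.1 hy.1.2 hy.2
        rw [← h1.2.2.1, hxy, h2.2.2.1]
    -- Since `t ≥ 1`, vertices of price at least `t` are matched too, and the two sets overlap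
    -- exactly in the class of price `t`.
    have hsum : ((Finset.Ico (0 : ℤ) b).filter fun v => 0 ≤ mr v ∧ pr v ≤ t).card +
        ((Finset.Ico (0 : ℤ) b).filter fun v => t ≤ pr v).card ≤
        ((Finset.Ico (0 : ℤ) b).filter fun v => 0 ≤ mr v).card +
        ((Finset.Ico (0 : ℤ) b).filter fun v => pr v = t).card := by
      simp only [Finset.card_filter, ← Finset.sum_add_distrib]
      refine Finset.sum_le_sum fun v hv => ?_
      rw [Finset.mem_Ico] at hv
      have h1 := h.right v hv.1 hv.2
      have h2 := h.pr_free v hv.1 hv.2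
      split_ifs <;> omega
    rw [h.card_right] at hsum
    push_cast
    omega

end Bidding

/-! ### The search for an augmenting path -/

/-- The invariant of the search: the queue `q` contains vertices of the first side that can be
reached from unmatched ones by alternating paths; `vis` contains the order in which the
vertices of the second side have been visited, from the vertices in `par`, or `0`. -/
structure Searching (a b : ℕ) (off adj mate mr ptr vis par q : ℤ → ℤ)
    (head tail cnt found : ℤ) : Prop where
  head_nonneg : 0 ≤ head
  head_le : head ≤ tail
  cnt_nonneg : 0 ≤ cnt
  queue : ∀ i : ℤ, 0 ≤ i → i < tail → 0 ≤ q i ∧ q i < a ∧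
    (mate (q i) = -1 ∨ 0 < vis (mate (q i)))
  done : ∀ i : ℤ, 0 ≤ i → i < head → ptr (q i) = off (q i + 1)
  off_le : ∀ x : ℤ, 0 ≤ x → x < a → off x ≤ ptr x
  le_off : ∀ x : ℤ, 0 ≤ x → x < a → ptr x ≤ off (x + 1)
  explored : ∀ x p : ℤ, 0 ≤ x → x < a → off x ≤ p → p < ptr x → 0 < vis (adj p)
  free : ∀ x : ℤ, 0 ≤ x → x < a → mate x = -1 → ∃ i, 0 ≤ i ∧ i < tail ∧ q i = x
  vis_nonneg : ∀ v : ℤ, 0 ≤ v → v < b → 0 ≤ vis v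
  vis_le : ∀ v : ℤ, 0 ≤ v → v < b → vis v ≤ cnt
  parent : ∀ v : ℤ, 0 ≤ v → v < b → 0 < vis v → 0 ≤ par v ∧ par v < a ∧ Arc off adj (par v) v ∧
    (mate (par v) = -1 ∨ (0 < vis (mate (par v)) ∧ vis (mate (par v)) < vis v))
  pushed : ∀ v : ℤ, 0 ≤ v → v < b → 0 < vis v → v = found ∨
    (0 ≤ mr v ∧ ∃ i, 0 ≤ i ∧ i < tail ∧ q i = mr v)
  found_free : found = -1 ∨ (0 ≤ found ∧ found < b ∧ mr found = -1 ∧ 0 < vis found)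
  count : cnt + ∑ x ∈ Finset.Ico (0 : ℤ) a, (off (x + 1) - ptr x) ≤ off a

section Searching

variable {a b : ℕ} {off adj mate mr ptr vis par q : ℤ → ℤ} {head tail cnt found : ℤ}

theorem Searching.init (G : AdjLists a b off adj)
    (htail : 0 ≤ tail) (hq : ∀ i : ℤ, 0 ≤ i → i < tail → 0 ≤ q i ∧ q i < a ∧ mate (q i) = -1)
    (hfree : ∀ x : ℤ, 0 ≤ x → x < a → mate x = -1 → ∃ i, 0 ≤ i ∧ i < tail ∧ q i = x)
    (hptr : ∀ x : ℤ, 0 ≤ x → x < a → ptr x = off x)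
    (hvis : ∀ v : ℤ, 0 ≤ v → v < b → vis v = 0) :
    Searching a b off adj mate mr ptr vis par q 0 tail 0 (-1) where
  head_nonneg := le_rfl
  head_le := htail
  cnt_nonneg := le_rfl
  queue i h0 h1 := by have := hq i h0 h1; exact ⟨this.1, this.2.1, Or.inl this.2.2⟩
  done i h0 h1 := by omega
  off_le x h0 h1 := (hptr x h0 h1).ge
  le_off x h0 h1 := (hptr x h0 h1).trans_le (G.off_mono x h0 h1)
  explored x p h0 h1 h2 h3 := by have := hptr x h0 h1; omega
  free := hfree
  vis_nonneg v h0 h1 := (hvis v h0 h1).ge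
  vis_le v h0 h1 := (hvis v h0 h1).le
  parent v h0 h1 h2 := by have := hvis v h0 h1; omega
  pushed v h0 h1 h2 := by have := hvis v h0 h1; omega
  found_free := Or.inl rfl
  count := by
    have h : ∑ x ∈ Finset.Ico (0 : ℤ) a, (off (x + 1) - ptr x) =
        ∑ x ∈ Finset.Ico (0 : ℤ) a, (off (x + 1) - off x) :=
      Finset.sum_congr rfl fun x hx => by rw [Finset.mem_Ico] at hx; rw [hptr x hx.1 hx.2]
    rw [h, sum_Ico_sub, G.off_zero]
    omega

theorem sum_remaining (h0 : 0 ≤ head) (ha : head < a) :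
    ∑ x ∈ Finset.Ico (0 : ℤ) a, (off (x + 1) - Function.update ptr head (ptr head + 1) x) =
      ∑ x ∈ Finset.Ico (0 : ℤ) a, (off (x + 1) - ptr x) - 1 := by
  have := sum_add_eq_of_eq_off (s := Finset.Ico (0 : ℤ) a)
    (f := fun x => off (x + 1) - Function.update ptr head (ptr head + 1) x)
    (g := fun x => off (x + 1) - ptr x) (u := head) (by simp [h0, ha]) (fun x hx => by simp [hx])
  simp only [Function.update_self] at this
  linarith

theorem Searching.remaining_nonneg
    (h : Searching a b off adj mate mr ptr vis par q head tail cnt found) :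
    0 ≤ ∑ x ∈ Finset.Ico (0 : ℤ) a, (off (x + 1) - ptr x) := by
  refine Finset.sum_nonneg fun x hx => ?_
  rw [Finset.mem_Ico] at hx
  have := h.le_off x hx.1 hx.2
  omega

theorem Searching.pop (h : Searching a b off adj mate mr ptr vis par q head tail cnt found)
    (ht : head < tail) (hp : ¬ ptr (q head) < off (q head + 1)) :
    Searching a b off adj mate mr ptr vis par q (head + 1) tail cnt found := by
  have h1 := h.queue head h.head_nonneg ht
  have h2 := h.le_off _ h1.1 h1.2.1
  exact {
    h with
    head_nonneg := by have := h.head_nonneg; omega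
    head_le := by omega
    done := fun i h0 hi => by
      rcases eq_or_ne i head with rfl | hne
      · omega
      · exact h.done i h0 (by omega) }

theorem Searching.skip (h : Searching a b off adj mate mr ptr vis par q head tail cnt found)
    (ht : head < tail) {u : ℤ} (hu : q head = u) (hp : ptr u < off (u + 1))
    (G : AdjLists a b off adj) (hv : vis (adj (ptr u)) ≠ 0) :
    Searching a b off adj mate mr (Function.update ptr u (ptr u + 1)) vis par q head tail cnt
      found := by
  obtain ⟨hu0, hua, -⟩ := hu ▸ h.queue head h.head_nonneg ht
  have h1 := G.range hu0 hua (h.off_le u hu0 hua) hp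
  have h2 := h.vis_nonneg _ h1.1 h1.2
  exact {
    h with
    -- A finished queue entry equal to `u` would have an exhausted list, against `hp`; so no
    -- finished entry is affected.
    done := fun i h0 hi => by have := h.done i h0 hi; grind
    off_le := fun x => by have := h.off_le x; grind
    le_off := fun x => by have := h.le_off x; grind
    explored := fun x p => by have := h.explored x p; grind
    count := by
      rw [sum_remaining hu0 hua]
      have := h.count
      omega }

/-- The stamp `cnt + 1` exceeds all earlier ones, so stamps decrease along chains of parents. An
unmatched `v` ends an augmenting path; otherwise its partner joins the queue. In `count`, the
consumed arc pays for the new stamp. -/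
theorem Searching.visit (h : Searching a b off adj mate mr ptr vis par q head tail cnt (-1))
    (ht : head < tail) {u : ℤ} (hu : q head = u) (hp : ptr u < off (u + 1))
    (G : AdjLists a b off adj) (hM : Mates a b off adj mate mr) {v : ℤ}
    (hv : adj (ptr u) = v) (hvis : vis v = 0) {q' : ℤ → ℤ} {tail' found' : ℤ}
    (hcase : (mr v < 0 ∧ q' = q ∧ tail' = tail ∧ found' = v) ∨
      (¬ mr v < 0 ∧ q' = Function.update q tail (mr v) ∧ tail' = tail + 1 ∧ found' = -1)) :
    Searching a b off adj mate mr (Function.update ptr u (ptr u + 1))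
      (Function.update vis v (cnt + 1)) (Function.update par v u) q' head tail' (cnt + 1)
      found' := by
  obtain ⟨hu0, hua, hum⟩ := hu ▸ h.queue head h.head_nonneg ht
  obtain ⟨hv0, hvb⟩ := hv ▸ G.range hu0 hua (h.off_le u hu0 hua) hp
  have harc : Arc off adj u v := ⟨ptr u, h.off_le u hu0 hua, hp, hv⟩
  have hcnt := h.cnt_nonneg
  have htail : tail ≤ tail' := by omega
  have hq : ∀ i, i < tail → q' i = q i := by
    intro i hi
    rcases hcase with ⟨-, rfl, -⟩ | ⟨-, rfl, -⟩ <;> grind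
  have hvr := hM.right v hv0 hvb
  have hpos : ∀ x, 0 < vis x → 0 < Function.update vis v (cnt + 1) x := by
    intro x hx; grind
  have hex : ∀ x, (∃ i, 0 ≤ i ∧ i < tail ∧ q i = x) → ∃ i, 0 ≤ i ∧ i < tail' ∧ q' i = x := by
    rintro x ⟨i, h0, h1, h2⟩
    exact ⟨i, h0, by omega, by rw [hq i h1, h2]⟩
  have hhead := h.head_nonneg
  exact {
    head_nonneg := hhead
    head_le := by omega
    cnt_nonneg := by omega
    queue := fun i h0 hi => by
      by_cases hit : i < tail
      · rw [hq i hit]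
        have := h.queue i h0 hit
        exact ⟨this.1, this.2.1, this.2.2.imp_right (hpos _)⟩
      · rcases hcase with hc | ⟨hc1, rfl, rfl, rfl⟩
        · omega
        · obtain rfl : i = tail := by omega
          have := hvr.resolve_left (by omega)
          rw [Function.update_self]
          refine ⟨this.1, this.2.1, Or.inr ?_⟩
          rw [this.2.2, Function.update_self]
          omega
    done := fun i h0 hi => by
      have := h.done i h0 hi
      rw [hq i (by omega)]
      grind
    off_le := fun x => by have := h.off_le x; grind
    le_off := fun x => by have := h.le_off x; grind
    explored := fun x p h0 h1 h2 h3 => by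
      by_cases hx : x = u ∧ p = ptr u
      · rw [hx.2, hv, Function.update_self]; omega
      · exact hpos _ (h.explored x p h0 h1 h2 (by grind))
    free := fun x h0 h1 h2 => hex x (h.free x h0 h1 h2)
    vis_nonneg := fun x => by have := h.vis_nonneg x; grind
    vis_le := fun x => by have := h.vis_le x; grind
    parent := fun x h0 h1 h2 => by
      by_cases hx : x = v
      · subst hx
        simp only [Function.update_self]
        refine ⟨hu0, hua, harc, or_iff_not_imp_left.2 fun hne => ?_⟩
        have h3 := (hM.left u hu0 hua).resolve_left hne
        have h4 := h.vis_le (mate u) h3.1 h3.2.1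
        have h5 := hum.resolve_left hne
        -- The vertex `mate u` was visited and `v` was not, so they differ, and the stamp of `mate
        -- u` remains at most `cnt`.
        exact ⟨hpos _ h5, by grind⟩
      · rw [Function.update_of_ne hx] at h2
        simp only [Function.update_of_ne hx]
        have := h.parent x h0 h1 h2
        grind
    pushed := fun x h0 h1 h2 => by
      by_cases hx : x = v
      · subst hx
        rcases hcase with hc | ⟨hc1, rfl, rfl, rfl⟩
        · exact Or.inl hc.2.2.2.symm
        · exact Or.inr ⟨by omega, tail, by omega, by omega, Function.update_self ..⟩
      · rw [Function.update_of_ne hx] at h2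
        have := (h.pushed x h0 h1 h2).resolve_left (by omega)
        exact Or.inr ⟨this.1, hex _ this.2⟩
    found_free := by
      rcases hcase with hc | hc
      · right
        rw [hc.2.2.2, Function.update_self]
        omega
      · exact Or.inl hc.2.2.2
    count := by
      rw [sum_remaining hu0 hua]
      have := h.count
      omega }

/-- If the search fails, then a vertex cover shows that the matching is maximum. -/
theorem Searching.card_le (G : AdjLists a b off adj) (hM : Mates a b off adj mate mr)
    (h : Searching a b off adj mate mr ptr vis par q head tail cnt (-1)) (ht : ¬ head < tail) :
    ∃ S T : Finset ℤ, (∀ x v : ℤ, 0 ≤ x → x < a → Arc off adj x v → x ∈ S ∨ v ∈ T) ∧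
      S.card + T.card ≤ matched a mate := by
  classical
  -- König's cover: the vertices of the first side that were not reached and those of the second
  -- side that were.
  refine ⟨(Finset.Ico (0 : ℤ) a).filter fun x => ¬ ∃ i, 0 ≤ i ∧ i < tail ∧ q i = x,
    (Finset.Ico (0 : ℤ) b).filter fun v => 0 < vis v, ?_, ?_⟩
  · rintro x v hx0 hxa ⟨p, hp, hp', rfl⟩
    have hr := G.range hx0 hxa hp hp'
    simp only [Finset.mem_filter, Finset.mem_Ico]
    by_cases hx : ∃ i, 0 ≤ i ∧ i < tail ∧ q i = x
    · obtain ⟨i, h0, h1, rfl⟩ := hx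
      have hd := h.done i h0 (by omega)
      exact Or.inr ⟨hr, h.explored _ p hx0 hxa hp (by omega)⟩
    · exact Or.inl ⟨⟨hx0, hxa⟩, hx⟩
  · have hT : ((Finset.Ico (0 : ℤ) b).filter fun v => 0 < vis v).card ≤
        ((Finset.Ico (0 : ℤ) a).filter
          fun x => 0 ≤ mate x ∧ ∃ i, 0 ≤ i ∧ i < tail ∧ q i = x).card := by
      have key : ∀ v : ℤ, 0 ≤ v → v < b → 0 < vis v → (0 ≤ mr v ∧ mr v < a ∧ mate (mr v) = v) ∧
          ∃ i, 0 ≤ i ∧ i < tail ∧ q i = mr v := by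
        intro v hv0 hvb hv
        have h1 := (h.pushed v hv0 hvb hv).resolve_left (by omega)
        exact ⟨(hM.right v hv0 hvb).resolve_left (by omega), h1.2⟩
      refine Finset.card_le_card_of_injOn mr (fun v hv => ?_) fun v hv w hw hvw => ?_
      · simp only [Finset.coe_filter, Finset.mem_Ico, Set.mem_ofPred_eq] at hv ⊢
        have := key v hv.1.1 hv.1.2 hv.2
        exact ⟨⟨this.1.1, this.1.2.1⟩, by rw [this.1.2.2]; exact hv.1.1, this.2⟩
      · simp only [Finset.coe_filter, Finset.mem_Ico, Set.mem_ofPred_eq] at hv hw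
        have h1 := key v hv.1.1 hv.1.2 hv.2
        have h2 := key w hw.1.1 hw.1.2 hw.2
        rw [← h1.1.2.2, hvw, h2.1.2.2]
    -- Each matched vertex of the first side is counted once, as unreached or as the partner of a
    -- visited vertex. Unreached vertices are matched, since all unmatched ones are in the queue.
    refine (Nat.add_le_add_left hT _).trans ?_
    simp only [matched, Finset.card_filter, ← Finset.sum_add_distrib]
    refine Finset.sum_le_sum fun x hx => ?_
    rw [Finset.mem_Ico] at hx
    have h1 := hM.left x hx.1 hx.2
    have h2 := h.free x hx.1 hx.2
    by_cases hq : ∃ i, 0 ≤ i ∧ i < tail ∧ q i = x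
    · simp [hq]
    · have : mate x ≠ -1 := fun h' => hq (h2 h')
      have : 0 ≤ mate x := by omega
      simp [hq, this]

end Searching

/-! ### The augmentation -/

/-- The invariant of the augmentation: the vertex `v` (if it is not `-1`) is left out of the
current matching. -/
structure Augmenting (a b : ℕ) (off adj vis par : ℤ → ℤ) (v : ℤ) (mate mr : ℤ → ℤ) : Prop where
  left : ∀ u : ℤ, 0 ≤ u → u < a → mate u = -1 ∨
    (0 ≤ mate u ∧ mate u < b ∧ Arc off adj u (mate u) ∧ mr (mate u) = u ∧ mate u ≠ v)
  right : ∀ x : ℤ, 0 ≤ x → x < b → x = v ∨ mr x = -1 ∨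
    (0 ≤ mr x ∧ mr x < a ∧ mate (mr x) = x)
  current : v = -1 ∨ (0 ≤ v ∧ v < b ∧ 0 < vis v)
  parent : ∀ x : ℤ, 0 ≤ x → x < b → 0 < vis x → vis x ≤ vis v → 0 ≤ v →
    0 ≤ par x ∧ par x < a ∧ Arc off adj (par x) x ∧
    (mate (par x) = -1 ∨ (0 < vis (mate (par x)) ∧ vis (mate (par x)) < vis x))

section Augmenting

variable {a b : ℕ} {off adj mate mr ptr vis par q : ℤ → ℤ} {head tail cnt found v : ℤ}

theorem Searching.augmenting (hM : Mates a b off adj mate mr)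
    (h : Searching a b off adj mate mr ptr vis par q head tail cnt found) (hf : ¬ found < 0) :
    Augmenting a b off adj vis par found mate mr where
  left u h0 ha := by
    have h1 := hM.left u h0 ha
    have h2 := h.found_free.resolve_left (by omega)
    refine h1.imp_right fun h3 => ⟨h3.1, h3.2.1, h3.2.2.1, h3.2.2.2, fun h4 => ?_⟩
    rw [h4] at h3
    omega
  right x h0 hb := Or.inr (hM.right x h0 hb)
  current := by have := h.found_free.resolve_left (by omega); exact Or.inr (by tauto)
  parent x h0 hb hx _ _ := h.parent x h0 hb hx

theorem Augmenting.mates (h : Augmenting a b off adj vis par (-1) mate mr) :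
    Mates a b off adj mate mr where
  left u h0 ha := (h.left u h0 ha).imp_right fun h => ⟨h.1, h.2.1, h.2.2.1, h.2.2.2.1⟩
  right x h0 hb := (h.right x h0 hb).resolve_left (by omega)

/-- The parent `u` takes `v` and leaves out its former partner, which has a smaller stamp. The
matching grows only in the last step, when `u` had no partner. -/
theorem Augmenting.step (h : Augmenting a b off adj vis par v mate mr) (hv : 0 ≤ v) {u : ℤ}
    (hu : par v = u) :
    Augmenting a b off adj vis par (mate u) (Function.update mate u v) (Function.update mr v u) ∧
      (mate u < 0 ∨ vis (mate u) < vis v) ∧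
      (matched a (Function.update mate u v) : ℤ) + (if mate u < 0 then 0 else 1) =
        matched a mate + 1 := by
  obtain ⟨-, hvb, hvis⟩ := h.current.resolve_left (by omega)
  obtain ⟨hu0, hua, harc, hw⟩ := hu ▸ h.parent v hv hvb hvis le_rfl hv
  have hlu := h.left u hu0 hua
  have hne : ∀ x : ℤ, 0 ≤ x → x < a → 0 ≤ mate x → x ≠ u → mate x ≠ mate u := by
    intro x hx0 hxa hm hx
    have := h.left x hx0 hxa
    grind
  refine ⟨?_, ?_, ?_⟩
  · exact {
      left := fun x hx0 hxa => by
        have h1 := h.left x hx0 hxa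
        have h2 := hne x hx0 hxa
        grind
      right := fun x hx0 hxb => by
        have h1 := h.right x hx0 hxb
        grind
      current := by grind
      parent := fun x hx0 hxb hx hxle hm => by
        have h1 := h.parent x hx0 hxb hx
        -- A vertex with parent `u` has a stamp above that of the old `mate u`, so the rest of the
        -- path does not see the change at `u`.
        by_cases hp : par x = u
        · grind
        · rw [Function.update_of_ne hp]; grind }
  · grind
  · have := matched_update (mate := mate) v hu0 hua
    rw [if_pos hv] at this
    split_ifs at this ⊢ <;> omega

end Augmenting

open RAM Approx

/-! ### The program -/

/-! Registers of the matching subroutine. -/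

abbrev cU : ℕ := 32
abbrev cV : ℕ := 33
abbrev cW : ℕ := 34
abbrev cI : ℕ := 35
abbrev cL : ℕ := 36
abbrev cSq : ℕ := 37
abbrev cHead : ℕ := 38
abbrev cTail : ℕ := 39
abbrev cCnt : ℕ := 40
abbrev cFound : ℕ := 41
abbrev cGo : ℕ := 42

/-! Arrays of the matching subroutine: the partners of the vertices of the second side, prices,
levels, current arcs, parents and order of discovery in a search, and its queue. -/

abbrev bMR : ℕ := 32
abbrev bPr : ℕ := 33
abbrev bLev : ℕ := 34
abbrev bPtr : ℕ := 35
abbrev bPar : ℕ := 36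
abbrev bVis : ℕ := 37
abbrev bQ : ℕ := 38

/-- `x := x + 1` -/
def incr (x : ℕ) : Prog := .assign x (.add (.reg x) (.lit 1))

/-- The register `cL` gets the square root of the number of vertices on the first side,
rounded up. -/
def sqrtUp : Prog :=
  .assign cL (.lit 1) ;; .assign cSq (.lit 1) ;;
  .while (.lt (.reg cSq) (.reg rL))
    (.assign cSq (.add (.reg cSq) (.add (.reg cL) (.add (.reg cL) (.lit 1)))) ;; incr cL)

def initBidding : Prog :=
  .assign rSize (.lit 0) ;;
  forRange cI rL
    (.store aMate (.reg cI) (.lit (-1)) ;; .store bLev (.reg cI) (.lit 0) ;;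
     .store bPtr (.reg cI) (.get aOff (.reg cI))) ;;
  forRange cI rR (.store bMR (.reg cI) (.lit (-1)) ;; .store bPr (.reg cI) (.lit 0))

/-- The vertex `cU` looks at its current arc. If the price of the other endpoint equals the level
of `cU`, it is matched to `cU` and its price rises. -/
def bid : Prog :=
  .ite (.lt (.get bPtr (.reg cU)) (.get aOff (.add (.reg cU) (.lit 1))))
    (.assign cV (.get aAdj (.get bPtr (.reg cU))) ;;
     .store bPtr (.reg cU) (.add (.get bPtr (.reg cU)) (.lit 1)) ;;
     .ite (.eq (.get bPr (.reg cV)) (.get bLev (.reg cU)))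
       (.store bPr (.reg cV) (.add (.get bPr (.reg cV)) (.lit 1)) ;;
        .assign cW (.get bMR (.reg cV)) ;;
        .store aMate (.reg cU) (.reg cV) ;;
        .store bMR (.reg cV) (.reg cU) ;;
        .ite (.lt (.reg cW) (.lit 0)) (incr rSize) (.store aMate (.reg cW) (.lit (-1))) ;;
        .assign cU (.reg cW))
       (.assign cV (.reg cV)))
    (.ite (.lt (.add (.get bLev (.reg cU)) (.lit 1)) (.reg cL))
      (.store bLev (.reg cU) (.add (.get bLev (.reg cU)) (.lit 1)) ;;
       .store bPtr (.reg cU) (.get aOff (.reg cU)))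
      (.assign cU (.lit (-1))))

def bidding : Prog :=
  forRange cI rL (.assign cU (.reg cI) ;; .while (.not (.lt (.reg cU) (.lit 0))) bid)

def initSearch : Prog :=
  .assign cHead (.lit 0) ;; .assign cTail (.lit 0) ;; .assign cCnt (.lit 0) ;;
  .assign cFound (.lit (-1)) ;;
  forRange cI rL
    (.store bPtr (.reg cI) (.get aOff (.reg cI)) ;;
     .ite (.lt (.get aMate (.reg cI)) (.lit 0))
       (.store bQ (.reg cTail) (.reg cI) ;; incr cTail)
       (.assign cV (.reg cV))) ;;
  forRange cI rR (.store bVis (.reg cI) (.lit 0))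

def searchStep : Prog :=
  .assign cU (.get bQ (.reg cHead)) ;;
  .ite (.lt (.get bPtr (.reg cU)) (.get aOff (.add (.reg cU) (.lit 1))))
    (.assign cV (.get aAdj (.get bPtr (.reg cU))) ;;
     .store bPtr (.reg cU) (.add (.get bPtr (.reg cU)) (.lit 1)) ;;
     .ite (.eq (.get bVis (.reg cV)) (.lit 0))
       (incr cCnt ;; .store bVis (.reg cV) (.reg cCnt) ;; .store bPar (.reg cV) (.reg cU) ;;
        .ite (.lt (.get bMR (.reg cV)) (.lit 0))
          (.assign cFound (.reg cV))
          (.store bQ (.reg cTail) (.get bMR (.reg cV)) ;; incr cTail))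
       (.assign cV (.reg cV)))
    (incr cHead)

def searchLoop : Prog :=
  .while (.and (.lt (.reg cHead) (.reg cTail)) (.lt (.reg cFound) (.lit 0))) searchStep

def augmentLoop : Prog :=
  .while (.not (.lt (.reg cV) (.lit 0)))
    (.assign cU (.get bPar (.reg cV)) ;; .assign cW (.get aMate (.reg cU)) ;;
     .store aMate (.reg cU) (.reg cV) ;; .store bMR (.reg cV) (.reg cU) ;;
     .assign cV (.reg cW))

def improveStep : Prog :=
  initSearch ;; searchLoop ;;
  .ite (.lt (.reg cFound) (.lit 0)) (.assign cGo (.lit 0))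
    (.assign cV (.reg cFound) ;; augmentLoop ;; incr rSize)

def improve : Prog :=
  .assign cGo (.lit 1) ;; .while (.lt (.lit 0) (.reg cGo)) improveStep

/-- A maximum matching is computed in two phases: first, a bidding process with prices up to the
square root of the number of vertices finds all but few of its edges; then the matching is
improved along augmenting paths. -/
def maximumMatching : Prog :=
  sqrtUp ;; initBidding ;; bidding ;; improve

-- Correctness and running time of the matching program

attribute [local simp] wp_assign wp_store wp_seq wp_ite Test.Holds Test.cost Expr.eval Expr.cost
  State.setReg_reg State.setReg_arr State.setArr_reg State.setArr_arr incr

/-- Without multiplication, the square is updated by `(l + 1)² = l² + (l + (l + 1))`. The lower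
bound on `cL` is for the quality of the bidding phase, the upper bound for its running time. -/
theorem wp_sqrtUp {s : State} {a : ℕ} (ha : s.reg rL = a) :
    WP sqrtUp s fun t s' => 0 < s'.reg cL ∧ (a : ℤ) ≤ s'.reg cL * s'.reg cL ∧
      s'.reg cL ≤ Nat.sqrt a + 1 ∧ (t : ℤ) ≤ 20 * Nat.sqrt a + 40 := by
  have hlt : ∀ l : ℤ, 0 < l → l * l < a → l ≤ Nat.sqrt a := by
    intro l hl h
    lift l to ℕ using hl.le
    exact_mod_cast Nat.le_sqrt.2 (by exact_mod_cast h.le)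
  simp only [sqrtUp, wp_seq, wp_assign]
  refine (wp_while (fun s => s.reg rL = a ∧ 0 < s.reg cL ∧ s.reg cSq = s.reg cL * s.reg cL ∧
    s.reg cL ≤ Nat.sqrt a + 1) (fun s => 20 * (Nat.sqrt a + 1 - s.reg cL))
    (fun s h => by omega) ?_ ?_).mono ?_
  · rintro s ⟨h1, h2, h3, h4⟩ hb
    simp at hb ⊢
    have := hlt (s.reg cL) h2 (by rw [← h3, ← h1]; exact hb)
    refine ⟨⟨h1, by omega, by rw [h3]; ring, by omega⟩, by omega⟩
  · simp [ha]
  · rintro t s' ⟨⟨h1, h2, h3, h4⟩, hb, ht⟩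
    simp at hb ht ⊢
    refine ⟨h2, ?_, h4, by omega⟩
    rw [← h3, ← h1]
    exact hb

theorem wp_bid_loop {s : State} {a b : ℕ} {L i : ℤ} {off adj : ℤ → ℤ} (G : AdjLists a b off adj)
    (hoff : s.arr aOff = off) (hadj : s.arr aAdj = adj) (hL : s.reg cL = L)
    (hsize : s.reg rSize = matched a (s.arr aMate))
    (h : Bidding a b L off adj i (s.reg cU) (s.arr aMate) (s.arr bMR) (s.arr bPr) (s.arr bLev)
      (s.arr bPtr)) :
    WP (.while (.not (.lt (.reg cU) (.lit 0))) bid) s fun t s' =>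
      s'.reg rSize = matched a (s'.arr aMate) ∧
      Bidding a b L off adj i (-1) (s'.arr aMate) (s'.arr bMR) (s'.arr bPr) (s'.arr bLev)
        (s'.arr bPtr) ∧
      (t : ℤ) + 60 * bidPotential a L off (s'.arr bLev) (s'.arr bPtr) ≤
        60 * bidPotential a L off (s.arr bLev) (s.arr bPtr) + 70 := by
  refine (wp_while (fun s => s.arr aOff = off ∧ s.arr aAdj = adj ∧ s.reg cL = L ∧
    s.reg rSize = matched a (s.arr aMate) ∧ Bidding a b L off adj i (s.reg cU) (s.arr aMate)
      (s.arr bMR) (s.arr bPr) (s.arr bLev) (s.arr bPtr))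
    -- The indicator pays for giving up, the only step that leaves `bidPotential` unchanged.
    (fun s => 60 * (bidPotential a L off (s.arr bLev) (s.arr bPtr) +
      if s.reg cU < 0 then 0 else 1)) ?_ ?_ ⟨hoff, hadj, hL, hsize, h⟩).mono ?_
  · rintro s ⟨-, -, -, -, h⟩
    have := h.potential_nonneg G
    split_ifs <;> omega
  · rintro s ⟨h1, h2, h3, h4, h⟩ hb
    simp only [Test.Holds, Expr.eval, not_lt] at hb
    have hu : ¬ s.reg cU < 0 := not_lt.2 hb
    obtain ⟨hu0, hua, -, -⟩ := h.current.resolve_left (by omega)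
    simp [bid, h1, h2, h3, h4]
    refine ⟨fun hp => ⟨fun he => ⟨fun hw => ?_, fun hw => ?_⟩, fun he => ?_⟩,
      fun hp => ⟨fun hl => ?_, fun hl => ?_⟩⟩
    · obtain ⟨k1, k2⟩ := h.assign G hb hp rfl he (by rw [if_pos hw])
      rw [if_pos hw] at k2
      refine ⟨⟨k2.symm, k1⟩, ?_⟩
      rw [bidPotential_advance hu0 hua, if_pos hw, if_neg hu]
      omega
    · obtain ⟨k1, k2⟩ := h.assign G hb hp rfl he (by rw [if_neg (not_lt.2 hw)])
      rw [if_neg (not_lt.2 hw), add_zero] at k2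
      refine ⟨⟨by exact_mod_cast k2.symm, k1⟩, ?_⟩
      rw [bidPotential_advance hu0 hua, if_neg (not_lt.2 hw), if_neg hu]
      omega
    · refine ⟨h.advance hb hp he, ?_⟩
      rw [bidPotential_advance hu0 hua, if_neg hu]
      omega
    · refine ⟨h.raise G hb (not_lt.2 hp) hl, ?_⟩
      rw [bidPotential_raise hu0 hua (le_antisymm (h.le_off _ hu0 hua) hp), if_neg hu]
      omega
    · refine ⟨h.give_up hb (not_lt.2 hp) (not_lt.2 hl), ?_⟩
      rw [if_neg hu]
      omega
  · rintro t s' ⟨⟨h1, h2, h3, h4, h⟩, hb, ht⟩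
    simp at hb ht
    rw [if_pos hb] at ht
    have hu : s'.reg cU = -1 := by have := h.current; omega
    refine ⟨h4, hu ▸ h, ?_⟩
    split_ifs at ht <;> omega

theorem wp_initBidding {s : State} {a b : ℕ} {L : ℤ} {off adj : ℤ → ℤ} (G : AdjLists a b off adj)
    (hoff : s.arr aOff = off) (hL : 0 < L) (ha : s.reg rL = a) (hb : s.reg rR = b) :
    WP initBidding s fun t s' =>
      s'.reg rSize = matched a (s'.arr aMate) ∧
      Bidding a b L off adj 0 (-1) (s'.arr aMate) (s'.arr bMR) (s'.arr bPr) (s'.arr bLev)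
        (s'.arr bPtr) ∧
      bidPotential a L off (s'.arr bLev) (s'.arr bPtr) = (L - 1) * (off a + a) + off a ∧
      (t : ℤ) ≤ 40 * (a + b) + 40 := by
  simp only [initBidding, wp_seq, wp_assign]
  refine (wp_forRange a (fun i s => s.arr aOff = off ∧ s.reg rR = b ∧ s.reg rSize = 0 ∧
    ∀ x : ℤ, 0 ≤ x → x < i → s.arr aMate x = -1 ∧ s.arr bLev x = 0 ∧ s.arr bPtr x = off x)
    (fun _ => 0) 30 ?_ (by decide) (by simp [ha]) ?_).mono ?_
  · rintro i s hi ⟨h1, h2, h3, h4⟩ hx hy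
    simp [hx, hy, h1, h2, h3]
    intro x hx0 hxi
    have := h4 x hx0
    grind
  · simp [hoff, hb]
    intro x; omega
  rintro t s ⟨⟨h1, h2, h3, h4⟩, -, -, ht⟩
  refine (wp_forRange b (fun i s => s.arr aOff = off ∧ s.reg rSize = 0 ∧
    (∀ x : ℤ, 0 ≤ x → x < a → s.arr aMate x = -1 ∧ s.arr bLev x = 0 ∧ s.arr bPtr x = off x) ∧
    ∀ x : ℤ, 0 ≤ x → x < i → s.arr bMR x = -1 ∧ s.arr bPr x = 0)
    (fun _ => 0) 30 ?_ (by decide) h2 ?_).mono ?_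
  · rintro i s hi ⟨h1, h3, h4, h5⟩ hx hy
    simp [hx, hy, h1, h3]
    refine ⟨h4, fun x hx0 hxi => ?_⟩
    have := h5 x hx0
    grind
  · simp [h1, h3]
    exact ⟨h4, fun x => by omega⟩
  rintro t' s ⟨⟨h1, h3, h4, h5⟩, -, -, ht'⟩
  have hm : matched a (s.arr aMate) = 0 := by
    simp only [matched, Finset.card_eq_zero, Finset.filter_eq_empty_iff, Finset.mem_Ico]
    intro x hx
    have := h4 x hx.1 hx.2
    omega
  refine ⟨by rw [h3, hm]; rfl, Bidding.init G hL (fun x h h' => (h4 x h h').1)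
    (fun x h h' => (h4 x h h').2.1) (fun x h h' => (h4 x h h').2.2) (fun x h h' => (h5 x h h').1)
    (fun x h h' => (h5 x h h').2),
    bidPotential_init G (fun x h h' => (h4 x h h').2.1) (fun x h h' => (h4 x h h').2.2), ?_⟩
  simp only [Expr.cost]
  push_cast
  omega

/-- One potential serves all iterations: an eviction chain may be long, but its steps are charged to
the initial potential, and each starting vertex adds only a constant. -/
theorem wp_bidding {s : State} {a b : ℕ} {L : ℤ} {off adj : ℤ → ℤ} (G : AdjLists a b off adj)
    (hoff : s.arr aOff = off) (hadj : s.arr aAdj = adj) (hL : s.reg cL = L) (ha : s.reg rL = a)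
    (hsize : s.reg rSize = matched a (s.arr aMate))
    (h : Bidding a b L off adj 0 (-1) (s.arr aMate) (s.arr bMR) (s.arr bPr) (s.arr bLev)
      (s.arr bPtr)) :
    WP bidding s fun t s' =>
      s'.reg rSize = matched a (s'.arr aMate) ∧
      Bidding a b L off adj a (-1) (s'.arr aMate) (s'.arr bMR) (s'.arr bPr) (s'.arr bLev)
        (s'.arr bPtr) ∧
      (t : ℤ) ≤ 60 * bidPotential a L off (s.arr bLev) (s.arr bPtr) + 100 * a + 6 := by
  refine (wp_forRange a (fun i s => s.arr aOff = off ∧ s.arr aAdj = adj ∧ s.reg cL = L ∧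
      s.reg rSize = matched a (s.arr aMate) ∧
      Bidding a b L off adj i (-1) (s.arr aMate) (s.arr bMR) (s.arr bPr) (s.arr bLev)
        (s.arr bPtr))
    (fun s => 60 * bidPotential a L off (s.arr bLev) (s.arr bPtr)) 80 ?_ (by decide) ha ?_).mono ?_
  · rintro i s hi ⟨h1, h2, h3, h4, h⟩ hx hy
    simp only [wp_seq, wp_assign]
    refine (wp_bid_loop (L := L) (i := i + 1) G (by simp [h1]) (by simp [h2]) (by simp [h3])
      (by simpa using h4) ?_).mono_frame ?_
    · simpa [hx] using h.start (by omega) (by omega)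
    · rintro t s' hr harr ⟨k1, k2, k3⟩
      have e1 : s'.reg cI = i := (hr _ (by decide)).trans (by simp [hx])
      have e2 : s'.reg rL = a := (hr _ (by decide)).trans (by simp [hy])
      have e3 : s'.reg cL = L := (hr _ (by decide)).trans (by simp [h3])
      have e4 : s'.arr aOff = off := (harr _ (by decide)).trans (by simp [h1])
      have e5 : s'.arr aAdj = adj := (harr _ (by decide)).trans (by simp [h2])
      simp at k3
      simp [e1, e2, e3, e4, e5, k1]
      exact ⟨k2, by omega⟩
  · simpa [hoff, hadj, hL, hsize] using h
  · rintro t s' ⟨⟨h1, h2, h3, h4, h⟩, -, -, ht⟩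
    have := h.potential_nonneg G
    simp at ht
    exact ⟨h4, h, by omega⟩

theorem wp_initSearch {s : State} {a b : ℕ} {off adj : ℤ → ℤ} (G : AdjLists a b off adj)
    (hoff : s.arr aOff = off) (ha : s.reg rL = a) (hb : s.reg rR = b)
    (hM : Mates a b off adj (s.arr aMate) (s.arr bMR)) :
    WP initSearch s fun t s' => s'.reg cHead = 0 ∧ s'.reg cTail ≤ a ∧ s'.reg cFound = -1 ∧
      Searching a b off adj (s.arr aMate) (s.arr bMR) (s'.arr bPtr) (s'.arr bVis) (s'.arr bPar)
        (s'.arr bQ) (s'.reg cHead) (s'.reg cTail) (s'.reg cCnt) (s'.reg cFound) ∧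
      (t : ℤ) ≤ 50 * (a + b) + 40 := by
  generalize hmate : s.arr aMate = mate at hM ⊢
  generalize s.arr bMR = mr at hM ⊢
  simp only [initSearch, wp_seq, wp_assign]
  refine (wp_forRange a (fun i s => s.arr aOff = off ∧ s.arr aMate = mate ∧ s.reg rR = b ∧
    s.reg cHead = 0 ∧ s.reg cCnt = 0 ∧ s.reg cFound = -1 ∧ 0 ≤ s.reg cTail ∧ s.reg cTail ≤ i ∧
    (∀ x : ℤ, 0 ≤ x → x < i → s.arr bPtr x = off x) ∧
    (∀ k : ℤ, 0 ≤ k → k < s.reg cTail →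
      0 ≤ s.arr bQ k ∧ s.arr bQ k < a ∧ mate (s.arr bQ k) = -1) ∧
    ∀ x : ℤ, 0 ≤ x → x < i → mate x = -1 → ∃ k, 0 ≤ k ∧ k < s.reg cTail ∧ s.arr bQ k = x)
    (fun _ => 0) 40 ?_ (by decide) (by simp [ha]) ?_).mono ?_
  · rintro i s hi ⟨h1, h2, h3, h4, h5, h6, h7, h8, h9, h10, h11⟩ hx hy
    have hl := hM.left i (by omega) (by omega)
    have hptr : ∀ x : ℤ, 0 ≤ x → x ≤ i →
        Function.update (s.arr bPtr) (i : ℤ) (off i) x = off x := by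
      intro x hx0 hxi
      have := h9 x hx0
      grind
    simp [hx, hy, h1, h2, h3, h4, h5, h6]
    refine ⟨fun hm => ⟨by omega, by omega, hptr, fun k hk0 hk => ?_, fun x hx0 hxi hmx => ?_⟩,
      fun hm => ⟨by omega, by omega, hptr, h10, fun x hx0 hxi hmx => ?_⟩⟩
    · have := h10 k hk0
      grind
    · by_cases hxi' : x = i
      · exact ⟨s.reg cTail, h7, by omega, by simp [hxi']⟩
      · obtain ⟨k, hk0, hk, hkx⟩ := h11 x hx0 (by omega) hmx
        exact ⟨k, hk0, by omega, by rw [Function.update_of_ne (by omega), hkx]⟩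
    · by_cases hxi' : x = i
      · subst hxi'; omega
      · exact h11 x hx0 (by omega) hmx
  · simp [hoff, hmate, hb]
    refine ⟨fun x => by omega, fun k => by omega, fun x => by omega⟩
  rintro t s ⟨⟨h1, h2, h3, h4, h5, h6, h7, h8, h9, h10, h11⟩, -, -, ht⟩
  refine (wp_forRange b (fun i s =>
    s.reg cHead = 0 ∧ s.reg cCnt = 0 ∧ s.reg cFound = -1 ∧ 0 ≤ s.reg cTail ∧ s.reg cTail ≤ a ∧
    (∀ x : ℤ, 0 ≤ x → x < a → s.arr bPtr x = off x) ∧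
    (∀ k : ℤ, 0 ≤ k → k < s.reg cTail →
      0 ≤ s.arr bQ k ∧ s.arr bQ k < a ∧ mate (s.arr bQ k) = -1) ∧
    (∀ x : ℤ, 0 ≤ x → x < a → mate x = -1 → ∃ k, 0 ≤ k ∧ k < s.reg cTail ∧ s.arr bQ k = x) ∧
    ∀ x : ℤ, 0 ≤ x → x < i → s.arr bVis x = 0)
    (fun _ => 0) 30 ?_ (by decide) h3 ?_).mono ?_
  · rintro i s hi ⟨h4, h5, h6, h7, h8, h9, h10, h11, h12⟩ hx hy
    simp [hx, hy, h4, h5, h6, h7, h8]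
    refine ⟨h9, h10, h11, fun x hx0 hxi => ?_⟩
    have := h12 x hx0
    grind
  · simp [h4, h5, h6, h7, h8]
    exact ⟨h9, h10, h11, fun x => by omega⟩
  rintro t' s ⟨⟨h4, h5, h6, h7, h8, h9, h10, h11, h12⟩, -, -, ht'⟩
  refine ⟨h4, h8, h6, ?_, ?_⟩
  · rw [h4, h5, h6]
    exact Searching.init G h7 h10 h11 h9 h12
  · simp only [Expr.cost]
    push_cast
    omega

/-- Every step consumes an arc or a queue entry. An arc is worth 140, since scanning it may append
an entry worth 70. -/
theorem wp_searchLoop {s : State} {a b : ℕ} {off adj mate mr : ℤ → ℤ} (G : AdjLists a b off adj)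
    (hoff : s.arr aOff = off) (hadj : s.arr aAdj = adj)
    (hmr : s.arr bMR = mr) (hM : Mates a b off adj mate mr)
    (hhead : s.reg cHead = 0)
    (h : Searching a b off adj mate mr (s.arr bPtr) (s.arr bVis) (s.arr bPar)
      (s.arr bQ) (s.reg cHead) (s.reg cTail) (s.reg cCnt) (s.reg cFound)) :
    WP searchLoop s fun t s' =>
      Searching a b off adj mate mr (s'.arr bPtr) (s'.arr bVis) (s'.arr bPar)
        (s'.arr bQ) (s'.reg cHead) (s'.reg cTail) (s'.reg cCnt) (s'.reg cFound) ∧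
      (s'.reg cFound < 0 → ¬ s'.reg cHead < s'.reg cTail) ∧
      (t : ℤ) ≤ 140 * off a + 70 * s.reg cTail + 10 := by
  refine (wp_while (fun s => s.arr aOff = off ∧ s.arr aAdj = adj ∧ s.arr bMR = mr ∧
      Searching a b off adj mate mr (s.arr bPtr) (s.arr bVis) (s.arr bPar)
        (s.arr bQ) (s.reg cHead) (s.reg cTail) (s.reg cCnt) (s.reg cFound))
    (fun s => 140 * ∑ x ∈ Finset.Ico (0 : ℤ) a, (off (x + 1) - s.arr bPtr x) +
      70 * (s.reg cTail - s.reg cHead)) ?_ ?_ ⟨hoff, hadj, hmr, h⟩).mono ?_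
  · rintro s ⟨-, -, -, h⟩
    have := h.remaining_nonneg
    have := h.head_le
    omega
  · rintro s ⟨h1, h2, h3, h⟩ hb
    simp only [Test.Holds, Expr.eval] at hb
    obtain ⟨hlt, hf⟩ := hb
    have hf : s.reg cFound = -1 := by have := h.found_free; omega
    obtain ⟨hu0, hua, -⟩ := h.queue _ h.head_nonneg hlt
    rw [hf] at h
    simp [searchStep, h1, h2, h3, hf]
    refine ⟨fun hp => ⟨fun hv => ⟨fun hw => ?_, fun hw => ?_⟩, fun hv => ?_⟩, fun hp => ?_⟩
    · refine ⟨h.visit hlt rfl hp G hM rfl hv (Or.inl ⟨hw, rfl, rfl, rfl⟩), ?_⟩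
      have := sum_remaining (off := off) (ptr := s.arr bPtr) hu0 hua
      simp at this
      omega
    · refine ⟨h.visit hlt rfl hp G hM rfl hv (Or.inr ⟨not_lt.2 hw, rfl, rfl, rfl⟩), ?_⟩
      have := sum_remaining (off := off) (ptr := s.arr bPtr) hu0 hua
      simp at this
      omega
    · refine ⟨h.skip hlt rfl hp G hv, ?_⟩
      have := sum_remaining (off := off) (ptr := s.arr bPtr) hu0 hua
      simp at this
      omega
    · exact ⟨h.pop hlt (not_lt.2 hp), by omega⟩
  · rintro t s' ⟨⟨-, -, -, h'⟩, hb, ht⟩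
    simp only [Test.Holds, Expr.eval] at hb
    refine ⟨h', by tauto, ?_⟩
    have h1 := h'.remaining_nonneg
    have h2 := h'.head_le
    have h3 := h.count
    have h4 := h.cnt_nonneg
    simp only [Test.cost, Expr.cost] at ht
    omega

/-- The stamp of the vertex left out decreases strictly and so bounds the number of steps. Invariant
is the size of the matching plus one for a vertex left out. -/
theorem wp_augmentLoop {s : State} {a b : ℕ} {off adj vis par : ℤ → ℤ}
    (hpar : s.arr bPar = par)
    (h : Augmenting a b off adj vis par (s.reg cV) (s.arr aMate) (s.arr bMR)) :
    WP augmentLoop s fun t s' => Mates a b off adj (s'.arr aMate) (s'.arr bMR) ∧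
      (0 ≤ s.reg cV → (matched a (s'.arr aMate) : ℤ) = matched a (s.arr aMate) + 1 ∧
        (t : ℤ) ≤ 60 * vis (s.reg cV) + 70) := by
  refine (wp_while (fun s' => s'.arr bPar = par ∧
      Augmenting a b off adj vis par (s'.reg cV) (s'.arr aMate) (s'.arr bMR) ∧
      (matched a (s'.arr aMate) : ℤ) + (if s'.reg cV < 0 then 0 else 1) =
        matched a (s.arr aMate) + (if s.reg cV < 0 then 0 else 1))
    (fun s => if s.reg cV < 0 then 0 else 60 * vis (s.reg cV)) ?_ ?_ ⟨hpar, h, rfl⟩).mono ?_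
  · rintro s ⟨-, h, -⟩
    have := h.current
    split_ifs <;> omega
  · rintro s ⟨h1, h, h3⟩ hb
    simp only [Test.Holds, Expr.eval, not_lt] at hb
    obtain ⟨k1, k2, k3⟩ := h.step hb rfl
    have h4 := h.current
    rw [if_neg (not_lt.2 hb), ← k3] at h3
    simp [h1]
    refine ⟨⟨k1, h3⟩, ?_⟩
    rw [if_neg (not_lt.2 hb)]
    have := k1.current
    split_ifs <;> omega
  · rintro t s' ⟨⟨h1, h', h3⟩, hb, ht⟩
    simp only [Test.Holds, Expr.eval, not_not] at hb
    have hv : s'.reg cV = -1 := by have := h'.current; omega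
    rw [hv] at h'
    refine ⟨h'.mates, fun h0 => ?_⟩
    simp only [if_pos hb, if_neg (not_lt.2 h0)] at h3 ht
    simp only [Test.cost, Expr.cost] at ht
    omega

theorem wp_improveStep {s : State} {a b : ℕ} {off adj : ℤ → ℤ} (G : AdjLists a b off adj)
    (hoff : s.arr aOff = off) (hadj : s.arr aAdj = adj) (ha : s.reg rL = a) (hb : s.reg rR = b)
    (hM : Mates a b off adj (s.arr aMate) (s.arr bMR))
    (hsize : s.reg rSize = matched a (s.arr aMate)) :
    WP improveStep s fun t s' => Mates a b off adj (s'.arr aMate) (s'.arr bMR) ∧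
      s'.reg rSize = matched a (s'.arr aMate) ∧ (t : ℤ) ≤ 250 * (off a + a + b + 1) ∧
      ((s'.reg cGo = s.reg cGo ∧ s'.reg rSize = s.reg rSize + 1) ∨
        (s'.reg cGo = 0 ∧ s'.arr aMate = s.arr aMate ∧
          ∃ S T : Finset ℤ, (∀ x v : ℤ, 0 ≤ x → x < a → Arc off adj x v → x ∈ S ∨ v ∈ T) ∧
            S.card + T.card ≤ matched a (s.arr aMate))) := by
  have hD := (G.off_nonneg_le (u := a) (by omega) le_rfl).1
  simp only [improveStep, wp_seq]
  refine (wp_initSearch G hoff ha hb hM).mono_frame ?_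
  rintro t₁ s₁ hr₁ harr₁ ⟨k1, k2, k3, k4, ht₁⟩
  refine (wp_searchLoop G ((harr₁ _ (by decide)).trans hoff) ((harr₁ _ (by decide)).trans hadj)
    (harr₁ _ (by decide)) hM k1 k4).mono_frame ?_
  rintro t₂ s₂ hr₂ harr₂ ⟨k5, k6, ht₂⟩
  have e1 : s₂.arr aMate = s.arr aMate := (harr₂ _ (by decide)).trans (harr₁ _ (by decide))
  have e2 : s₂.arr bMR = s.arr bMR := (harr₂ _ (by decide)).trans (harr₁ _ (by decide))
  have e3 : s₂.reg rSize = s.reg rSize := (hr₂ _ (by decide)).trans (hr₁ _ (by decide))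
  have e4 : s₂.reg cGo = s.reg cGo := (hr₂ _ (by decide)).trans (hr₁ _ (by decide))
  rw [wp_ite]
  simp only [Test.Holds, Expr.eval]
  refine ⟨fun hf => ?_, fun hf => ?_⟩
  · have hf' : s₂.reg cFound = -1 := by have := k5.found_free; omega
    rw [hf'] at k5
    simp only [wp_assign]
    simp [e1, e2, e3, hM, hsize]
    exact ⟨by omega, k5.card_le G hM (k6 hf)⟩
  · have hA := k5.augmenting hM hf
    obtain ⟨hf0, hfb, -, -⟩ := k5.found_free.resolve_left (by omega)
    simp only [wp_seq, wp_assign]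
    refine (wp_augmentLoop (s := s₂.setReg cV (s₂.reg cFound)) (par := s₂.arr bPar)
      (vis := s₂.arr bVis) rfl (by simpa [e1, e2] using hA)).mono_frame ?_
    rintro t₃ s₃ hr₃ - ⟨k7, k8⟩
    simp [e1] at k8
    obtain ⟨k8, ht₃⟩ := k8 (by omega)
    have e5 : s₃.reg rSize = s.reg rSize := (hr₃ _ (by decide)).trans (by simp [e3])
    have e6 : s₃.reg cGo = s.reg cGo := (hr₃ _ (by decide)).trans (by simp [e4])
    -- The stamp of the free endpoint is at most `cnt ≤ off a`, so the augmentation takes linear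
    -- time as well.
    have h1 := k5.vis_le _ hf0 hfb
    have h2 := k5.count
    have h3 := k5.remaining_nonneg
    simp [e5, e6, k7, k8, hsize]
    omega

/-- The matching that is described by an array of partners. -/
noncomputable def matching (a : ℕ) (mate : ℤ → ℤ) : Finset (ℕ × ℕ) :=
  ((Finset.range a).filter fun u : ℕ => 0 ≤ mate u).image fun u => (u, (mate u).toNat)

theorem mem_matching {a : ℕ} {mate : ℤ → ℤ} {u v : ℕ} :
    (u, v) ∈ matching a mate ↔ u < a ∧ mate u = v := by
  simp only [matching, Finset.mem_image, Finset.mem_filter, Finset.mem_range, Prod.mk.injEq]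
  constructor
  · rintro ⟨x, ⟨h1, h2⟩, rfl, rfl⟩
    exact ⟨h1, by omega⟩
  · rintro ⟨h1, h2⟩
    exact ⟨u, ⟨h1, by omega⟩, rfl, by omega⟩

theorem card_matching (a : ℕ) (mate : ℤ → ℤ) : (matching a mate).card = matched a mate := by
  rw [matching, Finset.card_image_of_injective _ fun x y h => (Prod.mk.inj h).1, matched]
  refine Finset.card_nbij' (fun u => (u : ℤ)) Int.toNat ?_ ?_ ?_ ?_
  all_goals
    intro x hx
    simp only [Finset.coe_filter, Finset.mem_Ico, Finset.mem_range, Set.mem_ofPred_eq] at hx ⊢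
  · exact ⟨by omega, hx.2⟩
  · rw [Int.toNat_of_nonneg hx.1.1]
    exact ⟨by omega, hx.2⟩
  · omega
  · omega

theorem Mates.isMatching {a b : ℕ} {off adj mate mr : ℤ → ℤ} (h : Mates a b off adj mate mr)
    {E : Finset (ℕ × ℕ)} (hE : ∀ u v : ℕ, (u, v) ∈ E ↔ u < a ∧ Arc off adj u v) :
    Bipartite.IsMatching E (matching a mate) := by
  constructor
  · rintro ⟨u, v⟩ huv
    rw [mem_matching] at huv
    have := h.left u (by omega) (by omega)
    rw [hE, ← huv.2]
    exact ⟨huv.1, by rcases this with h | h; omega; exact h.2.2.1⟩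
  · rintro ⟨u, v⟩ huv ⟨u', v'⟩ huv' heq
    rw [mem_matching] at huv huv'
    have h1 := h.left u (by omega) (by omega)
    have h2 := h.left u' (by omega) (by omega)
    dsimp only at heq
    have : u = u' := by grind
    subst this
    have : (v : ℤ) = v' := huv.2.symm.trans huv'.2
    exact Prod.ext rfl (by exact_mod_cast this)

/-- By `hL` at most `L` searches succeed, and one fails. The term `cGo` in the potential pays for
the failing one. -/
theorem wp_improve {s : State} {a b : ℕ} {off adj : ℤ → ℤ} (G : AdjLists a b off adj)
    {E : Finset (ℕ × ℕ)} (hE : ∀ u v : ℕ, (u, v) ∈ E ↔ u < a ∧ Arc off adj u v)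
    (hoff : s.arr aOff = off) (hadj : s.arr aAdj = adj) (ha : s.reg rL = a) (hb : s.reg rR = b)
    (hM : Mates a b off adj (s.arr aMate) (s.arr bMR))
    (hsize : s.reg rSize = matched a (s.arr aMate)) {L : ℤ}
    (hL : ∀ M, Bipartite.IsMatching E M → (M.card : ℤ) ≤ s.reg rSize + L) :
    WP improve s fun t s' => Mates a b off adj (s'.arr aMate) (s'.arr bMR) ∧
      s'.reg rSize = matched a (s'.arr aMate) ∧
      (∃ S T : Finset ℤ, (∀ x v : ℤ, 0 ≤ x → x < a → Arc off adj x v → x ∈ S ∨ v ∈ T) ∧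
            S.card + T.card ≤ matched a (s'.arr aMate)) ∧
      (t : ℤ) ≤ 260 * (off a + a + b + 1) * (L + 1) + 10 := by
  have hD := (G.off_nonneg_le (u := a) (by omega) le_rfl).1
  have hW : 0 ≤ 260 * (off a + a + b + 1) := by omega
  have hbound : ∀ mate mr, Mates a b off adj mate mr → (matched a mate : ℤ) ≤ s.reg rSize + L :=
    fun mate mr h => card_matching a mate ▸ hL _ (h.isMatching hE)
  simp only [improve, wp_seq, wp_assign]
  refine (wp_while (fun s => s.arr aOff = off ∧ s.arr aAdj = adj ∧ s.reg rL = a ∧ s.reg rR = b ∧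
      Mates a b off adj (s.arr aMate) (s.arr bMR) ∧ s.reg rSize = matched a (s.arr aMate) ∧
      (s.reg cGo = 1 ∨ (s.reg cGo = 0 ∧
        ∃ S T : Finset ℤ, (∀ x v : ℤ, 0 ≤ x → x < a → Arc off adj x v → x ∈ S ∨ v ∈ T) ∧
            S.card + T.card ≤ matched a (s.arr aMate))))
    (fun s' => 260 * (off a + a + b + 1) * (s.reg rSize + L - s'.reg rSize + s'.reg cGo))
    ?_ ?_ ?_).mono ?_
  · rintro s' ⟨-, -, -, -, h, h', hgo⟩
    have := hbound _ _ h
    exact mul_nonneg hW (by omega)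
  · rintro s' ⟨h1, h2, h3, h4, h5, h6, hgo⟩ hlt
    simp only [Test.Holds, Expr.eval] at hlt
    have hgo : s'.reg cGo = 1 := by omega
    refine (wp_improveStep G h1 h2 h3 h4 h5 h6).mono_frame ?_
    rintro t s'' hr harr ⟨k1, k2, k3, k4⟩
    rw [hgo] at k4
    have e1 : s''.reg rL = a := (hr _ (by decide)).trans h3
    have e2 : s''.reg rR = b := (hr _ (by decide)).trans h4
    have e3 : s''.arr aOff = off := (harr _ (by decide)).trans h1
    have e4 : s''.arr aAdj = adj := (harr _ (by decide)).trans h2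
    simp only [Test.cost, Expr.cost, hgo]
    push_cast
    rcases k4 with ⟨k4, k5⟩ | ⟨k4, k5, k6⟩
    · refine ⟨⟨e3, e4, e1, e2, k1, k2, Or.inl k4⟩, ?_⟩
      rw [k4, k5]
      linarith
    · refine ⟨⟨e3, e4, e1, e2, k1, k2, Or.inr ⟨k4, k5 ▸ k6⟩⟩, ?_⟩
      have : s''.reg rSize = s'.reg rSize := by rw [k2, k5, h6]
      rw [k4, this]
      linarith
  · simp [hoff, hadj, ha, hb, hM, hsize]
  · rintro t s' ⟨⟨h1, h2, h3, h4, h5, h6, h7⟩, hb', ht⟩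
    simp only [Test.Holds, Expr.eval] at hb'
    have hgo : s'.reg cGo = 0 := by omega
    refine ⟨h5, h6, ?_, ?_⟩
    · rcases h7 with h7 | h7
      · omega
      · exact h7.2
    · simp at ht
      have h8 := hbound _ _ h5
      rw [← h6] at h8
      rw [hgo] at ht
      have := mul_nonneg hW (by omega : 0 ≤ s.reg rSize + L - s'.reg rSize + 0)
      simp
      linarith

/-- Correctness and running time of the matching subroutine. -/
theorem wp_maximumMatching {s : State} {a b : ℕ} {E : Finset (ℕ × ℕ)} (h : HoldsGraph s a b E) :
    ∃ (t : ℕ) (s' : State) (M : Finset (ℕ × ℕ)), Exec maximumMatching s t s' ∧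
      Bipartite.IsMaximumMatching E M ∧ HoldsMatching s' a M ∧
      (∀ x < reserved, x ≠ rSize → s'.reg x = s.reg x) ∧
      (∀ x < reserved, x ≠ aMate → s'.arr x = s.arr x) ∧
      (t : ℤ) ≤ 1000 * (s.arr aOff a + a + b + 1) * (Nat.sqrt a + 1) := by
  have G : AdjLists a b (s.arr aOff) (s.arr aAdj) := by
    refine ⟨h.off_zero, fun u h0 ha => ?_, h.adj_range⟩
    lift u to ℕ using h0
    exact h.off_mono u (by omega)
  have hE : ∀ u v : ℕ, (u, v) ∈ E ↔ u < a ∧ Arc (s.arr aOff) (s.arr aAdj) u v := h.mem_iff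
  have hcov : ∀ S T : Finset ℤ,
      (∀ x v : ℤ, 0 ≤ x → x < a → Arc (s.arr aOff) (s.arr aAdj) x v → x ∈ S ∨ v ∈ T) →
      ∀ M, Bipartite.IsMatching E M → M.card ≤ S.card + T.card := by
    intro S T hc M hM
    refine hM.card_le_of_cover S T fun u v huv => ?_
    rw [hE] at huv
    exact hc u v (by omega) (by omega) huv.2
  generalize hoff : s.arr aOff = off at G hE hcov ⊢
  generalize hadj : s.arr aAdj = adj at G hE hcov
  have hD := (G.off_nonneg_le (u := a) (by omega) le_rfl).1
  have key : WP maximumMatching s fun t s' =>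
      ∃ M, Bipartite.IsMaximumMatching E M ∧ HoldsMatching s' a M ∧
      (t : ℤ) ≤ 1000 * (off a + a + b + 1) * (Nat.sqrt a + 1) := by
    simp only [maximumMatching, wp_seq]
    refine (wp_sqrtUp h.left).mono_frame ?_
    rintro t₁ s₁ hr₁ harr₁ ⟨hL, haL, hLa, ht₁⟩
    refine (wp_initBidding G ((harr₁ _ (by decide)).trans hoff) hL
      ((hr₁ _ (by decide)).trans h.left) ((hr₁ _ (by decide)).trans h.right)).mono_frame ?_
    rintro t₂ s₂ hr₂ harr₂ ⟨k1, k2, k3, ht₂⟩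
    refine (wp_bidding (L := s₁.reg cL) G
      ((harr₂ _ (by decide)).trans ((harr₁ _ (by decide)).trans hoff))
      ((harr₂ _ (by decide)).trans ((harr₁ _ (by decide)).trans hadj)) (hr₂ _ (by decide))
      ((hr₂ _ (by decide)).trans ((hr₁ _ (by decide)).trans h.left)) k1 k2).mono_frame ?_
    rintro t₃ s₃ hr₃ harr₃ ⟨k4, k5, ht₃⟩
    refine (wp_improve G hE
      ((harr₃ _ (by decide)).trans ((harr₂ _ (by decide)).trans ((harr₁ _ (by decide)).trans hoff)))
      ((harr₃ _ (by decide)).trans ((harr₂ _ (by decide)).trans ((harr₁ _ (by decide)).trans hadj)))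
      ((hr₃ _ (by decide)).trans ((hr₂ _ (by decide)).trans ((hr₁ _ (by decide)).trans h.left)))
      ((hr₃ _ (by decide)).trans ((hr₂ _ (by decide)).trans ((hr₁ _ (by decide)).trans h.right)))
      k5.toMates k4 (L := s₁.reg cL) ?_).mono ?_
    -- The cover left by the bidding phase bounds the number of missing edges by `L`.
    · obtain ⟨S, T, hc, hST⟩ := k5.card_le G hL haL
      intro M hM
      rw [k4]
      exact le_trans (by exact_mod_cast hcov S T hc M hM) hST
    · rintro t₄ s₄ ⟨k6, k7, ⟨S, T, hc, hST⟩, ht₄⟩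
      refine ⟨matching a (s₄.arr aMate), ⟨k6.isMatching hE, fun M hM => ?_⟩, ?_, ?_⟩
      · rw [card_matching]
        exact (hcov S T hc M hM).trans hST
      · refine ⟨by rw [k7, card_matching], fun u hu v => ?_, fun u hu hv => ?_⟩
        · rw [mem_matching]; tauto
        · refine (k6.left u (by omega) (by omega)).resolve_right fun hl => ?_
          refine hv (s₄.arr aMate u).toNat ?_
          rw [mem_matching]
          exact ⟨hu, by omega⟩
      · rw [k3] at ht₃
        -- As `L ≤ √a + 1`, both the initial bidding potential and the `L + 1` searches cost `O(√a)`
        -- times the size of the graph.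
        generalize s₁.reg cL = L at *
        have hq : (0 : ℤ) ≤ Nat.sqrt a := by omega
        generalize (Nat.sqrt a : ℤ) = q at *
        push_cast
        have h1 : (L - 1) * (off a + a) ≤ q * (off a + a) :=
          mul_le_mul_of_nonneg_right (by omega) (by omega)
        have h2 : 260 * (off a + a + b + 1) * (L + 1) ≤ 260 * (off a + a + b + 1) * (q + 2) :=
          mul_le_mul_of_nonneg_left (by omega) (by omega)
        have h3 : 0 ≤ q * off a := mul_nonneg hq hD
        have h4 : 0 ≤ q * a := mul_nonneg hq (by omega)
        have h5 : 0 ≤ q * b := mul_nonneg hq (by omega)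
        linarith
  obtain ⟨t, s', he, M, h1, h2, h3⟩ := key
  refine ⟨t, s', M, he, h1, h2, fun x hx hne => he.reg_eq ?_, fun x hx hne => he.arr_eq ?_, h3⟩
  · have : ∀ x ∈ maximumMatching.regs, x = rSize ∨ reserved ≤ x := by decide
    intro hmem
    have := this x hmem
    omega
  · have : ∀ x ∈ maximumMatching.arrs, x = aMate ∨ reserved ≤ x := by decide
    intro hmem
    have := this x hmem
    omega

theorem computesMaximumMatchings : ComputesMaximumMatchings maximumMatching := fun _ _ _ _ h =>
  let ⟨t, s', M, h1, h2, h3, h4, h5, _⟩ := wp_maximumMatching h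
  ⟨t, s', M, h1, h2, h3, h4, h5⟩

end Matching

/-! ### Transport of matchings along a renaming of vertices -/

namespace Bipartite

variable {α β γ δ : Type*}

/-- On the second side, injectivity is required only at endpoints of edges, because a numbering of
the projections is injective on nothing more. -/
theorem IsMatching.image [DecidableEq γ] [DecidableEq δ] {E M : Finset (α × β)}
    (hM : IsMatching E M) {f : α → γ} {g : β → δ} (hf : f.Injective)
    (hg : Set.InjOn g {b | ∃ e ∈ E, e.2 = b}) :
    IsMatching (E.image (Prod.map f g)) (M.image (Prod.map f g)) ∧
      (M.image (Prod.map f g)).card = M.card := by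
  have hg' : ∀ e ∈ M, ∀ e' ∈ M, g e.2 = g e'.2 → e.2 = e'.2 := fun e he e' he' h =>
    hg ⟨e, hM.1 he, rfl⟩ ⟨e', hM.1 he', rfl⟩ h
  refine ⟨⟨Finset.image_subset_image hM.1, ?_⟩, Finset.card_image_of_injOn fun e he e' he' h =>
    hM.2 e he e' he' (Or.inl (hf (Prod.mk.inj h).1))⟩
  intro x hx y hy h
  obtain ⟨e, he, rfl⟩ := Finset.mem_image.1 hx
  obtain ⟨e', he', rfl⟩ := Finset.mem_image.1 hy
  rw [hM.2 e he e' he' (h.imp (fun h => hf h) (hg' e he e' he'))]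

theorem IsMatching.preimage [DecidableEq γ] [DecidableEq δ] {E : Finset (α × β)}
    {f : α → γ} {g : β → δ} (hf : f.Injective) (hg : Set.InjOn g {b | ∃ e ∈ E, e.2 = b})
    {M' : Finset (γ × δ)} (hM : IsMatching (E.image (Prod.map f g)) M') :
    IsMatching E (E.filter fun e => Prod.map f g e ∈ M') ∧
      (E.filter fun e => Prod.map f g e ∈ M').card = M'.card := by
  have hinj : ∀ e ∈ E, ∀ e' ∈ E, Prod.map f g e = Prod.map f g e' → e = e' := fun e he e' he' h =>
    Prod.ext (hf (Prod.mk.inj h).1) (hg ⟨e, he, rfl⟩ ⟨e', he', rfl⟩ (Prod.mk.inj h).2)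
  refine ⟨⟨Finset.filter_subset _ _, ?_⟩, ?_⟩
  · intro e he e' he' h
    rw [Finset.mem_filter] at he he'
    exact hinj e he.1 e' he'.1 (hM.2 _ he.2 _ he'.2
      (h.imp (fun h => congrArg f h) fun h => congrArg g h))
  · rw [← Finset.card_image_of_injOn (f := Prod.map f g)]
    · congr 1
      ext x
      simp only [Finset.mem_image, Finset.mem_filter]
      constructor
      · rintro ⟨e, ⟨_, he⟩, rfl⟩
        exact he
      · intro hx
        obtain ⟨e, he, rfl⟩ := Finset.mem_image.1 (hM.1 hx)
        exact ⟨e, ⟨he, hx⟩, rfl⟩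
    · intro e he e' he' h
      exact hinj e (Finset.mem_filter.1 he).1 e' (Finset.mem_filter.1 he').1 h

end Bipartite

/-! ### Optimal density and matchings of the instance graph -/

namespace SEP

variable {n : ℕ} (I : SEP n)

theorem proj_mem_path (u : Fin n) (d : Dir) : I.proj u d ∈ I.path u d := by
  obtain ⟨h1, h2, h3, h4⟩ := I.inside u
  cases d <;> simp [proj, path, h1, h2, h3, h4]

theorem mem_projections {u : Fin n} {v : ℤ × ℤ} : v ∈ I.projections u ↔ ∃ d, I.proj u d = v := by
  simp only [projections, Finset.mem_insert, Finset.mem_singleton]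
  constructor
  · rintro (h | h | h | h)
    exacts [⟨_, h.symm⟩, ⟨_, h.symm⟩, ⟨_, h.symm⟩, ⟨_, h.symm⟩]
  · rintro ⟨d, rfl⟩
    cases d <;> simp

theorem mem_edges {j : ℕ} {u : Fin n} {v : ℤ × ℤ} {i : Fin j} :
    (u, (v, i)) ∈ I.edges j ↔ ∃ d, I.proj u d = v := by
  rw [← mem_projections]
  simp [edges]

theorem mem_copies {j : ℕ} {v : ℤ × ℤ} {i : Fin j} :
    (v, i) ∈ I.copies j ↔ ∃ u d, I.proj u d = v := by
  simp [copies, mem_projections]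

theorem load_le (o : Fin n → Dir) (c : ℤ × ℤ) : I.load o c ≤ n := by
  have := Set.ncard_le_card (s := {u : Fin n | c ∈ I.path u (o u)})
  simpa [load] using this

theorem exists_load_le_optDensity : ∃ o : Fin n → Dir, ∀ c, I.load o c ≤ I.optDensity :=
  Nat.sInf_mem (s := {d : ℕ | ∃ o : Fin n → Dir, ∀ c : ℤ × ℤ, I.load o c ≤ d})
    ⟨n, fun _ => .left, I.load_le _⟩

theorem optDensity_le : I.optDensity ≤ n :=
  Nat.sInf_le ⟨fun _ => .left, I.load_le _⟩

theorem one_le_optDensity (hn : 1 ≤ n) : 1 ≤ I.optDensity := by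
  obtain ⟨o, ho⟩ := I.exists_load_le_optDensity
  refine le_trans ?_ (ho (I.proj ⟨0, hn⟩ (o ⟨0, hn⟩)))
  rw [load, Nat.one_le_iff_ne_zero, ← Nat.pos_iff_ne_zero, Set.ncard_pos (Set.toFinite _)]
  exact ⟨_, I.proj_mem_path _ _⟩

/-- Points that end in `v` all have `v` on their escape paths, so an optimal choice of directions
sends at most `optDensity` points to `v`, and these embed into the `j` copies. -/
theorem exists_matching {j : ℕ} (hj : I.optDensity ≤ j) :
    ∃ M : Finset (Fin n × ((ℤ × ℤ) × Fin j)), Bipartite.IsMatching (I.edges j) M ∧ M.card = n := by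
  obtain ⟨o, ho⟩ := I.exists_load_le_optDensity
  have : ∀ v : ℤ × ℤ, Nonempty ({u : Fin n // I.proj u (o u) = v} ↪ Fin j) := by
    intro v
    refine Function.Embedding.nonempty_of_card_le ?_
    rw [Fintype.card_fin]
    refine le_trans ?_ ((ho v).trans hj)
    rw [load, ← Nat.card_eq_fintype_card]
    refine Set.ncard_le_ncard (s := {u : Fin n | I.proj u (o u) = v}) (fun u hu => ?_)
      (Set.toFinite _)
    rw [Set.mem_ofPred_eq] at hu
    rw [Set.mem_ofPred_eq, ← hu]
    exact I.proj_mem_path _ _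
  let e := fun v => (this v).some
  have he : ∀ u u' : Fin n, I.proj u (o u) = I.proj u' (o u') →
      e (I.proj u (o u)) ⟨u, rfl⟩ = e (I.proj u' (o u')) ⟨u', rfl⟩ → u = u' := by
    intro u u' h h'
    -- The domain of `e v` depends on `v`, so both points are first moved to the same `v`.
    have key : ∀ v (hv : I.proj u (o u) = v) (hv' : I.proj u' (o u') = v),
        e v ⟨u, hv⟩ = e v ⟨u', hv'⟩ → u = u' := fun v hv hv' heq =>
      congrArg Subtype.val ((e v).injective heq)
    have aux : ∀ v (hv : I.proj u (o u) = v), e v ⟨u, hv⟩ = e (I.proj u (o u)) ⟨u, rfl⟩ := by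
      rintro _ rfl
      rfl
    exact key _ h rfl ((aux _ h).trans h')
  refine ⟨Finset.univ.image fun u => (u, (I.proj u (o u), e (I.proj u (o u)) ⟨u, rfl⟩)), ⟨?_, ?_⟩, ?_⟩
  · intro x hx
    obtain ⟨u, -, rfl⟩ := Finset.mem_image.1 hx
    exact I.mem_edges.2 ⟨_, rfl⟩
  · intro x hx y hy h
    obtain ⟨u, -, rfl⟩ := Finset.mem_image.1 hx
    obtain ⟨u', -, rfl⟩ := Finset.mem_image.1 hy
    have : u = u' := h.elim id fun h => he u u' (Prod.mk.inj h).1 (Prod.mk.inj h).2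
    rw [this]
  · rw [Finset.card_image_of_injective _ fun u u' h => (Prod.mk.inj h).1, Finset.card_fin]

theorem card_edges_le (j : ℕ) : (I.edges j).card ≤ 4 * j * n := by
  refine Finset.card_biUnion_le.trans ?_
  calc _ ≤ ∑ _u : Fin n, 4 * j := Finset.sum_le_sum fun u _ => ?_
    _ = 4 * j * n := by simp [mul_comm]
  refine Finset.card_image_le.trans ?_
  rw [Finset.card_product, Finset.card_fin]
  exact Nat.mul_le_mul_right _ Finset.card_le_four

/-- The left projection alone provides `j` edges per point. This absorbs the repeated list entries
that arise when projections of a point coincide. -/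
theorem mul_le_card_edges (j : ℕ) : n * j ≤ (I.edges j).card := by
  have : (Finset.univ : Finset (Fin n × Fin j)).card ≤ (I.edges j).card := by
    refine Finset.card_le_card_of_injOn (fun p => (p.1, (I.proj p.1 .left, p.2)))
      (fun p _ => I.mem_edges.2 ⟨_, rfl⟩) fun p _ p' _ h => ?_
    simp only [Prod.mk.injEq] at h
    exact Prod.ext h.1 h.2.2
  simpa using this

end SEP

/-! ### Numbering the boundary points -/

namespace Approx

open RAM

attribute [local simp] wp_assign wp_store wp_seq wp_ite Test.Holds Test.cost Expr.eval Expr.cost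
  State.setReg_reg State.setReg_arr State.setArr_reg State.setArr_arr

variable {n : ℕ} (I : SEP n)

/-- The set of all projections of points. -/
def boundary : Finset (ℤ × ℤ) := Finset.univ.biUnion I.projections

theorem mem_boundary {v : ℤ × ℤ} : v ∈ boundary I ↔ ∃ u d, I.proj u d = v := by
  simp [boundary, SEP.mem_projections]

/-- The table in which the number of a boundary point is stored. -/
def table (v : ℤ × ℤ) : ℕ :=
  if v.1 = I.x0 then aTabLeft else if v.1 = I.x1 then aTabRight
  else if v.2 = I.y0 then aTabDown else aTabUp

/-- The index of a boundary point in its table. -/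
def key (v : ℤ × ℤ) : ℤ :=
  if v.1 = I.x0 then v.2 else if v.1 = I.x1 then v.2 else v.1

theorem two_le_table (v : ℤ × ℤ) : 2 ≤ table I v := by
  unfold table; split_ifs <;> decide

theorem table_le_five (v : ℤ × ℤ) : table I v ≤ 5 := by
  unfold table; split_ifs <;> decide

/-- The table determines one coordinate and the key is the other. For the last table this needs
`boundary`: a boundary point on none of the first three sides has `v.2 = I.y1`. -/
theorem eq_of_table_eq {v w : ℤ × ℤ} (hv : v ∈ boundary I) (hw : w ∈ boundary I)
    (ht : table I v = table I w) (hk : key I v = key I w) : v = w := by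
  have h : ∀ v ∈ boundary I, v.1 = I.x0 ∨ v.1 = I.x1 ∨ v.2 = I.y0 ∨ v.2 = I.y1 := by
    intro v hv
    obtain ⟨u, d, rfl⟩ := (mem_boundary I).1 hv
    cases d <;> simp [SEP.proj]
  have h1 := h v hv
  have h2 := h w hw
  simp only [table, key] at ht hk
  apply Prod.ext <;> grind

/-- The number of a boundary point that is stored in the tables. -/
def stored (s : State) (v : ℤ × ℤ) : ℤ := s.arr (table I v) (key I v)

/-- Exactly the boundary points in `P` have been numbered. -/
structure Numbering (P : Finset (ℤ × ℤ)) (s : State) : Prop where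
  subset : P ⊆ boundary I
  count : s.reg rM = P.card
  pos : ∀ v ∈ P, 1 ≤ stored I s v
  le : ∀ v ∈ P, stored I s v ≤ P.card
  inj : ∀ v ∈ P, ∀ w ∈ P, stored I s v = stored I s w → v = w
  zero : ∀ v ∈ boundary I, v ∉ P → stored I s v = 0

/-- Numbers in use are at least 1, so a zero cell means that `v` is new, and `P.card + 1` is then
unused. Distinct boundary points have distinct cells, and `5 < dest` keeps the output away from the
tables. -/
theorem wp_lookup {s : State} {P : Finset (ℤ × ℤ)} (hs : Numbering I P s) {v : ℤ × ℤ}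
    (hv : v ∈ boundary I) {k dest : ℕ} (hk : s.reg k = key I v) (hkM : k ≠ rM)
    (hdest : 5 < dest) :
    WP (lookup (table I v) k dest) s fun t s' => Numbering I (insert v P) s' ∧
      (∀ w ∈ P, stored I s' w = stored I s w) ∧
      s'.arr dest = Function.update (s.arr dest) (s.reg rU) (stored I s' v - 1) ∧ t ≤ 30 := by
  have hd : ∀ w, table I w ≠ dest := fun w => by have := table_le_five I w; omega
  have hd' : ∀ w, dest ≠ table I w := fun w => (hd w).symm
  simp only [lookup, wp_seq, wp_ite, wp_assign, wp_store, Test.Holds, Expr.eval]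
  have hstored : s.arr (table I v) (s.reg k) = stored I s v := by rw [hk, stored]
  rw [hstored]
  refine ⟨fun h0 => ?_, fun h0 => ?_⟩
  · have hvP : v ∉ P := fun h => by have := hs.pos v h; omega
    generalize hs' : State.setArr _ _ _ _ = s'
    have e1 : ∀ w ∈ boundary I, stored I s' w = if w = v then (P.card : ℤ) + 1 else
        stored I s w := by
      intro w hw
      subst hs'
      simp only [stored, State.setArr_arr, State.setReg_arr, State.setReg_reg, if_neg (hd w), hk,
        hs.count, if_neg hkM]
      by_cases hwv : w = v
      · simp [hwv]
      · by_cases ht : table I w = table I v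
        · have : key I w ≠ key I v := fun h => hwv (eq_of_table_eq I hw hv ht h)
          simp [ht, hwv, this]
        · simp [ht, hwv]
    have e2 : s'.reg rM = P.card + 1 := by subst hs'; simp [hs.count]
    have e3 : s'.arr dest = Function.update (s.arr dest) (s.reg rU) (stored I s' v - 1) := by
      rw [e1 v hv]
      subst hs'
      simp [hd', hk, hkM, hs.count]
    have e4 : ∀ w ∈ P, w ≠ v := fun w hw h => hvP (h ▸ hw)
    have e5 : ∀ w ∈ P, stored I s' w = stored I s w := fun w hw => by
      rw [e1 w (hs.subset hw), if_neg (e4 w hw)]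
    have e6 : stored I s' v = P.card + 1 := by rw [e1 v hv, if_pos rfl]
    refine ⟨⟨?_, ?_, ?_, ?_, ?_, ?_⟩, e5, e3, by simp⟩
    · exact Finset.insert_subset hv hs.subset
    · rw [e2, Finset.card_insert_of_notMem hvP]; push_cast; rfl
    · intro w hw
      rcases Finset.mem_insert.1 hw with rfl | hw
      · omega
      · rw [e5 w hw]; exact hs.pos w hw
    · intro w hw
      rw [Finset.card_insert_of_notMem hvP]
      rcases Finset.mem_insert.1 hw with rfl | hw
      · omega
      · rw [e5 w hw]; have := hs.le w hw; omega
    · intro w hw x hx h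
      rcases Finset.mem_insert.1 hw with hw' | hw' <;> rcases Finset.mem_insert.1 hx with hx' | hx'
      · rw [hw', hx']
      · rw [hw', e6, e5 x hx'] at h; have := hs.le x hx'; omega
      · rw [hx', e6, e5 w hw'] at h; have := hs.le w hw'; omega
      · rw [e5 w hw', e5 x hx'] at h; exact hs.inj w hw' x hx' h
    · intro w hw hwP
      rw [Finset.mem_insert, not_or] at hwP
      rw [e1 w hw, if_neg hwP.1]
      exact hs.zero w hw hwP.2
  · have hvP : v ∈ P := by_contra fun h => h0 (hs.zero v hv h)
    generalize hs' : State.setArr _ _ _ _ = s'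
    have e1 : ∀ w, stored I s' w = stored I s w := by
      intro w
      subst hs'
      simp [stored, hd w]
    have e2 : s'.reg rM = P.card := by subst hs'; simp [hs.count]
    have e3 : s'.arr dest = Function.update (s.arr dest) (s.reg rU) (stored I s' v - 1) := by
      rw [e1 v]
      subst hs'
      simp [hk, hkM, stored]
    rw [Finset.insert_eq_self.2 hvP]
    refine ⟨⟨hs.subset, e2, ?_, ?_, ?_, ?_⟩, fun w _ => e1 w, e3, by simp⟩
    · simpa only [e1] using hs.pos
    · simpa only [e1] using hs.le
    · simpa only [e1] using hs.inj
    · simpa only [e1] using hs.zero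

/-- The array with the indices of the projections in a given direction. -/
def dirArr : Dir → ℕ
  | .left => aLeft
  | .right => aRight
  | .down => aDown
  | .up => aUp

/-- The state contains the input. -/
structure HoldsInput (s : State) : Prop where
  reg_n : s.reg rN = n
  reg_x0 : s.reg rX0 = I.x0
  reg_x1 : s.reg rX1 = I.x1
  reg_y0 : s.reg rY0 = I.y0
  reg_y1 : s.reg rY1 = I.y1
  arr_x : ∀ u : Fin n, s.arr aX (u : ℕ) = (I.pt u).1
  arr_y : ∀ u : Fin n, s.arr aY (u : ℕ) = (I.pt u).2

/-- The second expression is evaluated after `rA` has been written, hence the form of `hb`. -/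
theorem wp_number {s : State} {P : Finset (ℤ × ℤ)} (hs : Numbering I P s) (hI : HoldsInput I s)
    {v : ℤ × ℤ} (hv : v ∈ boundary I) {a b : Expr} {dest : ℕ} (ha : a.eval s = v.1)
    (hb : b.eval (s.setReg rA v.1) = v.2) (hdest : 5 < dest) (hab : a.cost + b.cost ≤ 3) :
    WP (number a b dest) s fun t s' => Numbering I (insert v P) s' ∧
      (∀ w ∈ P, stored I s' w = stored I s w) ∧
      s'.arr dest = Function.update (s.arr dest) (s.reg rU) (stored I s' v - 1) ∧ t ≤ 60 := by
  simp only [number, wp_seq, wp_assign, ha, hb]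
  set s₁ := (s.setReg rA v.1).setReg rB v.2 with hs₁
  have h1 : s₁.reg rA = v.1 := by simp [hs₁]
  have h2 : s₁.reg rB = v.2 := by simp [hs₁]
  have h3 : s₁.reg rX0 = I.x0 := by simp [hs₁, hI.reg_x0]
  have h4 : s₁.reg rX1 = I.x1 := by simp [hs₁, hI.reg_x1]
  have h5 : s₁.reg rY0 = I.y0 := by simp [hs₁, hI.reg_y0]
  have h6 : s₁.reg rU = s.reg rU := by simp [hs₁]
  have h7 : Numbering I P s₁ := ⟨hs.subset, by simpa [hs₁] using hs.count, hs.pos, hs.le, hs.inj,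
    hs.zero⟩
  simp only [wp_ite, Test.Holds, Expr.eval, h1, h2, h3, h4, h5]
  refine ⟨fun c1 => ?_, fun c1 => ⟨fun c2 => ?_, fun c2 => ⟨fun c3 => ?_, fun c3 => ?_⟩⟩⟩
  · have ht : table I v = aTabLeft := by simp [table, c1]
    rw [← ht]
    refine (wp_lookup I h7 hv (h2.trans (by simp [key, c1])) (by decide) hdest).mono ?_
    rintro t s' ⟨k1, k2, k3, k4⟩
    exact ⟨k1, k2, h6 ▸ k3, by simp; omega⟩
  · have ht : table I v = aTabRight := by simp only [table, if_neg c1, if_pos c2]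
    rw [← ht]
    refine (wp_lookup I h7 hv (h2.trans (by simp [key, c2])) (by decide) hdest).mono ?_
    rintro t s' ⟨k1, k2, k3, k4⟩
    exact ⟨k1, k2, h6 ▸ k3, by simp; omega⟩
  · have ht : table I v = aTabDown := by simp only [table, if_neg c1, if_neg c2, if_pos c3]
    rw [← ht]
    refine (wp_lookup I h7 hv (h1.trans (by simp [key, c1, c2])) (by decide) hdest).mono ?_
    rintro t s' ⟨k1, k2, k3, k4⟩
    exact ⟨k1, k2, h6 ▸ k3, by simp; omega⟩
  · have ht : table I v = aTabUp := by simp only [table, if_neg c1, if_neg c2, if_neg c3]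
    rw [← ht]
    refine (wp_lookup I h7 hv (h1.trans (by simp [key, c1, c2])) (by decide) hdest).mono ?_
    rintro t s' ⟨k1, k2, k3, k4⟩
    exact ⟨k1, k2, h6 ▸ k3, by simp; omega⟩

/-- The indices of the projections in `R` have been computed. -/
def Numbered (R : Set (Fin n × Dir)) (s : State) : Prop :=
  HoldsInput I s ∧ ∃ P, Numbering I P s ∧ ∀ u d, (u, d) ∈ R → I.proj u d ∈ P ∧
    s.arr (dirArr d) (u : ℕ) = stored I s (I.proj u d) - 1

theorem dirArr_injective : dirArr.Injective := by
  intro d d' h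
  cases d <;> cases d' <;> simp_all [dirArr]

theorem wp_number_dir {s : State} {R : Set (Fin n × Dir)} (hs : Numbered I R s) (u : Fin n)
    (d : Dir) (hu : s.reg rU = (u : ℕ)) {a b : Expr} (ha : a.eval s = (I.proj u d).1)
    (hb : b.eval (s.setReg rA (I.proj u d).1) = (I.proj u d).2) (hab : a.cost + b.cost ≤ 3) :
    WP (number a b (dirArr d)) s fun t s' => Numbered I (insert (u, d) R) s' ∧
      s'.reg rU = (u : ℕ) ∧ t ≤ 60 := by
  obtain ⟨hI, P, hP, hR⟩ := hs
  have hd : 5 < dirArr d := by cases d <;> decide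
  have hv : I.proj u d ∈ boundary I := (mem_boundary I).2 ⟨u, d, rfl⟩
  have hregs : ∀ x ∈ (number a b (dirArr d)).regs, x = rM ∨ x = rA ∨ x = rB := by
    intro x hx
    simp [number, lookup, Prog.regs] at hx
    tauto
  have harrs : ∀ x ∈ (number a b (dirArr d)).arrs, (2 ≤ x ∧ x ≤ 5) ∨ x = dirArr d := by
    intro x hx
    simp [number, lookup, Prog.arrs, aTabLeft, aTabRight, aTabDown, aTabUp] at hx
    omega
  refine (wp_number I hP hI hv ha hb hd hab).mono_frame ?_
  rintro t s' hr harr ⟨k1, k2, k3, k4⟩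
  have e : ∀ x, x ≠ rM → x ≠ rA → x ≠ rB → s'.reg x = s.reg x := fun x h1 h2 h3 =>
    hr x fun h => by have := hregs x h; tauto
  have e' : ∀ x, (x < 2 ∨ 5 < x) → x ≠ dirArr d → s'.arr x = s.arr x := fun x h1 h2 =>
    harr x fun h => by have := harrs x h; omega
  refine ⟨⟨⟨?_, ?_, ?_, ?_, ?_, ?_, ?_⟩, insert (I.proj u d) P, k1, ?_⟩, ?_, k4⟩
  · rw [e _ (by decide) (by decide) (by decide), hI.reg_n]
  · rw [e _ (by decide) (by decide) (by decide), hI.reg_x0]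
  · rw [e _ (by decide) (by decide) (by decide), hI.reg_x1]
  · rw [e _ (by decide) (by decide) (by decide), hI.reg_y0]
  · rw [e _ (by decide) (by decide) (by decide), hI.reg_y1]
  · rw [e' _ (Or.inl (by decide)) (ne_of_lt (lt_trans (by decide) hd))]; exact hI.arr_x
  · rw [e' _ (Or.inl (by decide)) (ne_of_lt (lt_trans (by decide) hd))]; exact hI.arr_y
  · intro u' d' h
    by_cases hne : d' = d ∧ u' = u
    · obtain ⟨rfl, rfl⟩ := hne
      refine ⟨Finset.mem_insert_self _ _, ?_⟩
      rw [k3, hu, Function.update_self]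
    · have hmem : (u', d') ∈ R := by
        rcases h with h | h
        · rw [Prod.mk.injEq] at h; tauto
        · exact h
      obtain ⟨h1, h2⟩ := hR u' d' hmem
      refine ⟨Finset.mem_insert_of_mem h1, ?_⟩
      rw [k2 _ h1, ← h2]
      by_cases hdd : d' = d
      · subst hdd
        rw [k3, hu, Function.update_of_ne]
        exact fun h => hne ⟨rfl, Fin.ext (by exact_mod_cast h)⟩
      · rw [e' _ (Or.inr (by cases d' <;> decide)) fun h => hdd (dirArr_injective h)]
  · rw [e _ (by decide) (by decide) (by decide), hu]

/-- The boundary points are numbered by `num`, and the memory contains the numbers of the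
projections of all points. -/
structure Ready (num : ℤ × ℤ → ℕ) (m : ℕ) (s : State) : Prop where
  reg_n : s.reg rN = n
  reg_m : s.reg rM = m
  arr_dir : ∀ (u : Fin n) d, s.arr (dirArr d) ((u : ℕ) : ℤ) = num (I.proj u d)
  bijOn : Set.BijOn num (boundary I) (Set.Iio m)

theorem wp_prologue : WP prologue (init I) fun t s => (t : ℤ) ≤ 300 * n + 40 ∧
    s.reg rK = 0 ∧ s.reg rSize = -1 ∧ ∃ num m, Ready I num m s := by
  simp only [prologue, setup, wp_seq, wp_assign]
  refine (wp_forRange n (fun i s => Numbered I {p | (p.1 : ℕ) < i} s)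
    (fun _ => 0) 240 ?_ (by decide) (by simp [init]) ?_).mono ?_
  · rintro i s hi h hx hy
    refine (wp_seq.2 <| (wp_number_dir I h ⟨i, hi⟩ .left hx (by simp [SEP.proj, h.1.reg_x0])
      (by simpa [SEP.proj, hx] using h.1.arr_y ⟨i, hi⟩) (by simp)).mono ?_)
    rintro t₁ s₁ ⟨h₁, hx₁, ht₁⟩
    refine (wp_seq.2 <| (wp_number_dir I h₁ ⟨i, hi⟩ .right hx₁ (by simp [SEP.proj, h₁.1.reg_x1])
      (by simpa [SEP.proj, hx₁] using h₁.1.arr_y ⟨i, hi⟩) (by simp)).mono ?_)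
    rintro t₂ s₂ ⟨h₂, hx₂, ht₂⟩
    refine (wp_seq.2 <| (wp_number_dir I h₂ ⟨i, hi⟩ .down hx₂
      (by simpa [SEP.proj, hx₂] using h₂.1.arr_x ⟨i, hi⟩) (by simp [SEP.proj, h₂.1.reg_y0])
      (by simp)).mono ?_)
    rintro t₃ s₃ ⟨h₃, hx₃, ht₃⟩
    refine (wp_number_dir I h₃ ⟨i, hi⟩ .up hx₃
      (by simpa [SEP.proj, hx₃] using h₃.1.arr_x ⟨i, hi⟩) (by simp [SEP.proj, h₃.1.reg_y1])
      (by simp)).mono ?_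
    rintro t₄ s₄ ⟨⟨hI, P, hP, hR⟩, hx₄, ht₄⟩
    refine ⟨hx₄, hI.reg_n, ⟨⟨?_, ?_, ?_, ?_, ?_, hI.arr_x, hI.arr_y⟩, P, ⟨hP.subset, ?_, hP.pos, hP.le, hP.inj,
      hP.zero⟩, fun u d hu => ?_⟩, by push_cast; omega⟩
    · simpa using hI.reg_n
    · simpa using hI.reg_x0
    · simpa using hI.reg_x1
    · simpa using hI.reg_y0
    · simpa using hI.reg_y1
    · simpa using hP.count
    · refine hR u d ?_
      simp only [Set.mem_ofPred_eq] at hu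
      rcases Nat.lt_succ_iff_lt_or_eq.1 hu with hu | hu
      · simp [hu]
      · obtain rfl : u = ⟨i, hi⟩ := Fin.ext hu
        cases d <;> simp
  · refine ⟨⟨?_, ?_, ?_, ?_, ?_, ?_, ?_⟩, ∅, ⟨?_, ?_, ?_, ?_, ?_, ?_⟩, ?_⟩
    -- Only the arrays `0` and `1` contain input; the tables start with zeros, so nothing is
    -- numbered.
    case refine_13 =>
      intro v _ _
      have := two_le_table I v
      simp [stored, init, show table I v ≠ 0 by omega, show table I v ≠ 1 by omega]
    all_goals simp [init]
  · rintro t s ⟨⟨hI, P, hP, hR⟩, -, -, ht⟩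
    obtain rfl : P = boundary I := by
      refine hP.subset.antisymm fun v hv => ?_
      obtain ⟨u, d, rfl⟩ := (mem_boundary I).1 hv
      exact (hR u d u.2).1
    -- Stored numbers start at 1, because 0 means absent; `num` starts at 0.
    refine ⟨by simp at ht ⊢; omega, by simp, by simp, fun v => (stored I s v - 1).toNat,
      (boundary I).card, ⟨by simpa using hI.reg_n, by simpa using hP.count, fun u d => ?_, ?_, ?_, ?_⟩⟩
    · obtain ⟨h1, h2⟩ := hR u d u.2
      have := hP.pos _ h1
      simp [h2]
      omega
    · intro v hv
      have h1 := hP.pos v hv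
      have h2 := hP.le v hv
      simp only [Set.mem_Iio]
      omega
    · intro v hv w hw h
      have h1 := hP.pos v hv
      have h2 := hP.pos w hw
      dsimp only at h
      exact hP.inj v hv w hw (by omega)
    · intro i hi
      -- Surjectivity by counting: an injective map into a range of the same cardinality.
      have h : (boundary I).image (fun v => (stored I s v - 1).toNat) =
          Finset.range (boundary I).card := by
        refine Finset.eq_of_subset_of_card_le (fun i hi => ?_) ?_
        · obtain ⟨v, hv, rfl⟩ := Finset.mem_image.1 hi
          have h1 := hP.pos v hv
          have h2 := hP.le v hv
          rw [Finset.mem_range]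
          omega
        · rw [Finset.card_range, Finset.card_image_of_injOn]
          intro v hv w hw h
          have h1 := hP.pos v hv
          have h2 := hP.pos w hw
          dsimp only at h
          exact hP.inj v hv w hw (by omega)
      have := h ▸ Finset.mem_range.2 hi
      simpa using this

end Approx

/-! ### The instance graph in memory and the output -/

namespace Approx

open RAM

attribute [local simp] wp_assign wp_store wp_seq wp_ite Test.Holds Test.cost Expr.eval Expr.cost
  State.setReg_reg State.setReg_arr State.setArr_reg State.setArr_arr

variable {n : ℕ} {I : SEP n} {num : ℤ × ℤ → ℕ} {m j : ℕ}

/-- The number of a vertex of the second side. -/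
def vertex (num : ℤ × ℤ → ℕ) (m : ℕ) {j : ℕ} (p : (ℤ × ℤ) × Fin j) : ℕ := num p.1 + p.2 * m

/-- The instance graph with numbered vertices. -/
def numberedEdges (I : SEP n) (num : ℤ × ℤ → ℕ) (m j : ℕ) : Finset (ℕ × ℕ) :=
  (I.edges j).image fun e => ((e.1 : ℕ), vertex num m e.2)

theorem Ready.of_eq {s s' : State} (h : Ready I num m s) (hn : s'.reg rN = s.reg rN)
    (hm : s'.reg rM = s.reg rM) (hd : ∀ d, s'.arr (dirArr d) = s.arr (dirArr d)) :
    Ready I num m s' :=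
  ⟨hn.trans h.reg_n, hm.trans h.reg_m, fun u d => by rw [hd]; exact h.arr_dir u d, h.bijOn⟩

theorem dirCode_bounds (d : Dir) : 0 ≤ dirCode d ∧ dirCode d < 4 := by
  cases d <;> simp [dirCode]

theorem exists_dirCode {c : ℤ} (h0 : 0 ≤ c) (h4 : c < 4) : ∃ d, dirCode d = c := by
  obtain rfl | rfl | rfl | rfl : c = 0 ∨ c = 1 ∨ c = 2 ∨ c = 3 := by omega
  exacts [⟨.left, rfl⟩, ⟨.right, rfl⟩, ⟨.down, rfl⟩, ⟨.up, rfl⟩]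

/-- The adjacency lists of the instance graph have been written up to the `q`-th block of four
entries. -/
def Listed (I : SEP n) (num : ℤ × ℤ → ℕ) (m j q : ℕ) (adj : ℤ → ℤ) : Prop :=
  ∀ (u : Fin n) (i : ℕ), i < j → j * u + i < q → ∀ d,
    adj (4 * (j * (u : ℕ) + i : ℕ) + dirCode d) = num (I.proj u d) + i * m

theorem eq_of_block_eq {u u' i i' : ℕ} (hi : i < j) (hi' : i' < j)
    (h : j * u + i = j * u' + i') : u = u' ∧ i = i' := by
  have h1 : (j * u + i) / j = u := by
    rw [Nat.mul_add_div (by omega), Nat.div_eq_of_lt hi, add_zero]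
  have h2 : (j * u' + i') / j = u' := by
    rw [Nat.mul_add_div (by omega), Nat.div_eq_of_lt hi', add_zero]
  have : u = u' := by rw [← h1, h, h2]
  subst this
  exact ⟨rfl, by omega⟩

theorem Listed.succ {adj adj' : ℤ → ℤ} {u : Fin n} {i : ℕ} (hi : i < j)
    (h : Listed I num m j (j * u + i) adj)
    (hold : ∀ p : ℤ, p < 4 * (j * (u : ℕ) + i : ℕ) → adj' p = adj p)
    (hnew : ∀ d, adj' (4 * (j * (u : ℕ) + i : ℕ) + dirCode d) = num (I.proj u d) + i * m) :
    Listed I num m j (j * u + i + 1) adj' := by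
  intro u' i' hi' hq d
  rcases Nat.lt_succ_iff_lt_or_eq.1 hq with hq | hq
  · rw [hold _ (by have := dirCode_bounds d; omega)]
    exact h u' i' hi' hq d
  · obtain ⟨h1, rfl⟩ := eq_of_block_eq hi' hi hq
    obtain rfl := Fin.ext h1
    exact hnew d

/-- Each point has exactly `4j` entries, which fixes all offsets. Coinciding projections yield
repeated entries, which `HoldsGraph` allows. -/
theorem wp_buildGraph {s : State} (h : Ready I num m s) (hK : s.reg rK = j) :
    WP buildGraph s fun t s' => s'.reg rL = n ∧ s'.reg rR = (j * m : ℕ) ∧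
      (∀ u : ℕ, u ≤ n → s'.arr aOff u = 4 * (j * u : ℕ)) ∧ Listed I num m j (j * n) (s'.arr aAdj) ∧
      (t : ℤ) ≤ 100 * (n * j + n + j + 1) := by
  simp only [buildGraph, wp_seq, wp_assign]
  refine (wp_forRange j (fun i s => Ready I num m s ∧ s.reg rL = n ∧ s.reg rR = (i * m : ℕ))
    (fun _ => 0) 4 ?_ (by decide) (by simp [hK]) ?_).mono_frame ?_
  · rintro i s hi ⟨h1, h2, h3⟩ hx hy
    have hy' : s.reg rK = j := hy
    simp [hx, hy', h2, h3, h1.reg_m]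
    exact ⟨h1.of_eq (by simp) (by simp) fun d => by simp, by ring⟩
  · simp [h.reg_n]
    exact h.of_eq (by simp) (by simp) fun d => by simp
  rintro t₁ s₁ hr₁ - ⟨⟨h1, h2, h3⟩, -, hK₁, ht₁⟩
  refine (wp_forRange n (fun u s => Ready I num m s ∧ s.reg rK = j ∧ s.reg rL = n ∧
      s.reg rR = (j * m : ℕ) ∧ s.reg rP = 4 * (j * u : ℕ) ∧
      (∀ u' : ℕ, u' < u → s.arr aOff u' = 4 * (j * u' : ℕ)) ∧
      Listed I num m j (j * u) (s.arr aAdj))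
    (fun _ => 0) (j * 60 + 20) ?_ (by decide) (by simp [h1.reg_n]) ?_).mono ?_
  · rintro u s hu ⟨k1, k2, k3, k4, k5, k6, k7⟩ hx hy
    simp only [wp_assign, wp_store, wp_seq]
    refine (wp_forRange j (fun i s => Ready I num m s ∧ s.reg rK = j ∧ s.reg rL = n ∧
      s.reg rR = (j * m : ℕ) ∧ s.reg rU = u ∧ s.reg rBase = (i * m : ℕ) ∧
      s.reg rP = 4 * (j * u + i : ℕ) ∧
      (∀ u' : ℕ, u' < u + 1 → s.arr aOff u' = 4 * (j * u' : ℕ)) ∧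
      Listed I num m j (j * u + i) (s.arr aAdj))
      (fun _ => 0) 52 ?_ (by decide) (by simp [k2]) ?_).mono ?_
    · rintro i s hi ⟨l1, l2, l3, l4, l5, l6, l7, l8, l9⟩ hx hy
      have d1 := l1.arr_dir ⟨u, hu⟩ .left
      have d2 := l1.arr_dir ⟨u, hu⟩ .right
      have d3 := l1.arr_dir ⟨u, hu⟩ .down
      have d4 := l1.arr_dir ⟨u, hu⟩ .up
      simp only [dirArr] at d1 d2 d3 d4
      simp [addEdge, hx, l1.reg_m, l2, l3, l4, l5, l6, l7, d1, d2, d3, d4]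
      refine ⟨l1.of_eq (by simp) (by simp) fun d => by cases d <;> simp [dirArr], by ring,
        by ring, ?_, ?_⟩
      · intro u' hu'
        have := l8 u' (by omega)
        simpa using this
      · refine Listed.succ (u := ⟨u, hu⟩) hi l9 (fun p hp => ?_) fun d => ?_
        · push_cast at hp
          simp only [Function.update_apply]
          grind
        · cases d <;> simp [dirCode, Function.update_apply] <;> grind
    · simp [k2, k3, k4, k5, hx]
      refine ⟨k1.of_eq (by simp) (by simp) fun d => by cases d <;> simp [dirArr], ?_, k7⟩
      intro u' hu'
      rcases hu'.lt_or_eq with hu' | rfl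
      · have := k6 u' hu'
        rw [Function.update_of_ne (by omega), this]
        push_cast; rfl
      · rw [Function.update_self]
    · rintro t' s' ⟨⟨l1, l2, l3, l4, l5, l6, l7, l8, l9⟩, -, -, ht'⟩
      simp at ht'
      simp [l1.reg_n, l2, l3, l4, l5, l7]
      refine ⟨⟨l1.of_eq (by simp) (by simp) fun d => by simp, by ring, ?_, ?_⟩, ?_⟩
      · intro u' hu'
        have := l8 u' (by omega)
        simpa using this
      · rwa [mul_add, mul_one]
      · linarith
  · simp [h2, h3, hK₁]
    refine ⟨h1.of_eq (by simp) (by simp) fun d => by simp, fun u i _ hlt => by omega⟩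
  · rintro t' s' ⟨⟨k1, k2, k3, k4, k5, k6, k7⟩, -, -, ht'⟩
    simp [k1.reg_n, k3, k4, k5]
    simp at ht₁ ht'
    refine ⟨fun u hu => ?_, k7, ?_⟩
    · rcases hu.lt_or_eq with hu | rfl
      · have := k6 u hu
        rw [Function.update_of_ne (by omega), this]
        push_cast; rfl
      · rw [Function.update_self]
    · nlinarith

/-- Division with remainder by `m`: the quotient is the copy, the remainder the number of the
boundary point. -/
theorem vertex_bijOn {s : State} (h : Ready I num m s) (j : ℕ) :
    Set.BijOn (vertex num m) (I.copies j : Set ((ℤ × ℤ) × Fin j)) (Set.Iio (j * m)) := by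
  have hmem : ∀ p : (ℤ × ℤ) × Fin j, p ∈ (I.copies j : Set ((ℤ × ℤ) × Fin j)) ↔
      p.1 ∈ boundary I := fun p => by
    rw [Finset.mem_coe, mem_boundary, ← SEP.mem_copies I (i := p.2)]
  refine ⟨fun p hp => ?_, fun p hp p' hp' heq => ?_, fun v hv => ?_⟩
  · rw [hmem] at hp
    have h1 : num p.1 < m := h.bijOn.mapsTo hp
    have h2 : (p.2 + 1) * m ≤ j * m := Nat.mul_le_mul_right m p.2.2
    simp only [vertex, Set.mem_Iio]
    linarith
  · rw [hmem] at hp hp'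
    have h1 : num p.1 < m := h.bijOn.mapsTo hp
    have h2 : num p'.1 < m := h.bijOn.mapsTo hp'
    have h3 : (p.2 : ℕ) = p'.2 ∧ num p.1 = num p'.1 :=
      eq_of_block_eq h1 h2 (by simp only [vertex] at heq; linarith)
    exact Prod.ext (h.bijOn.injOn hp hp' h3.2) (Fin.ext h3.1)
  · rw [Set.mem_Iio] at hv
    have hm : 0 < m := Nat.pos_of_mul_pos_left (by omega : 0 < j * m)
    obtain ⟨w, hw, hw'⟩ := h.bijOn.surjOn (show v % m ∈ Set.Iio m from Nat.mod_lt v hm)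
    refine ⟨(w, ⟨v / m, Nat.div_lt_of_lt_mul (by rwa [mul_comm])⟩), (hmem _).2 hw, ?_⟩
    simp only [vertex, hw']
    exact Nat.mod_add_div' v m

theorem exists_block {u : ℕ} {p : ℤ} (h : 4 * ((j * u : ℕ) : ℤ) ≤ p)
    (h' : p < 4 * (j * (u + 1) : ℕ)) :
    ∃ i < j, ∃ d, p = 4 * (j * u + i : ℕ) + dirCode d := by
  obtain ⟨d, hd⟩ := exists_dirCode (c := p % 4) (by omega) (by omega)
  rw [mul_add, mul_one] at h'
  refine ⟨(p / 4 - (j * u : ℕ)).toNat, ?_, d, ?_⟩ <;> push_cast at * <;> omega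

theorem holdsGraph {s : State} (h : Ready I num m s) (hL : s.reg rL = n)
    (hR : s.reg rR = (j * m : ℕ)) (hoff : ∀ u : ℕ, u ≤ n → s.arr aOff u = 4 * (j * u : ℕ))
    (hadj : Listed I num m j (j * n) (s.arr aAdj)) :
    HoldsGraph s n (j * m) (numberedEdges I num m j) := by
  have hlist : ∀ (u : Fin n) (i : ℕ), i < j → ∀ d,
      s.arr aAdj (4 * (j * (u : ℕ) + i : ℕ) + dirCode d) = num (I.proj u d) + i * m := by
    intro u i hi d
    have : j * (u + 1) ≤ j * n := Nat.mul_le_mul_left j u.2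
    exact hadj u i hi (by rw [mul_add, mul_one] at this; omega) d
  have hmem : ∀ (u : Fin n) (d : Dir) (i : ℕ) (hi : i < j),
      num (I.proj u d) + i * m < j * m := fun u d i hi =>
    (vertex_bijOn h j).mapsTo (x := (I.proj u d, ⟨i, hi⟩))
      ((SEP.mem_copies I).2 ⟨u, d, rfl⟩)
  refine ⟨hL, hR, ?_, fun u hu => ?_, fun p hp0 hp => ?_, fun u v => ⟨fun huv => ?_, ?_⟩⟩
  · simpa using hoff 0 (Nat.zero_le n)
  · have := hoff (u + 1) hu
    rw [hoff u hu.le]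
    push_cast at this ⊢
    rw [this]
    nlinarith
  · rw [hoff n le_rfl] at hp
    have hj : 0 < j := Nat.pos_of_ne_zero fun h0 => by subst h0; simp at hp; omega
    -- Position `p` lies in block `p / 4`, and the `j` blocks of each point are consecutive.
    have h1 : (p / 4).toNat / j < n :=
      Nat.div_lt_of_lt_mul (by omega)
    have h2 := Nat.div_add_mod (p / 4).toNat j
    have h3 := Nat.mod_lt (p / 4).toNat hj
    obtain ⟨i, hi, d, hpd⟩ := exists_block (j := j) (u := (p / 4).toNat / j) (p := p)
      (by omega) (by rw [mul_add, mul_one]; omega)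
    have := hlist ⟨_, h1⟩ i hi d
    dsimp only at this
    rw [hpd, this]
    have := hmem ⟨_, h1⟩ d i hi
    constructor
    · positivity
    · exact_mod_cast this
  · obtain ⟨⟨u, w, i⟩, he, heq⟩ := Finset.mem_image.1 huv
    obtain ⟨d, rfl⟩ := I.mem_edges.1 he
    obtain ⟨rfl, rfl⟩ := Prod.mk.inj heq
    have h1 := hoff (u + 1) u.2
    have h2 := dirCode_bounds d
    have h3 := i.2
    rw [mul_add, mul_one] at h1
    refine ⟨u.2, 4 * (j * (u : ℕ) + i : ℕ) + dirCode d, ?_, ?_, ?_⟩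
    · dsimp only
      rw [hoff u u.2.le]
      omega
    · push_cast at h1 ⊢
      omega
    · rw [hlist u i i.2 d]
      simp [vertex]
  · rintro ⟨hu, p, hp, hp', hv⟩
    have h1 := hoff (u + 1) hu
    push_cast at h1
    rw [h1] at hp'
    rw [hoff u hu.le] at hp
    obtain ⟨i, hi, d, rfl⟩ := exists_block hp (by push_cast; exact hp')
    have h2 := hlist ⟨u, hu⟩ i hi d
    dsimp only at h2
    rw [hv] at h2
    refine Finset.mem_image.2 ⟨(⟨u, hu⟩, (I.proj ⟨u, hu⟩ d, ⟨i, hi⟩)), I.mem_edges.2 ⟨d, rfl⟩, ?_⟩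
    simp only [vertex, Prod.mk.injEq, true_and]
    exact_mod_cast h2.symm

/-- Subtracting `m` until the value is below `m` forgets the copy. If several directions share the
projection, the first one tested is returned, so `d'` may differ from `d`. -/
theorem wp_extract {s : State} (h : Ready I num m s)
    (hmate : ∀ u : Fin n, ∃ d, ∃ i < j,
      s.arr aMate ((u : ℕ) : ℤ) = num (I.proj u d) + (i * m : ℕ)) (hn : 1 ≤ n) :
    WP extract s fun t s' => (∀ u : Fin n, ∃ d d', ∃ i < j, I.proj u d = I.proj u d' ∧
      s.arr aMate ((u : ℕ) : ℤ) = num (I.proj u d) + (i * m : ℕ) ∧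
      s'.arr aOut ((u : ℕ) : ℤ) = dirCode d') ∧ (t : ℤ) ≤ 100 * (n * j + n + 1) := by
  have hm : 0 < m := (Nat.zero_le _).trans_lt
    (h.bijOn.mapsTo ((mem_boundary I).2 ⟨⟨0, hn⟩, .left, rfl⟩))
  generalize hM : s.arr aMate = mate at hmate ⊢
  refine (wp_forRange n (fun k s => Ready I num m s ∧ s.arr aMate = mate ∧
      ∀ u : Fin n, (u : ℕ) < k → ∃ d d', ∃ i < j, I.proj u d = I.proj u d' ∧
        mate ((u : ℕ) : ℤ) = num (I.proj u d) + (i * m : ℕ) ∧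
        s.arr aOut ((u : ℕ) : ℤ) = dirCode d')
    (fun _ => 0) (20 * j + 60) ?_ (by decide) h.reg_n ?_).mono ?_
  · rintro k s hk ⟨h1, h2, h3⟩ hx hy
    obtain ⟨d, i, hi, hki⟩ := hmate ⟨k, hk⟩
    dsimp only at hki
    have hlt : num (I.proj ⟨k, hk⟩ d) < m := h.bijOn.mapsTo ((mem_boundary I).2 ⟨_, _, rfl⟩)
    simp only [wp_seq, wp_assign]
    refine (wp_while (fun s' => s'.reg rM = m ∧
        ∃ i' : ℕ, s'.reg rW = num (I.proj ⟨k, hk⟩ d) + (i' * m : ℕ))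
      -- The quotient by `m` is the number of subtractions still to come.
      (fun s' => 20 * (s'.reg rW / m)) ?_ ?_ ?_).mono_frame ?_
    · rintro s' ⟨-, i', hi'⟩
      rw [hi']
      positivity
    · rintro s' ⟨e, i', hi'⟩ hb
      simp only [Test.Holds, Expr.eval, e, not_lt] at hb
      simp [e]
      refine ⟨?_, ?_⟩
      · obtain ⟨i'', rfl⟩ : ∃ i'', i' = i'' + 1 := by
          refine Nat.exists_eq_succ_of_ne_zero fun h0 => ?_
          subst h0
          simp at hi'
          omega
        refine ⟨i'', ?_⟩
        rw [hi']
        push_cast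
        ring
      · have : (s'.reg rW - m) / (m : ℤ) = s'.reg rW / m - 1 := by
          rw [sub_eq_add_neg, ← neg_one_mul, Int.add_mul_ediv_right _ _ (by omega)]
          ring
        rw [this]
        omega
    · exact ⟨by simp [h1.reg_m], i, by simp [hx, h2, hki]⟩
    · rintro t s' hr harr ⟨⟨e1, i', hi'⟩, hb, ht⟩
      simp only [Test.Holds, Expr.eval, e1, not_not] at hb
      have hi0 : i' = 0 := by
        by_contra h0
        have : 1 * m ≤ i' * m := Nat.mul_le_mul_right m (Nat.one_le_iff_ne_zero.2 h0)
        omega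
      subst hi0
      have e2 : s'.reg rU = k := (hr _ (by decide)).trans (by simp [hx])
      have e3 : s'.reg rN = n := (hr _ (by decide)).trans (by simp [h1.reg_n])
      have e4 : s'.arr aMate = mate := (harr _ (by decide)).trans (by simp [h2])
      have e5 : s'.arr aOut = s.arr aOut := (harr _ (by decide)).trans (by simp)
      have e6 : Ready I num m s' := h1.of_eq ((hr _ (by decide)).trans (by simp))
        ((hr _ (by decide)).trans (by simp)) fun d => (harr _ (by cases d <;> decide))
      have hdiv : (mate k) / (m : ℤ) = i := by
        rw [hki]
        push_cast
        rw [Int.add_mul_ediv_right _ _ (by omega), Int.ediv_eq_zero_of_lt (by omega) (by omega),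
          zero_add]
      have hphi : 0 ≤ s'.reg rW / (m : ℤ) := by rw [hi']; positivity
      simp [hx, h2, hdiv] at ht
      have hW : s'.reg rW = num (I.proj ⟨k, hk⟩ d) := by rw [hi']; simp
      have hproj : ∀ d', s'.reg rW = s'.arr (dirArr d') k ↔ I.proj ⟨k, hk⟩ d = I.proj ⟨k, hk⟩ d' := by
        intro d'
        have := e6.arr_dir ⟨k, hk⟩ d'
        dsimp only at this
        rw [hW, this, Nat.cast_inj]
        exact ⟨fun h' => h.bijOn.injOn ((mem_boundary I).2 ⟨_, _, rfl⟩)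
          ((mem_boundary I).2 ⟨_, _, rfl⟩) h', fun h' => by rw [h']⟩
      have p1 := hproj .left
      have p2 := hproj .right
      have p3 := hproj .down
      simp only [dirArr] at p1 p2 p3
      have hout : ∀ d', I.proj ⟨k, hk⟩ d = I.proj ⟨k, hk⟩ d' → ∀ u : Fin n, (u : ℕ) < k + 1 →
          ∃ d₁ d₂, ∃ i < j, I.proj u d₁ = I.proj u d₂ ∧
          mate ((u : ℕ) : ℤ) = num (I.proj u d₁) + (i * m : ℕ) ∧
          Function.update (s.arr aOut) (k : ℤ) (dirCode d') ((u : ℕ) : ℤ) = dirCode d₂ := by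
        intro d' hd' u hu
        rcases Nat.lt_succ_iff_lt_or_eq.1 hu with hu | hu
        · obtain ⟨d₁, d₂, i', hi', h4, h5, h6⟩ := h3 u hu
          exact ⟨d₁, d₂, i', hi', h4, h5, by rw [Function.update_of_ne (by omega), h6]⟩
        · obtain rfl : u = ⟨k, hk⟩ := Fin.ext hu
          exact ⟨d, d', i, hi, hd', hki, Function.update_self ..⟩
      have hup : I.proj ⟨k, hk⟩ d ≠ I.proj ⟨k, hk⟩ .left → I.proj ⟨k, hk⟩ d ≠ I.proj ⟨k, hk⟩ .right →
          I.proj ⟨k, hk⟩ d ≠ I.proj ⟨k, hk⟩ .down → d = .up := by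
        cases d <;> simp
      have hfin : ∀ c, (∃ d', I.proj ⟨k, hk⟩ d = I.proj ⟨k, hk⟩ d' ∧ c = dirCode d') →
          Ready I num m ((s'.setArr aOut k c).setReg rU (k + 1)) ∧
          ∀ u : Fin n, (u : ℕ) < k + 1 → ∃ d₁ d₂, ∃ i < j, I.proj u d₁ = I.proj u d₂ ∧
          mate ((u : ℕ) : ℤ) = num (I.proj u d₁) + (i * m : ℕ) ∧
          Function.update (s.arr aOut) (k : ℤ) c ((u : ℕ) : ℤ) = dirCode d₂ := by
        rintro _ ⟨d', hd', rfl⟩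
        exact ⟨e6.of_eq (by simp) (by simp) fun d => by cases d <;> simp [dirArr], hout d' hd'⟩
      simp only [wp_ite, wp_store, Test.Holds, Expr.eval, e2, p1, p2, p3]
      refine ⟨fun c1 => ?_, fun c1 => ⟨fun c2 => ?_, fun c2 => ⟨fun c3 => ?_, fun c3 => ?_⟩⟩⟩
      · obtain ⟨f1, f2⟩ := hfin 0 ⟨.left, c1, rfl⟩
        refine ⟨e2, e3, ⟨f1, e4, by simpa [e5] using f2⟩, by simp; omega⟩
      · obtain ⟨f1, f2⟩ := hfin 1 ⟨.right, c2, rfl⟩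
        refine ⟨e2, e3, ⟨f1, e4, by simpa [e5] using f2⟩, by simp; omega⟩
      · obtain ⟨f1, f2⟩ := hfin 2 ⟨.down, c3, rfl⟩
        refine ⟨e2, e3, ⟨f1, e4, by simpa [e5] using f2⟩, by simp; omega⟩
      · obtain ⟨f1, f2⟩ := hfin 3 ⟨.up, by rw [hup c1 c2 c3], rfl⟩
        refine ⟨e2, e3, ⟨f1, e4, by simpa [e5] using f2⟩, by simp; omega⟩
  · exact ⟨h.of_eq (by simp) (by simp) fun d => by simp, by simp [hM], fun u hu => by omega⟩
  · rintro t s' ⟨⟨-, -, h3⟩, -, -, ht⟩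
    refine ⟨fun u => h3 u u.2, ?_⟩
    simp at ht
    have : (0 : ℤ) ≤ n * j := by positivity
    linarith

/-! ### The main loop: invariant, number of iterations, time -/

theorem vertex_injOn_edges {s : State} (h : Ready I num m s) (j : ℕ) :
    Set.InjOn (vertex num m) {p : (ℤ × ℤ) × Fin j | ∃ e ∈ I.edges j, e.2 = p} := by
  refine (vertex_bijOn h j).injOn.mono ?_
  rintro _ ⟨⟨u, v, i⟩, he, rfl⟩
  obtain ⟨d, hd⟩ := I.mem_edges.1 he
  exact (SEP.mem_copies I).2 ⟨u, d, hd⟩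

/-- A maximum matching of the numbered graph has size `n` if the instance graph has a matching of
that size. -/
theorem card_eq_of_isMatching {s : State} (h : Ready I num m s) {M : Finset (ℕ × ℕ)}
    (hM : Bipartite.IsMaximumMatching (numberedEdges I num m j) M)
    {M' : Finset (Fin n × ((ℤ × ℤ) × Fin j))} (hM' : Bipartite.IsMatching (I.edges j) M')
    (hcard : M'.card = n) : M.card = n := by
  refine le_antisymm ?_ ?_
  · have := Finset.card_le_card_of_injOn (s := M) (t := Finset.range n) Prod.fst
      (fun e he => ?_) fun e he e' he' heq => hM.1.2 e he e' he' (Or.inl heq)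
    · simpa using this
    · obtain ⟨e', -, rfl⟩ := Finset.mem_image.1 (hM.1.1 he)
      simp
  · obtain ⟨h1, h2⟩ := hM'.image (f := fun u : Fin n => (u : ℕ)) Fin.val_injective
      (vertex_injOn_edges h j)
    exact hcard ▸ h2 ▸ hM.2 _ h1

/-- The invariant of the main loop: the state after `j` iterations. -/
structure LoopInv (I : SEP n) (num : ℤ × ℤ → ℕ) (m j : ℕ) (s : State) : Prop where
  ready : Ready I num m s
  reg_k : s.reg rK = j
  start : j = 0 → s.reg rSize = -1
  matching : 1 ≤ j → ∃ M, Bipartite.IsMaximumMatching (numberedEdges I num m j) M ∧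
    HoldsMatching s n M
  not_matching : ∀ i, 1 ≤ i → i < j → ¬ ∃ M : Finset (Fin n × ((ℤ × ℤ) × Fin i)),
    Bipartite.IsMatching (I.edges i) M ∧ M.card = n

theorem LoopInv.size_eq {s : State} (h : LoopInv I num m j s) (hj : 1 ≤ j)
    (hM : ∃ M : Finset (Fin n × ((ℤ × ℤ) × Fin j)),
      Bipartite.IsMatching (I.edges j) M ∧ M.card = n) : s.reg rSize = n := by
  obtain ⟨M, h1, h2⟩ := h.matching hj
  obtain ⟨M', h3, h4⟩ := hM
  rw [h2.size, card_eq_of_isMatching h.ready h1 h3 h4]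

/-- Otherwise `j ≥ 1`, and the graph of iteration `j` has a matching of size `n`; the computed one
then has size `n` too, and the test fails. -/
theorem LoopInv.lt_optDensity {s : State} (hn : 1 ≤ n) (h : LoopInv I num m j s)
    (ht : loopTest.Holds s) : j < I.optDensity := by
  by_contra! hle
  simp only [loopTest, Test.Holds, Expr.eval, h.ready.reg_n] at ht
  exact ht.2 (h.size_eq ((I.one_le_optDensity hn).trans hle) (I.exists_matching hle))

/-- One iteration of the main loop. -/
theorem LoopInv.step {s : State} (h : LoopInv I num m j s) (ht : loopTest.Holds s) :
    ∃ (t t' : ℕ) (s' s'' : State), Exec prepare s t s' ∧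
      HoldsGraph s' n ((j + 1) * m) (numberedEdges I num m (j + 1)) ∧
      Exec Matching.maximumMatching s' t' s'' ∧ LoopInv I num m (j + 1) s'' ∧
      (t : ℤ) ≤ 300 * (n * (j + 1) + n + j + 1) ∧
      (t' : ℤ) ≤ 1000 * (4 * (j + 1) * n + n + (j + 1) * m + 1) * (Nat.sqrt n + 1) := by
  have hprep : WP prepare s fun t s' => Ready I num m s' ∧ s'.reg rK = (j + 1 : ℕ) ∧
      HoldsGraph s' n ((j + 1) * m) (numberedEdges I num m (j + 1)) ∧
      s'.arr aOff n = 4 * ((j + 1) * n : ℕ) ∧ (t : ℤ) ≤ 300 * (n * (j + 1) + n + j + 1) := by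
    simp only [prepare, wp_seq, wp_assign]
    have h0 : Ready I num m (s.setReg rK (j + 1 : ℕ)) :=
      h.ready.of_eq (by simp) (by simp) fun d => by simp
    have e : Expr.eval (.add (.reg rK) (.lit 1)) s = (j + 1 : ℕ) := by simp [h.reg_k]
    rw [e]
    refine (wp_buildGraph h0 (j := j + 1) (by simp)).mono_frame ?_
    rintro t s' hr harr ⟨h1, h2, h3, h4, h5⟩
    have h6 : Ready I num m s' := h0.of_eq (hr _ (by decide)) (hr _ (by decide))
      fun d => harr _ (by cases d <;> decide)
    refine ⟨h6, (hr _ (by decide)).trans (by simp), holdsGraph h6 h1 h2 h3 h4, h3 n le_rfl, ?_⟩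
    simp
    push_cast at h5
    have : (0 : ℤ) ≤ n * (j + 1) := by positivity
    linarith
  obtain ⟨t, s', he, h1, h2, h3, h4, h5⟩ := hprep
  obtain ⟨t', s'', M, he', hM, hs'', hr, harr, ht'⟩ := Matching.wp_maximumMatching h3
  refine ⟨t, t', s', s'', he, h3, he', ⟨?_, ?_, ?_, ?_, ?_⟩, h5, ?_⟩
  · exact h1.of_eq (hr _ (by decide) (by decide)) (hr _ (by decide) (by decide))
      fun d => harr _ (by cases d <;> decide) (by cases d <;> decide)
  · rw [hr _ (by decide) (by decide), h2]
  · intro h0; omega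
  · exact fun _ => ⟨M, hM, hs''⟩
  · intro i hi hij hex
    rcases Nat.lt_succ_iff_lt_or_eq.1 hij with hij | rfl
    · exact h.not_matching i hi hij hex
    · simp only [loopTest, Test.Holds, Expr.eval, h.ready.reg_n] at ht
      exact ht.2 (h.size_eq hi hex)
  · rw [h4] at ht'
    push_cast at ht' ⊢
    linarith

/-- Determinism identifies each given state with the one for which the invariant was established. -/
theorem loopInv_of_atLoop {t : ℕ} {s₀ : State} (he : Exec prologue (init I) t s₀)
    (h₀ : LoopInv I num m 0 s₀) {s : State}
    (h : AtLoop Matching.maximumMatching I j s) : LoopInv I num m j s := by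
  induction h with
  | start he' => exact (he.deterministic he').2 ▸ h₀
  | step _ ht he' ih =>
    obtain ⟨_, _, _, _, h1, -, h2, h3, -⟩ := ih.step ht
    exact ((h1.seq h2).deterministic he').2 ▸ h3

theorem exists_loopInv (I : SEP n) : ∃ (t : ℕ) (s : State) (num : ℤ × ℤ → ℕ) (m : ℕ),
    Exec prologue (init I) t s ∧ LoopInv I num m 0 s ∧ (t : ℤ) ≤ 300 * n + 40 := by
  obtain ⟨t, s, he, ht, h1, h2, num, m, h3⟩ := wp_prologue I
  exact ⟨t, s, num, m, he, ⟨h3, h1, fun _ => h2, fun h => by omega, fun i h h' => by omega⟩, ht⟩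

theorem Ready.le {s : State} (h : Ready I num m s) : m ≤ 4 * n := by
  have h1 : (boundary I).card = m := by
    have := Finset.card_nbij (s := boundary I) (t := Finset.range m) num
      (fun v hv => Finset.mem_coe.2 (Finset.mem_range.2 (h.bijOn.mapsTo hv))) h.bijOn.injOn
      (by simpa using h.bijOn.surjOn)
    simpa using this
  rw [← h1]
  refine Finset.card_biUnion_le.trans ?_
  calc _ ≤ ∑ _u : Fin n, 4 := Finset.sum_le_sum fun u _ => Finset.card_le_four
    _ = 4 * n := by simp [mul_comm]

/-- The time for a maximum matching in the instance graph. -/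
theorem LoopInv.matching_time {s : State} (hn : 1 ≤ n) (h : LoopInv I num m j s) {t : ℤ}
    (ht : t ≤ 1000 * (4 * (j + 1) * n + n + (j + 1) * m + 1) * (Nat.sqrt n + 1)) :
    t ≤ 20000 * ((j + 1) * n) * Nat.sqrt n := by
  have hm : (m : ℤ) ≤ 4 * n := by exact_mod_cast h.ready.le
  have hq : (1 : ℤ) ≤ Nat.sqrt n := by exact_mod_cast Nat.sqrt_pos.2 hn
  have hn' : (1 : ℤ) ≤ n := by exact_mod_cast hn
  have h1 : ((j : ℤ) + 1) * m ≤ (j + 1) * (4 * n) := mul_le_mul_of_nonneg_left hm (by positivity)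
  have h2 : (n : ℤ) ≤ (j + 1) * n := le_mul_of_one_le_left (by positivity) (by omega)
  refine ht.trans ?_
  -- The factor 10 is `4 + 1 + 4 + 1`, since `m ≤ 4n` and both `n` and 1 are at most `(j + 1) n`;
  -- moreover `√n + 1 ≤ 2√n`, also for the rounded root.
  calc _ ≤ (1000 * (10 * ((j + 1) * n)) * (2 * Nat.sqrt n) : ℤ) :=
        mul_le_mul (by linarith) (by omega) (by positivity) (by positivity)
    _ = _ := by ring

/-- The output of the algorithm is correct. -/
theorem LoopInv.wp_extract {s : State} (hn : 1 ≤ n) (h : LoopInv I num m j s)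
    (ht : ¬ loopTest.Holds s) :
    WP extract s fun t s' => HoldsOutput I s' ∧ (t : ℤ) ≤ 100 * (n * j + n + 1) := by
  have hsize : s.reg rSize = n := by
    simp only [loopTest, Test.Holds, Expr.eval, h.ready.reg_n, h.reg_k, not_and, not_not] at ht
    -- For `j < n` the loop was left because of the size. Otherwise `j ≥ n ≥ optDensity`, and a
    -- matching of size `n` exists anyway.
    by_cases hj : j < n
    · exact ht (by omega)
    · have hle : I.optDensity ≤ j := I.optDensity_le.trans (not_lt.1 hj)
      exact h.size_eq (by omega) (I.exists_matching hle)
  -- The initial value `-1` of `rSize` cannot be mistaken for `n`.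
  have hj : 1 ≤ j := Nat.one_le_iff_ne_zero.2 fun h0 => by
    have := h.start h0
    omega
  obtain ⟨M, hM, hs⟩ := h.matching hj
  obtain ⟨h1, h2⟩ := hM.1.preimage Fin.val_injective (vertex_injOn_edges h.ready j)
    (f := fun u : Fin n => (u : ℕ))
  set M' := (I.edges j).filter fun e => Prod.map (fun u : Fin n => (u : ℕ)) (vertex num m) e ∈ M
    with hM'
  have hcard : M'.card = n := by
    have := hs.size
    rw [h2]
    omega
  have hmem : ∀ (u : Fin n) (d : Dir) (i : Fin j), (u, (I.proj u d, i)) ∈ M' ↔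
      s.arr aMate ((u : ℕ) : ℤ) = num (I.proj u d) + ((i : ℕ) * m : ℕ) := by
    intro u d i
    rw [hM', Finset.mem_filter, I.mem_edges, Prod.map, hs.mem_iff _ u.2]
    simp only [vertex]
    push_cast
    exact ⟨fun h => h.2, fun h => ⟨⟨d, rfl⟩, h⟩⟩
  have hall : ∀ u : Fin n, ∃ d, ∃ i : Fin j, (u, (I.proj u d, i)) ∈ M' := by
    -- Distinct edges of a matching have distinct first endpoints, so `n` edges reach all `n`
    -- points.
    have himg : M'.image Prod.fst = Finset.univ := by
      rw [← Finset.card_eq_iff_eq_univ, Fintype.card_fin, Finset.card_image_of_injOn, hcard]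
      exact fun e he e' he' heq => h1.2 e he e' he' (Or.inl heq)
    intro u
    obtain ⟨⟨u', v, i⟩, he, rfl⟩ := Finset.mem_image.1 (himg ▸ Finset.mem_univ u)
    obtain ⟨d, rfl⟩ := I.mem_edges.1 (h1.1 he)
    exact ⟨d, i, he⟩
  refine (Approx.wp_extract h.ready (fun u => ?_) hn (j := j)).mono_frame ?_
  · obtain ⟨d, i, hdi⟩ := hall u
    exact ⟨d, i, i.2, (hmem u d i).1 hdi⟩
  · rintro t s' hr - ⟨h3, h4⟩
    choose d d' i hi hd hmate hout using h3
    refine ⟨⟨j, M', d', ⟨⟨hj, M', h1, hcard⟩, fun i hi => ?_⟩, h1, hcard, fun u => ?_, ?_, hout⟩, h4⟩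
    · by_contra! hlt
      exact h.not_matching i hi.1 hlt hi.2
    · refine ⟨⟨i u, hi u⟩, ?_⟩
      rw [← hd u, hmem]
      exact hmate u
    · rw [hr _ (by decide), h.reg_k]

/-- The running time of the algorithm. -/
theorem wp_approx (hn : 1 ≤ n) (I : SEP n) :
    WP (approx Matching.maximumMatching) (init I) fun t s => HoldsOutput I s ∧
      (t : ℤ) ≤ 30000 * (n * Nat.sqrt n * I.optDensity ^ 2) := by
  obtain ⟨t₀, s₀, num, m, he, h₀, ht₀⟩ := exists_loopInv I
  have hk := I.one_le_optDensity hn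
  have hq : (1 : ℤ) ≤ Nat.sqrt n := by exact_mod_cast Nat.sqrt_pos.2 hn
  have hn' : (1 : ℤ) ≤ n := by exact_mod_cast hn
  generalize hkdef : I.optDensity = k at *
  have hk' : (1 : ℤ) ≤ k := by exact_mod_cast hk
  have hnk : (1 : ℤ) ≤ n * k := by nlinarith
  have hnkq : (n : ℤ) * k ≤ n * k * Nat.sqrt n := le_mul_of_one_le_right (by omega) hq
  have hkn : (k : ℤ) ≤ n * k := le_mul_of_one_le_left (by omega) hn'
  have hnn : (n : ℤ) ≤ n * k := le_mul_of_one_le_right (by omega) hk'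
  have hloop : WP (.while loopTest (prepare ;; Matching.maximumMatching)) s₀ fun t s =>
      (∃ j, j ≤ k ∧ LoopInv I num m j s) ∧ ¬ loopTest.Holds s ∧
        (t : ℤ) ≤ 22000 * (n * k * Nat.sqrt n) * k + 20 := by
    refine (wp_while (fun s => ∃ j, j ≤ k ∧ LoopInv I num m j s)
      -- Each remaining iteration has the same budget: 20000 units for the matching, the rest for
      -- the graph and the test. Up to `k` iterations account for the second factor `k`.
      (fun s => 22000 * (n * k * Nat.sqrt n) * (k - s.reg rK)) ?_ ?_ ⟨0, by omega, h₀⟩).mono ?_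
    · rintro s ⟨j, hj, h⟩
      rw [h.reg_k]
      exact mul_nonneg (by positivity) (by omega)
    · rintro s ⟨j, hj, h⟩ ht
      have hlt := h.lt_optDensity hn ht
      rw [hkdef] at hlt
      obtain ⟨t, t', s', s'', h1, -, h2, h3, h4, h5⟩ := h.step ht
      refine ⟨t + t', s'', h1.seq h2, ⟨j + 1, hlt, h3⟩, ?_⟩
      have h6 := h.matching_time hn h5
      rw [h.reg_k, h3.reg_k]
      simp only [loopTest, Test.cost, Expr.cost]
      push_cast
      have h7 : ((j : ℤ) + 1) * n ≤ n * k := by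
        rw [mul_comm]; exact mul_le_mul_of_nonneg_left (by omega) (by omega)
      have h8 : ((j : ℤ) + 1) * n * Nat.sqrt n ≤ n * k * Nat.sqrt n :=
        mul_le_mul_of_nonneg_right h7 (by omega)
      linarith
    · rintro t s ⟨h1, h2, h3⟩
      refine ⟨h1, h2, ?_⟩
      obtain ⟨j, hj, h⟩ := h1
      rw [h.reg_k, h₀.reg_k] at h3
      simp only [loopTest, Test.cost, Expr.cost] at h3
      have : (0 : ℤ) ≤ 22000 * (n * k * Nat.sqrt n) * (k - j) :=
        mul_nonneg (by positivity) (by omega)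
      push_cast at h3
      linarith
  obtain ⟨t₁, s₁, he₁, ⟨j, hj, h⟩, hnot, ht₁⟩ := hloop
  obtain ⟨t₂, s₂, he₂, hout, ht₂⟩ := h.wp_extract hn hnot
  refine ⟨_, s₂, he.seq (he₁.seq he₂), hout, ?_⟩
  have h1 : (n : ℤ) * j ≤ n * k := mul_le_mul_of_nonneg_left (by omega) (by omega)
  have h2 : (n : ℤ) * k * Nat.sqrt n ≤ n * k * Nat.sqrt n * k :=
    le_mul_of_one_le_right (by positivity) hk'
  have h3 : (n : ℤ) * Nat.sqrt n * k ^ 2 = n * k * Nat.sqrt n * k := by ring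
  rw [h3]
  push_cast
  linarith

end Approx

/-! ### The main theorem -/

theorem mainTheorem5 :
    ∃ mm : RAM.Prog, Approx.ComputesMaximumMatchings mm ∧
      ∃ C : ℝ, ∀ (n : ℕ) (I : SEP n), 1 ≤ n →
        -- the running time, and the output
        (∃ (t : ℕ) (s : RAM.State), RAM.Exec (Approx.approx mm) (Approx.init I) t s ∧
          Approx.HoldsOutput I s ∧
          (t : ℝ) ≤ C * (n : ℝ) ^ (3 / 2 : ℝ) * (I.optDensity : ℝ) ^ 2) ∧
        -- at most `k` iterations
        (∀ (j : ℕ) (s : RAM.State), Approx.AtLoop mm I j s → j ≤ I.optDensity) ∧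
        -- each iteration builds a graph with `O(kn)` edges and finds a maximum matching of it
        -- in time `O(√n |E|) = O(kn√n)`
        (∀ (j : ℕ) (s : RAM.State), Approx.AtLoop mm I j s → Approx.loopTest.Holds s →
          ∃ (t t' : ℕ) (s' s'' : RAM.State),
            RAM.Exec Approx.prepare s t s' ∧ Approx.HoldsInstanceGraph I (j + 1) s' ∧
            (I.edges (j + 1)).card ≤ 4 * I.optDensity * n ∧
            RAM.Exec mm s' t' s'' ∧
            (t' : ℝ) ≤ C * √(n : ℝ) * ((I.edges (j + 1)).card : ℝ) ∧
            (t' : ℝ) ≤ C * (I.optDensity : ℝ) * n * √(n : ℝ)) := by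
  refine ⟨Matching.maximumMatching, Matching.computesMaximumMatchings, 30000, fun n I hn => ?_⟩
  obtain ⟨t₀, s₀, num, m, he, h₀, -⟩ := Approx.exists_loopInv I
  have hsqrt : (Nat.sqrt n : ℝ) ≤ √(n : ℝ) := Real.nat_sqrt_le_real_sqrt
  refine ⟨?_, ?_, ?_⟩
  · obtain ⟨t, s, he, hout, ht⟩ := Approx.wp_approx hn I
    refine ⟨t, s, he, hout, ?_⟩
    have ht' : (t : ℝ) ≤ 30000 * (n * Nat.sqrt n * I.optDensity ^ 2) := by exact_mod_cast ht
    have hpow : (n : ℝ) ^ (3 / 2 : ℝ) = n * √(n : ℝ) := by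
      rw [Real.sqrt_eq_rpow, show (3 / 2 : ℝ) = 1 + 1 / 2 by norm_num,
        Real.rpow_add (by exact_mod_cast hn), Real.rpow_one]
    rw [hpow, mul_assoc]
    refine ht'.trans (mul_le_mul_of_nonneg_left ?_ (by norm_num))
    gcongr
  · intro j s h
    cases h with
    | start => exact Nat.zero_le _
    -- The last iteration started with the test satisfied after one iteration fewer, hence strictly
    -- below `optDensity`.
    | step h ht _ => exact (Approx.loopInv_of_atLoop he h₀ h).lt_optDensity hn ht
  · intro j s h ht
    have hinv := Approx.loopInv_of_atLoop he h₀ h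
    have hlt := hinv.lt_optDensity hn ht
    obtain ⟨t, t', s', s'', h1, h2, h3, -, -, h5⟩ := hinv.step ht
    have h6 := hinv.matching_time hn h5
    have h7 : (t' : ℝ) ≤ 20000 * ((j + 1) * n) * Nat.sqrt n := by exact_mod_cast h6
    have hle : 4 * (j + 1) * n ≤ 4 * I.optDensity * n := by gcongr; exact hlt
    refine ⟨t, t', s', s'', h1, ⟨(j + 1) * m, Approx.vertex num m,
      Approx.vertex_bijOn hinv.ready (j + 1), h2⟩, (I.card_edges_le (j + 1)).trans hle, h3, ?_, ?_⟩
    -- The time is bounded through `(j + 1) n`, which is at most the number of edges.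
    · have hE : ((j : ℝ) + 1) * n ≤ ((I.edges (j + 1)).card : ℝ) := by
        rw [mul_comm]; exact_mod_cast I.mul_le_card_edges (j + 1)
      calc (t' : ℝ) ≤ 20000 * ((j + 1) * n) * Nat.sqrt n := h7
        _ ≤ 30000 * ((I.edges (j + 1)).card : ℝ) * √(n : ℝ) := by gcongr; norm_num
        _ = _ := by ring
    · have hK : ((j : ℝ) + 1) ≤ I.optDensity := by exact_mod_cast hlt
      calc (t' : ℝ) ≤ 20000 * ((j + 1) * n) * Nat.sqrt n := h7
        _ ≤ 30000 * (I.optDensity * n) * √(n : ℝ) := by gcongr; norm_num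
        _ = _ := by ring
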